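/- **Conventions.** An inverse system $\mathbf X=(X_\lambda,p_{\lambda\lambda'},\Lambda)$ consists of topological spaces $X_\lambda$ and continuous bonding maps $p_{\lambda\lambda'}:X_{\lambda'}\to X_\lambda$ ($\lambda\le\lambda'$) with $p_{\lambda\lambda}=1$ and $p_{\lambda\lambda'}p_{\lambda'\lambda''}=p_{\lambda\lambda''}$, indexed by a non-empty directed preordered set $\Lambda$ in which every element has only finitely many predecessors. It is *in HPol* if every $X_\lambda$ has the homotopy type of a polyhedron (the realization of a simplicial complex with the weak topology). A space $X$ is identified with the system $(X)$ indexed by one point. All maps are continuous, and "for almost all $n$" means for all sufficiently large $n\in\mathbb N$. A *morphism* $\mathbf p^*:X\to\mathbf X$ of pro$^*$-Top from a space $X$ is given by maps $p^n_\lambda:X\to X_\lambda$ ($n\in\mathbb N$, $\lambda\in\Lambda$) such that for all $\lambda\le\lambda'$ one has $p_{\lambda\lambda'}p^n_{\lambda'}=p^n_\lambda$ for almost all $n$. For $\mathbf Y=(Y_\mu,q_{\mu\mu'},M)$ let $M_m$ be the set of multiindices $\bar\mu=(\mu_0\le\dots\le\mu_m)$, with face and degeneracy operators $d^j,s^j$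 (omit, respectively repeat, $\mu_j$), and let $d_j:\Delta^{m-1}\to\Delta^m$ and $s_j:\Delta^{m+1}\to\Delta^m$ be the usual face and degeneracy maps of the standard simplices. A *coarse coherent mapping* $\mathbf f^*=(f,f^n_{\bar\mu}):\mathbf X\to\mathbf Y$ consists of an increasing function $f:M\to\Lambda$ and maps $f^n_{\bar\mu}:X_{f(\mu_m)}\times\Delta^m\to Y_{\mu_0}$ ($n\in\mathbb N$, $m\ge0$, $\bar\mu\in M_m$) such that, for every $m$, $\bar\mu\in M_m$ and $0\le j\le m$, for almost all $n$ (how large may depend on $\bar\mu$) and all $x,t$, $$f^n_{\bar\mu}(x,d_jt)=\begin{cases}q_{\mu_0\mu_1}f^n_{d^0\bar\mu}(x,t)&j=0,\\ f^n_{d^j\bar\mu}(x,t)&0<j<m,\\ f^n_{d^m\bar\mu}(p_{f(\mu_{m-1})f(\mu_m)}(x),t)&j=m,\end{cases}\quad(m\ge1),\qquad f^n_{\bar\mu}(x,s_jt)=f^n_{s^j\bar\mu}(x,t).$$ Two such mappings $\mathbf f^*,\mathbf f'^*:\mathbf X\to\mathbf Y$ are *homotopic* if there is a coarse coherent mapping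 $\mathbf F^*=(F,F^n_{\bar\mu}):\mathbf X\times I\to\mathbf Y$, where $\mathbf X\times I=(X_\lambda\times I,p_{\lambda\lambda'}\times1,\Lambda)$, with $F\ge f,f'$ and such that, for every $\bar\mu$, for almost all $n$ and all $x,t$, $F^n_{\bar\mu}(x,0,t)=f^n_{\bar\mu}(p_{f(\mu_m)F(\mu_m)}(x),t)$ and $F^n_{\bar\mu}(x,1,t)=f'^n_{\bar\mu}(p_{f'(\mu_m)F(\mu_m)}(x),t)$. The category CCH has inverse systems as objects and homotopy classes $[\mathbf f^*]$ as morphisms. The composite $[\mathbf g^*][\mathbf f^*]$ of $\mathbf f^*:\mathbf X\to\mathbf Y$ and $\mathbf g^*:\mathbf Y\to\mathbf Z$ is represented by $\mathbf h^*$ with index function $h=fg$ for which, for every multiindex $\bar\nu=(\nu_0,\dots,\nu_m)$ of $\mathbf Z$ and almost all $n$, $$h^n_{\bar\nu}(x,t)=g^n_{\nu_0\dots\nu_i}\bigl(f^n_{g(\nu_i)\dots g(\nu_m)}(x,a_i(t)),b_i(t)\bigr)\quad\text{whenever } \textstyle\sum_{j<i}t_j\le\frac12\le\sum_{j\le i}t_j,$$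 where $a_i(t)=(1-2\sum_{j>i}t_j,2t_{i+1},\dots,2t_m)$ and $b_i(t)=(2t_0,\dots,2t_{i-1},1-2\sum_{j<i}t_j)$. For a morphism $\mathbf p^*:X\to\mathbf X$ as above, $\mathcal C^*(\mathbf p^*)$ is the class of the coarse coherent mapping $p^n_{\bar\lambda}(x,t)=p^n_{\lambda_0}(x)$. A morphism $\mathbf p^*:X\to\mathbf X$ of pro$^*$-Top is a *strong HPol$^*$-expansion* of $X$ if $\mathbf X$ is in HPol and, for every inverse system $\mathbf Z$ in HPol and every morphism $[\mathbf h^*]:X\to\mathbf Z$ of CCH, there is a unique morphism $[\mathbf f^*]:\mathbf X\to\mathbf Z$ of CCH with $[\mathbf h^*]=[\mathbf f^*]\,\mathcal C^*(\mathbf p^*)$. **Theorem.** Let $X$ and $Y$ be topological spaces, and let $\mathbf p^*=(p^n_\lambda):X\to\mathbf X=(X_\lambda,p_{\lambda\lambda'},\Lambda)$ and $\mathbf q^*=(q^n_\mu):Y\to\mathbf Y=(Y_\mu,q_{\mu\mu'},M)$ be morphisms of pro$^*$-Top. Suppose that $1\times\mathbf q^*=(1\times q^n_\mu):X\times Y\to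 X\times\mathbf Y=(X\times Y_\mu,1\times q_{\mu\mu'},M)$ is a strong HPol$^*$-expansion and that, for every $\mu\in M$, $\mathbf p^*\times1=(p^n_\lambda\times1):X\times Y_\mu\to\mathbf X\times Y_\mu=(X_\lambda\times Y_\mu,p_{\lambda\lambda'}\times1,\Lambda)$ is a strong HPol$^*$-expansion. Then $\mathbf p^*\times\mathbf q^*=(p^n_\lambda\times q^n_\mu):X\times Y\to\mathbf X\times\mathbf Y=(X_\lambda\times Y_\mu,p_{\lambda\lambda'}\times q_{\mu\mu'},\Lambda\times M)$ is a strong HPol$^*$-expansion. -/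

import Mathlib

open Filter

universe u

/-! ### Polyhedra and spaces having the homotopy type of a polyhedron -/

/-- The geometric realization `|K|` of an abstract simplicial complex `K`: barycentric coordinate
functions carried by a face of `K`. -/
def GeomRealization {V : Type u} (K : AbstractSimplicialComplex V) : Type u :=
  {t : V → ℝ // (∀ v, 0 ≤ t v) ∧
    ∃ s ∈ K.faces, (∀ v, v ∉ s → t v = 0) ∧ ∑ v ∈ s, t v = 1}

/-- The closed simplex of `|K|` spanned by `s`. -/
def GeomRealization.face {V : Type u} (K : AbstractSimplicialComplex V) (s : Finset V) : Type u :=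
  {x : GeomRealization K // ∀ v, v ∉ s → x.1 v = 0}

/-- The weak (CW) topology: each closed simplex carries its Euclidean topology, and `|K|` carries
the finest topology for which the inclusions of all closed simplices are continuous. -/
instance {V : Type u} (K : AbstractSimplicialComplex V) :
    TopologicalSpace (GeomRealization K) :=
  ⨆ s : K.faces, TopologicalSpace.coinduced
    (fun x : GeomRealization.face K s.1 => x.1)
    (TopologicalSpace.induced (fun x v => x.1.1 v) (inferInstance : TopologicalSpace (V → ℝ)))

/-- `X` belongs to `HPol`: it has the homotopy type of a polyhedron. -/
def IsHPol (X : Type u) [TopologicalSpace X] : Prop :=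
  ∃ (V : Type u) (K : AbstractSimplicialComplex V),
    Nonempty (ContinuousMap.HomotopyEquiv X (GeomRealization K))

/-! ### Inverse systems -/

/-- A cofinite inverse system of topological spaces `(X_λ, p_{λλ'}, Λ)` indexed by a directed
preordered set. Here `map h` is the bonding map `p_{λλ'} : X_{λ'} → X_λ` for `h : λ ≤ λ'`. -/
structure InvSystem : Type (u + 1) where
  Idx : Type u
  [preorder : Preorder Idx]
  nonempty : Nonempty Idx
  directed : ∀ i j : Idx, ∃ k, i ≤ k ∧ j ≤ k
  cofinite : ∀ i : Idx, (Set.Iic i).Finite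
  obj : Idx → Type u
  [top : ∀ i, TopologicalSpace (obj i)]
  map : ∀ {i j : Idx}, i ≤ j → C(obj j, obj i)
  map_id : ∀ (i : Idx) (x : obj i), map (le_refl i) x = x
  map_comp : ∀ {i j k : Idx} (hij : i ≤ j) (hjk : j ≤ k) (x : obj k),
    map hij (map hjk x) = map (hij.trans hjk) x

attribute [instance] InvSystem.preorder InvSystem.top

namespace InvSystem

/-- An inverse system in `HPol`: all terms have the homotopy type of a polyhedron. -/
def InHPol (X : InvSystem.{u}) : Prop := ∀ i, IsHPol (X.obj i)

/-- The rudimentary system `(X)`. -/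
abbrev rudimentary (X : Type u) [TopologicalSpace X] : InvSystem.{u} where
  Idx := PUnit.{u + 1}
  nonempty := ⟨PUnit.unit⟩
  directed _ _ := ⟨PUnit.unit, le_refl _, le_refl _⟩
  cofinite _ := Set.toFinite _
  obj _ := X
  map _ := ContinuousMap.id X
  map_id _ _ := rfl
  map_comp _ _ _ := rfl

/-- The system `𝐗 × I = (X_λ × I, p_{λλ'} × 1, Λ)`. -/
abbrev cylinder (X : InvSystem.{u}) : InvSystem.{u} where
  Idx := X.Idx
  nonempty := X.nonempty
  directed := X.directed
  cofinite := X.cofinite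
  obj i := X.obj i × unitInterval
  map h := (X.map h).prodMap (ContinuousMap.id _)
  map_id i x := Prod.ext (X.map_id i x.1) rfl
  map_comp hij hjk x := Prod.ext (X.map_comp hij hjk x.1) rfl

/-- The system `X × 𝐘 = (X × Y_μ, 1 × q_{μμ'}, M)` for a space `X`. -/
abbrev spaceProd (X : Type u) [TopologicalSpace X] (Y : InvSystem.{u}) : InvSystem.{u} where
  Idx := Y.Idx
  nonempty := Y.nonempty
  directed := Y.directed
  cofinite := Y.cofinite
  obj i := X × Y.obj i
  map h := (ContinuousMap.id X).prodMap (Y.map h)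
  map_id i x := Prod.ext rfl (Y.map_id i x.2)
  map_comp hij hjk x := Prod.ext rfl (Y.map_comp hij hjk x.2)

/-- The system `𝐗 × Y = (X_λ × Y, p_{λλ'} × 1, Λ)` for a space `Y`. -/
abbrev prodSpace (X : InvSystem.{u}) (Y : Type u) [TopologicalSpace Y] : InvSystem.{u} where
  Idx := X.Idx
  nonempty := X.nonempty
  directed := X.directed
  cofinite := X.cofinite
  obj i := X.obj i × Y
  map h := (X.map h).prodMap (ContinuousMap.id Y)
  map_id i x := Prod.ext (X.map_id i x.1) rfl
  map_comp hij hjk x := Prod.ext (X.map_comp hij hjk x.1) rfl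

/-- The system `𝐗 × 𝐘 = (X_λ × Y_μ, p_{λλ'} × q_{μμ'}, Λ × M)`. -/
abbrev prod (X Y : InvSystem.{u}) : InvSystem.{u} where
  Idx := X.Idx × Y.Idx
  nonempty := ⟨(X.nonempty.some, Y.nonempty.some)⟩
  directed i j := by
    obtain ⟨a, ha, ha'⟩ := X.directed i.1 j.1
    obtain ⟨b, hb, hb'⟩ := Y.directed i.2 j.2
    exact ⟨(a, b), ⟨ha, hb⟩, ⟨ha', hb'⟩⟩
  cofinite i := by
    rw [← Set.Iic_prod_Iic i.1 i.2]
    exact (X.cofinite i.1).prod (Y.cofinite i.2)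
  obj i := X.obj i.1 × Y.obj i.2
  map h := (X.map (Prod.le_def.1 h).1).prodMap (Y.map (Prod.le_def.1 h).2)
  map_id i x := Prod.ext (X.map_id i.1 x.1) (Y.map_id i.2 x.2)
  map_comp hij hjk x := Prod.ext
    (X.map_comp (Prod.le_def.1 hij).1 (Prod.le_def.1 hjk).1 x.1)
    (Y.map_comp (Prod.le_def.1 hij).2 (Prod.le_def.1 hjk).2 x.2)

end InvSystem

/-! ### Coarse coherent mappings -/

/-- The standard simplex `Δ^m`. -/
abbrev Simplex (m : ℕ) : Type := stdSimplex ℝ (Fin (m + 1))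

/-- Multiindices `μ₀ ≤ ⋯ ≤ μ_m` of length `m`. -/
abbrev MultiIndex (M : Type u) [Preorder M] (m : ℕ) : Type u := Fin (m + 1) →o M

/-- `δ_j : {0,…,m} → {0,…,m+1}` omits the value `j`. Precomposition with it is the face operator
`d^j` on multiindices, and push-forward along it is the face operator `d_j : Δ^m → Δ^{m+1}`,
which inserts the coordinate `0` at the place `j`. -/
abbrev coface {m : ℕ} (j : Fin (m + 2)) : Fin (m + 1) →o Fin (m + 2) :=
  (Fin.succAboveOrderEmb j).toOrderHom

/-- `σ_j : {0,…,m+1} → {0,…,m}` takes the value `j` twice. Precomposition with it is the degeneracy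
operator `s^j` on multiindices, and push-forward along it is the degeneracy operator
`s_j : Δ^{m+1} → Δ^m`, which adds the coordinates at the places `j` and `j+1`. -/
abbrev codegeneracy {m : ℕ} (j : Fin (m + 1)) : Fin (m + 2) →o Fin (m + 1) :=
  Fin.predAboveOrderHom j

/-- A family of mappings `f^n_μ̄ : X_{f(μ_m)} × Δ^m → Y_{μ₀}` over an increasing index function. -/
abbrev CoherentFamily (X Y : InvSystem.{u}) (f : Y.Idx →o X.Idx) : Type u :=
  ℕ → ∀ {m : ℕ} (μ : MultiIndex Y.Idx m),
    C(X.obj (f (μ (Fin.last m))) × Simplex m, Y.obj (μ 0))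

/-- For all large `n`,
`f^n_μ̄(x, θ_* t) = q_{μ₀ μ_θ(0)} (f^n_{μ̄θ}(p_{f(μ_θ(k)) f(μ_m)} x, t))`
for all `x ∈ X_{f(μ_m)}` and `t ∈ Δ^k`. A bonding map whose two indices are equal is the
identity; hence, if `θ` is a coface map `δ_j`, this is the face condition with its three cases
(for `j = 0` only the map `q` remains, for `0 < j < m` neither, for `j = m` only the map `p`), and
if `θ` is a codegeneracy map `σ_j`, both bonding maps are identities. -/
def CohAt {X Y : InvSystem.{u}} {f : Y.Idx →o X.Idx} (F : CoherentFamily X Y f) {m k : ℕ}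
    (μ : MultiIndex Y.Idx m) (θ : Fin (k + 1) →o Fin (m + 1)) : Prop :=
  ∀ᶠ n in atTop, ∀ (x : X.obj (f (μ (Fin.last m)))) (t : Simplex k),
    F n μ (x, stdSimplex.map θ t) =
      Y.map (μ.monotone (Fin.zero_le (θ 0)))
        (F n (μ.comp θ) (X.map (f.monotone (μ.monotone (Fin.le_last (θ (Fin.last k))))) x, t))

/-- A coarse coherent mapping `𝐟* = (f, f^n_μ̄) : 𝐗 → 𝐘`. -/
structure CoarseCoherentMap (X Y : InvSystem.{u}) : Type u where
  idx : Y.Idx →o X.Idx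
  maps : CoherentFamily X Y idx
  face : ∀ {m : ℕ} (μ : MultiIndex Y.Idx (m + 1)) (j : Fin (m + 2)), CohAt maps μ (coface j)
  degeneracy : ∀ {m : ℕ} (μ : MultiIndex Y.Idx m) (j : Fin (m + 1)),
    CohAt maps μ (codegeneracy j)

namespace CoarseCoherentMap

/-- `𝐟* ≃ 𝐟'*`: they are connected by a coarse coherent homotopy `𝐗 × I → 𝐘`. The morphisms
`𝐗 → 𝐘` of the coarse coherent homotopy category `CCH` are the classes of this relation. -/
def Homotopic {X Y : InvSystem.{u}} (f f' : CoarseCoherentMap X Y) : Prop :=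
  ∃ (F : CoarseCoherentMap X.cylinder Y)
    (h : ∀ μ, f.idx μ ≤ F.idx μ) (h' : ∀ μ, f'.idx μ ≤ F.idx μ),
    ∀ {m : ℕ} (μ : MultiIndex Y.Idx m), ∀ᶠ n in atTop,
      ∀ (x : X.obj (F.idx (μ (Fin.last m)))) (t : Simplex m),
        F.maps n μ ((x, 0), t) = f.maps n μ (X.map (h (μ (Fin.last m))) x, t) ∧
        F.maps n μ ((x, 1), t) = f'.maps n μ (X.map (h' (μ (Fin.last m))) x, t)

end CoarseCoherentMap

/-! ### Composition -/

/-- The inclusion of `{0,…,i}` as the first `i + 1` elements of `{0,…,i+k}`. -/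
def frontIncl (i k : ℕ) : Fin (i + 1) →o Fin (i + k + 1) where
  toFun := Fin.castLE (by omega)
  monotone' _ _ h := h

/-- The inclusion of `{0,…,k}` as the last `k + 1` elements `i,…,i+k` of `{0,…,i+k}`. -/
def backIncl (i k : ℕ) : Fin (k + 1) →o Fin (i + k + 1) where
  toFun := Fin.natAdd i
  monotone' _ _ h := Nat.add_le_add_left h i

/-- `t_0 + ⋯ + t_{i-1}`, for `t ∈ Δ^{i+k}`. -/
noncomputable def sumBefore {i k : ℕ} (t : Simplex (i + k)) : ℝ :=
  ∑ j : Fin i, t.1 (frontIncl i k j.castSucc)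

/-- `t_{i+1} + ⋯ + t_{i+k}`, for `t ∈ Δ^{i+k}`. -/
noncomputable def sumAfter {i k : ℕ} (t : Simplex (i + k)) : ℝ :=
  ∑ j : Fin k, t.1 (backIncl i k j.succ)

/-- The subpolyhedron `P_i^m` of `Δ^m`, where `m = i + k`:
`t_0 + ⋯ + t_{i-1} ≤ 1/2 ≤ t_0 + ⋯ + t_i`. -/
def InPiece (i k : ℕ) (t : Simplex (i + k)) : Prop :=
  sumBefore t ≤ 1 / 2 ∧ 1 / 2 ≤ sumBefore t + t.1 (backIncl i k 0)

theorem sumBefore_add_sumAfter {i k : ℕ} (t : Simplex (i + k)) :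
    sumBefore t + (t.1 (backIncl i k 0) + sumAfter t) = 1 := by
  have h : ∑ j : Fin (i + (k + 1)), t.1 j = 1 := t.2.2
  rw [Fin.sum_univ_add, Fin.sum_univ_succ (n := k)] at h
  exact h

/-- `a_i^m(t) = (1 - 2(t_{i+1} + ⋯ + t_m), 2t_{i+1}, …, 2t_m)`, where `m = i + k`. -/
noncomputable def pieceA {i k : ℕ} (t : Simplex (i + k)) (ht : InPiece i k t) : Simplex k :=
  ⟨Fin.cons (1 - 2 * sumAfter t) (fun j : Fin k => 2 * t.1 (backIncl i k j.succ)), by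
    constructor
    · refine Fin.cases ?_ fun j => ?_
      · have h := sumBefore_add_sumAfter t
        have h' := ht.2
        simp only [Fin.cons_zero]
        linarith
      · simp only [Fin.cons_succ]
        have := t.2.1 (backIncl i k j.succ)
        linarith
    · rw [Fin.sum_cons, ← Finset.mul_sum]
      exact sub_add_cancel _ _⟩

/-- `b_i^m(t) = (2t_0, …, 2t_{i-1}, 1 - 2(t_0 + ⋯ + t_{i-1}))`, where `m = i + k`. -/
noncomputable def pieceB {i k : ℕ} (t : Simplex (i + k)) (ht : InPiece i k t) : Simplex i :=
  ⟨Fin.snoc (α := fun _ => ℝ) (fun j : Fin i => 2 * t.1 (frontIncl i k j.castSucc))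
      (1 - 2 * sumBefore t), by
    constructor
    · refine Fin.lastCases ?_ fun j => ?_
      · have h' := ht.1
        simp only [Fin.snoc_last]
        linarith
      · simp only [Fin.snoc_castSucc]
        have := t.2.1 (frontIncl i k j.castSucc)
        linarith
    · rw [Fin.sum_univ_castSucc]
      simp only [Fin.snoc_castSucc, Fin.snoc_last, ← Finset.mul_sum]
      exact add_sub_cancel _ _⟩

theorem frontIncl_last_le (i k : ℕ) : frontIncl i k (Fin.last i) ≤ backIncl i k 0 :=
  Fin.le_def.2 (by change i ≤ i + 0; omega)

/-- `𝐡*` is a composite `𝐠* 𝐟*`: its index function is `fg`, and for all large `n`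
`h^n_ν̄(x, t) = g^n_{ν₀…ν_i}(f^n_{g(ν_i)…g(ν_m)}(x, a_i^m(t)), b_i^m(t))` for `t ∈ P_i^m`,
where `m = i + k`. The bonding maps written here have equal indices, so they are identities. -/
def CoarseCoherentMap.IsComp {X Y Z : InvSystem.{u}} (g : CoarseCoherentMap Y Z)
    (f : CoarseCoherentMap X Y) (h : CoarseCoherentMap X Z) : Prop :=
  ∃ e : ∀ ν, h.idx ν = f.idx (g.idx ν),
    ∀ (i k : ℕ) (ν : MultiIndex Z.Idx (i + k)), ∀ᶠ n in atTop,
      ∀ (x : X.obj (h.idx (ν (Fin.last (i + k))))) (t : Simplex (i + k)) (ht : InPiece i k t),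
        h.maps n ν (x, t) =
          g.maps n (ν.comp (frontIncl i k))
            (Y.map (g.idx.monotone (ν.monotone (frontIncl_last_le i k)))
              (f.maps n (g.idx.comp (ν.comp (backIncl i k)))
                (X.map ((f.idx.monotone (g.idx.monotone (ν.monotone (Fin.le_last _)))).trans
                  (e _).ge) x, pieceA t ht)),
              pieceB t ht)

/-! ### Morphisms from a space to an inverse system and strong expansions -/

/-- A morphism `𝐩* : X → 𝐗` of pro*-Top from a space to an inverse system, given by mappings
`p^n_λ : X → X_λ` such that, for `λ ≤ λ'`, `p_{λλ'} p^n_{λ'} = p^n_λ` for all large `n`. -/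
structure CoarseMorphism (X : Type u) [TopologicalSpace X] (S : InvSystem.{u}) : Type u where
  maps : ℕ → ∀ i : S.Idx, C(X, S.obj i)
  comm : ∀ {i j : S.Idx} (h : i ≤ j), ∀ᶠ n in atTop, ∀ x, S.map h (maps n j x) = maps n i x

namespace CoarseMorphism

/-- The coarse coherent functor: `C*(𝐩*)` is represented by `p^n_λ̄(x, t) = p^n_{λ₀}(x)`. -/
def toCoherent {X : Type u} [TopologicalSpace X] {S : InvSystem.{u}} (p : CoarseMorphism X S) :
    CoarseCoherentMap (InvSystem.rudimentary X) S where
  idx := ⟨fun _ => PUnit.unit, fun _ _ _ => le_refl _⟩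
  maps n _ μ := (p.maps n (μ 0)).comp ContinuousMap.fst
  face μ j := by
    filter_upwards [p.comm (μ.monotone (Fin.zero_le (coface j 0)))] with n hn x t
    exact (hn x).symm
  degeneracy μ j := by
    filter_upwards [p.comm (μ.monotone (Fin.zero_le (codegeneracy j 0)))] with n hn x t
    exact (hn x).symm

/-- `[𝐡*] = [𝐟*] C*(𝐩*)` in `CCH`. -/
def Factors {X : Type u} [TopologicalSpace X] {S Z : InvSystem.{u}} (p : CoarseMorphism X S)
    (h : CoarseCoherentMap (InvSystem.rudimentary X) Z) (f : CoarseCoherentMap S Z) : Prop :=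
  ∃ c : CoarseCoherentMap (InvSystem.rudimentary X) Z,
    f.IsComp p.toCoherent c ∧ h.Homotopic c

/-- `𝐩* : X → 𝐗` is a strong `HPol*`-expansion of `X`: `𝐗` is an inverse system in `HPol`, and for
every inverse system `𝐙` in `HPol` and every morphism `[𝐡*] : X → 𝐙` of `CCH` there is a unique
morphism `[𝐟*] : 𝐗 → 𝐙` of `CCH` such that `[𝐡*] = [𝐟*] C*(𝐩*)`. -/
def IsStrongExpansion {X : Type u} [TopologicalSpace X] {S : InvSystem.{u}}
    (p : CoarseMorphism X S) : Prop :=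
  S.InHPol ∧
    ∀ Z : InvSystem.{u}, Z.InHPol → ∀ h : CoarseCoherentMap (InvSystem.rudimentary X) Z,
      ∃ f : CoarseCoherentMap S Z, p.Factors h f ∧
        ∀ f' : CoarseCoherentMap S Z, p.Factors h f' → f'.Homotopic f

variable {X Y : Type u} [TopologicalSpace X] [TopologicalSpace Y] {S T : InvSystem.{u}}

/-- `1 × 𝐪* : X × Y → X × 𝐘`, given by the mappings `1 × q^n_μ`. -/
def oneProd (X : Type u) [TopologicalSpace X] (q : CoarseMorphism Y T) :
    CoarseMorphism (X × Y) (InvSystem.spaceProd X T) where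
  maps n i := (ContinuousMap.id X).prodMap (q.maps n i)
  comm h := by
    filter_upwards [q.comm h] with n hn x
    exact Prod.ext rfl (hn x.2)

/-- `𝐩* × 1 : X × Y → 𝐗 × Y`, given by the mappings `p^n_λ × 1`. -/
def prodOne (p : CoarseMorphism X S) (Y : Type u) [TopologicalSpace Y] :
    CoarseMorphism (X × Y) (S.prodSpace Y) where
  maps n i := (p.maps n i).prodMap (ContinuousMap.id Y)
  comm h := by
    filter_upwards [p.comm h] with n hn x
    exact Prod.ext (hn x.1) rfl

/-- `𝐩* × 𝐪* : X × Y → 𝐗 × 𝐘`, given by the mappings `p^n_λ × q^n_μ`. -/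
def prod (p : CoarseMorphism X S) (q : CoarseMorphism Y T) :
    CoarseMorphism (X × Y) (S.prod T) where
  maps n i := (p.maps n i.1).prodMap (q.maps n i.2)
  comm h := by
    filter_upwards [p.comm h.1, q.comm h.2] with n hn hn' x
    exact Prod.ext (hn x.1) (hn' x.2)

end CoarseMorphism

/-! ### Maps into and out of geometric realizations -/

namespace GeomRealization

variable {V : Type u} {K : AbstractSimplicialComplex V}

/-! The theorem becomes nearly formal once "strong expansion" is replaced by a condition on single
spaces. `ExtensionProperty` for p : A → S says: let K be compact with a frontier L along which
homotopies extend, let P be in HPol, and let the maps gⁿ : A × K → P factor over L through maps fⁿ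
on S_i × L. Then for some j ≥ i the fⁿ extend over S_j × K in such a way that, for almost all n, gⁿ
is homotopic relative to A × L to the extension composed with pⁿ_j. This condition passes to
products at once (`ExtensionProperty.prod`): it is applied to 1 × q*, which leads to a single term X
× Y_μ, then to p* × 1 over that Y_μ, and the two relative homotopies are concatenated. What remains
is that the extension property is equivalent to the universal property for systems S in HPol.

Universal property ⇒ extension property (`IsStrongExpansion.extensionProperty`). Maps A × K → P are
maps from A to a mapping space, so the universal property is applied to mapping spaces. The
difficulty is to keep homotopies fixed over L: existence yields a homotopy moving the values on L,
uniqueness yields another one bringing them back, and together they form a loop that need not be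
trivial. The remedy is to apply existence to all sequences of maps with the given values on L
simultaneously. They form the system of finite families of maps K → P with a common restriction to
L, whose term at ∅ consists of maps L → P. The loop depends only on the term at ∅, so it is known
before a member is selected; the member selected is g carried backwards around the loop. Its
factorization, carried forwards, solves the problem for g. The system must lie in HPol. Following
Milnor, a polyhedron is homotopy equivalent to an open subset of a normed space, the families with
values in that subset form an open subset of a normed space of maps, and an open subset of a normed
space is homotopy equivalent to the nerve of a cover by balls (`isHPol_of_isOpen`, `isHPol_eqMaps`).

Extension property ⇒ universal property (`ExtensionProperty.isStrongExpansion`). If the index set of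
Z is partially ordered, a coherent mapping is built over nondegenerate multiindices by induction on
their length: the faces prescribe the values on the boundary of Δ^m, and the extension property with
K = Δ^m, or K = Δ^m × [0,1] for uniqueness, fills the interior. Cofiniteness then permits an
increasing index function. For a preordered index set one passes to representatives of the
equivalence classes and back; a prism homotopy shows that this does not change homotopy classes.

Composition in CCH enters only through `factors_iff`: composing with C*(p*) amounts, up to homotopy,
to substituting pⁿ in the space variable. -/

instance (s : Finset V) : TopologicalSpace (face K s) :=
  TopologicalSpace.induced (fun x v => x.1.1 v) (inferInstance : TopologicalSpace (V → ℝ))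

theorem continuous_face_coord (s : Finset V) (v : V) :
    Continuous fun x : face K s => x.1.1 v :=
  (continuous_apply v).comp continuous_induced_dom

theorem continuous_face_val {s : Finset V} (hs : s ∈ K.faces) :
    Continuous fun x : face K s => x.1 := by
  refine continuous_iSup_rng (i := (⟨s, hs⟩ : K.faces)) ?_
  exact continuous_coinduced_rng

theorem continuous_dom_iff {Y : Type*} [TopologicalSpace Y] {f : GeomRealization K → Y} :
    Continuous f ↔ ∀ s ∈ K.faces, Continuous fun x : face K s => f x.1 := by
  constructor
  · exact fun h s hs => h.comp (continuous_face_val hs)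
  · intro h
    refine continuous_iSup_dom.2 fun s => ?_
    exact continuous_coinduced_dom.2 (h s.1 s.2)

theorem continuous_coord (v : V) : Continuous fun x : GeomRealization K => x.1 v :=
  continuous_dom_iff.2 fun s _ => continuous_face_coord s v

theorem continuous_of_forall_mem_face {T : Type*} [TopologicalSpace T] {s : Finset V}
    (hs : s ∈ K.faces) {F : T → GeomRealization K} (h : ∀ t, ∀ v ∉ s, (F t).1 v = 0)
    (hF : ∀ v, Continuous fun t => (F t).1 v) : Continuous F := by
  let G : T → face K s := fun t => ⟨F t, h t⟩
  have hG : Continuous G := continuous_induced_rng.2 (continuous_pi hF)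
  exact (continuous_face_val hs).comp hG

theorem exists_face (x : GeomRealization K) :
    ∃ s ∈ K.faces, (∀ v, v ∈ s ↔ x.1 v ≠ 0) := by
  classical
  obtain ⟨s, hs, h0, h1⟩ := x.2.2
  refine ⟨s.filter fun v => x.1 v ≠ 0, ?_, ?_⟩
  · refine (K.isRelLowerSet_faces hs).2 (Finset.filter_subset _ _) ?_
    by_contra h
    rw [Finset.not_nonempty_iff_eq_empty, Finset.filter_eq_empty_iff] at h
    rw [Finset.sum_eq_zero fun v hv => not_not.1 (h hv)] at h1
    exact zero_ne_one h1
  · intro v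
    simp only [Finset.mem_filter, and_iff_right_iff_imp]
    intro hv
    by_contra hvs
    exact hv (h0 v hvs)

theorem sum_eq_one_of_forall_notMem (x : GeomRealization K) {s : Finset V}
    (h : ∀ v ∉ s, x.1 v = 0) : ∑ v ∈ s, x.1 v = 1 := by
  classical
  obtain ⟨s', -, h0, h1⟩ := x.2.2
  exact ((Finset.sum_subset (Finset.subset_union_left (s₂ := s')) fun v _ hv => h v hv).trans
    (Finset.sum_subset (Finset.subset_union_right (s₁ := s)) fun v _ hv => h0 v hv).symm).trans h1

/-- Continuity of the coordinates alone does not suffice for the weak topology. Near a point only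
finitely many vertices occur, hence finitely many faces; the sets of points sent into each of these
faces form a finite closed cover, and into one face coordinatewise continuity is enough. -/
theorem continuous_of_locallyFinite {T : Type*} [TopologicalSpace T] {F : T → GeomRealization K}
    (hF : ∀ v, Continuous fun t => (F t).1 v)
    (hl : LocallyFinite fun v => Function.support fun t => (F t).1 v) : Continuous F := by
  classical
  rw [continuous_iff_continuousAt]
  intro x
  obtain ⟨O, hO, hfin⟩ := hl x
  suffices h : ContinuousOn F O from h.continuousAt hO
  rw [continuousOn_iff_continuous_domRestrict]
  let S := hfin.toFinset
  let ι := {τ : Finset V // τ ∈ S.powerset ∧ τ ∈ K.faces}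
  have : Finite ι := Set.Finite.subset (Finset.finite_toSet S.powerset) fun τ hτ => hτ.1
  let f : ι → Set O := fun τ => {y | ∀ v ∉ τ.1, (F y.1).1 v = 0}
  refine (locallyFinite_of_finite f).continuous ?_ ?_ ?_
  · rw [Set.eq_univ_iff_forall]
    intro y
    obtain ⟨s, hs, h⟩ := exists_face (F y.1)
    rw [Set.mem_iUnion]
    refine ⟨⟨s, ?_, hs⟩, fun v hv => not_not.1 fun h' => hv ((h v).2 h')⟩
    rw [Finset.mem_powerset]
    intro v hv
    exact hfin.mem_toFinset.2 ⟨y.1, (h v).1 hv, y.2⟩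
  · intro τ
    simp only [f, Set.ofPred_forall]
    exact isClosed_iInter fun v => isClosed_iInter fun _ =>
      isClosed_eq ((hF v).comp continuous_subtype_val) continuous_const
  · intro τ
    rw [continuousOn_iff_continuous_domRestrict]
    refine continuous_of_forall_mem_face τ.2.2 (fun t v hv => t.2 v hv) fun v => ?_
    exact (hF v).comp (continuous_subtype_val.comp continuous_subtype_val)

/-- The point of `|K|` with barycentric coordinates proportional to `w`. -/
noncomputable def normalize (w : V → ℝ) (h0 : ∀ v, 0 ≤ w v)
    (hs : ∃ s ∈ K.faces, ∀ v ∉ s, w v = 0) (hp : ∃ v, 0 < w v) : GeomRealization K :=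
  ⟨fun v => w v / ∑ᶠ v, w v, fun v => div_nonneg (h0 v) (finsum_nonneg h0), by
    obtain ⟨s, hs, h⟩ := hs
    refine ⟨s, hs, fun v hv => by simp only [h v hv, zero_div], ?_⟩
    have hsum : ∑ᶠ v, w v = ∑ v ∈ s, w v :=
      finsum_eq_sum_of_support_subset _ fun v hv => by
        by_contra hvs
        exact hv (h v hvs)
    rw [← Finset.sum_div, hsum, div_self]
    obtain ⟨v, hv⟩ := hp
    have hvs : v ∈ s := by
      by_contra hvs
      rw [h v hvs] at hv
      exact lt_irrefl _ hv
    exact (Finset.sum_pos' (fun v _ => h0 v) ⟨v, hvs, hv⟩).ne'⟩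

theorem finsum_pos_of_face {w : V → ℝ} (h0 : ∀ v, 0 ≤ w v)
    (hs : ∃ s ∈ K.faces, ∀ v ∉ s, w v = 0) (hp : ∃ v, 0 < w v) : 0 < ∑ᶠ v, w v := by
  obtain ⟨s, -, h⟩ := hs
  obtain ⟨v, hv⟩ := hp
  refine finsum_pos h0 ⟨v, hv⟩ (s.finite_toSet.subset fun v hv => ?_)
  by_contra hvs
  exact hv (h v hvs)

/-- The straight segment between two points of a common simplex. -/
noncomputable def segment (x y : GeomRealization K)
    (h : ∃ s ∈ K.faces, ∀ v ∉ s, x.1 v = 0 ∧ y.1 v = 0) (r : unitInterval) : GeomRealization K :=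
  ⟨fun v => (1 - r.1) * x.1 v + r.1 * y.1 v,
    fun v => add_nonneg (mul_nonneg (sub_nonneg.2 r.2.2) (x.2.1 v)) (mul_nonneg r.2.1 (y.2.1 v)), by
    obtain ⟨s, hs, h⟩ := h
    refine ⟨s, hs, fun v hv => by simp only [(h v hv).1, (h v hv).2, mul_zero, add_zero], ?_⟩
    rw [Finset.sum_add_distrib, ← Finset.mul_sum, ← Finset.mul_sum,
      sum_eq_one_of_forall_notMem x fun v hv => (h v hv).1,
      sum_eq_one_of_forall_notMem y fun v hv => (h v hv).2]
    ring⟩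

theorem continuous_segment {T : Type*} [TopologicalSpace T] {f g : T → GeomRealization K}
    (hf : ∀ v, Continuous fun t => (f t).1 v) (hg : ∀ v, Continuous fun t => (g t).1 v)
    (hf' : LocallyFinite fun v => Function.support fun t => (f t).1 v)
    (hg' : LocallyFinite fun v => Function.support fun t => (g t).1 v)
    (h : ∀ t, ∃ s ∈ K.faces, ∀ v ∉ s, (f t).1 v = 0 ∧ (g t).1 v = 0) :
    Continuous fun p : unitInterval × T => segment (f p.2) (g p.2) (h p.2) p.1 := by
  refine continuous_of_locallyFinite (fun v => ?_) ?_
  · have h1 := (hf v).comp (continuous_snd : Continuous fun p : unitInterval × T => p.2)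
    have h2 := (hg v).comp (continuous_snd : Continuous fun p : unitInterval × T => p.2)
    have h3 : Continuous fun p : unitInterval × T => (p.1 : ℝ) := by fun_prop
    exact ((continuous_const.sub h3).mul h1).add (h3.mul h2)
  · intro p
    obtain ⟨O, hO, h1⟩ := hf' p.2
    obtain ⟨O', hO', h2⟩ := hg' p.2
    refine ⟨Prod.snd ⁻¹' (O ∩ O'), continuous_snd.continuousAt.preimage_mem_nhds
      (Filter.inter_mem hO hO'), (h1.union h2).subset ?_⟩
    rintro v ⟨q, hq, hqO⟩
    by_cases hv : (f q.2).1 v = 0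
    · refine Or.inr ⟨q.2, fun hv' => hq ?_, hqO.2⟩
      have hv'' : (g q.2).1 v = 0 := hv'
      simp only [segment, hv, hv'', mul_zero, add_zero]
    · exact Or.inl ⟨q.2, hv, hqO.1⟩

theorem locallyFinite_face (s : Finset V) :
    LocallyFinite fun v => Function.support fun t : face K s => t.1.1 v := fun _ =>
  ⟨Set.univ, Filter.univ_mem, s.finite_toSet.subset fun v ⟨t, ht, _⟩ => by
    by_contra hv
    exact ht (t.2 v hv)⟩

/-- The weak topology is compatible with the product by the interval because the interval is locally
compact: F is curried to a map into C(I, Y), whose continuity may be tested on faces. -/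
theorem continuous_prod_dom {Y : Type*} [TopologicalSpace Y]
    {F : unitInterval × GeomRealization K → Y}
    (h : ∀ s ∈ K.faces, Continuous fun p : unitInterval × face K s => F (p.1, p.2.1)) :
    Continuous F := by
  have hc : ∀ x, Continuous fun r => F (r, x) := by
    intro x
    obtain ⟨s, hs, h'⟩ := exists_face x
    let x' : face K s := ⟨x, fun v hv => not_not.1 fun h'' => hv ((h' v).2 h'')⟩
    exact (h s hs).comp (continuous_id.prodMk continuous_const : Continuous fun r => (r, x'))
  let G : GeomRealization K → C(unitInterval, Y) := fun x => ⟨fun r => F (r, x), hc x⟩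
  have hG : Continuous G := by
    rw [continuous_dom_iff]
    intro s hs
    exact ContinuousMap.continuous_of_continuous_uncurry _ ((h s hs).comp continuous_swap)
  have := ContinuousMap.continuous_uncurry_of_continuous ⟨G, hG⟩
  exact this.comp continuous_swap

/-- Contiguous maps are joined by straight segments. Local finiteness of the supports is needed only
on each closed simplex, since the continuity of the homotopy is tested there. -/
theorem homotopic_of_locallyFinite_face (f g : C(GeomRealization K, GeomRealization K))
    (hf' : ∀ s ∈ K.faces, LocallyFinite fun v => Function.support fun t : face K s => (f t.1).1 v)
    (hg' : ∀ s ∈ K.faces, LocallyFinite fun v => Function.support fun t : face K s => (g t.1).1 v)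
    (h : ∀ t, ∃ s ∈ K.faces, ∀ v ∉ s, (f t).1 v = 0 ∧ (g t).1 v = 0) : f.Homotopic g :=
  ⟨{ toFun := fun p => segment (f p.2) (g p.2) (h p.2) p.1
     continuous_toFun := by
      refine continuous_prod_dom fun s hs => ?_
      exact continuous_segment
        (fun v => (continuous_coord v).comp (f.continuous.comp (continuous_face_val hs)))
        (fun v => (continuous_coord v).comp (g.continuous.comp (continuous_face_val hs)))
        (hf' s hs) (hg' s hs) fun t => h t.1
     map_zero_left := fun t => Subtype.ext (funext fun v => by simp [segment])
     map_one_left := fun t => Subtype.ext (funext fun v => by simp [segment]) }⟩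

theorem continuous_normalize {T : Type*} [TopologicalSpace T] {w : T → V → ℝ}
    (hw : ∀ v, Continuous fun t => w t v) (hl : LocallyFinite fun v => Function.support fun t => w t v)
    (h0 : ∀ t v, 0 ≤ w t v)
    (hs : ∀ t, ∃ s ∈ K.faces, ∀ v ∉ s, w t v = 0) (hp : ∀ t, ∃ v, 0 < w t v) :
    Continuous fun t => normalize (w t) (h0 t) (hs t) (hp t) := by
  refine continuous_of_locallyFinite (fun v => ?_) ?_
  · exact (hw v).div (continuous_finsum hw hl) fun t =>
      (finsum_pos_of_face (h0 t) (hs t) (hp t)).ne'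
  · refine hl.subset fun v t ht h => ht ?_
    have h' : w t v = 0 := h
    simp only [normalize, h', zero_div]

end GeomRealization

/-! ### Open subsets of normed spaces have the homotopy type of a polyhedron -/

section BarycentricWeights

variable {V : Type u}

/-- The square sum of the coordinates of `y` over `σ`. -/
def sqSum (y : V → ℝ) (σ : Finset V) : ℝ := ∑ v ∈ σ, y v ^ 2

open Classical in
/-- A weight for the subset `τ` of `σ` which vanishes unless `τ` contains all vertices of `σ` with
large coordinates and only vertices with positive coordinates. -/
noncomputable def subsetWeight (y : V → ℝ) (σ τ : Finset V) : ℝ :=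
  (∏ v ∈ τ, y v) * ∏ v ∈ σ \ τ, max (1 - 2 * y v / sqSum y σ) 0

theorem subsetWeight_nonneg {y : V → ℝ} (hy : ∀ v, 0 ≤ y v) (σ τ : Finset V) :
    0 ≤ subsetWeight y σ τ :=
  mul_nonneg (Finset.prod_nonneg fun v _ => hy v)
    (Finset.prod_nonneg fun _ _ => le_max_right _ _)

theorem subsetWeight_self_pos {y : V → ℝ} {σ : Finset V} (hy : ∀ v ∈ σ, 0 < y v) :
    0 < subsetWeight y σ σ := by
  classical
  simpa [subsetWeight] using Finset.prod_pos hy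

theorem sqSum_of_subset {y : V → ℝ} {σ σ' : Finset V} (h : σ ⊆ σ') (h0 : ∀ v ∉ σ, y v = 0) :
    sqSum y σ' = sqSum y σ :=
  (Finset.sum_subset h fun v _ hv => by simp [h0 v hv]).symm

/-- A vertex with coordinate zero annihilates the weight of every subset containing it and
contributes the factor 1 to the others. Hence averages computed in a face and in a larger face
agree. -/
theorem sum_subsetWeight_smul {W : Type*} [AddCommGroup W] [Module ℝ W] {y : V → ℝ}
    {σ σ' : Finset V} (h : σ ⊆ σ') (h0 : ∀ v ∉ σ, y v = 0) (m : Finset V → W) :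
    ∑ τ ∈ σ'.powerset, subsetWeight y σ' τ • m τ = ∑ τ ∈ σ.powerset, subsetWeight y σ τ • m τ := by
  classical
  symm
  have hsub : σ.powerset ⊆ σ'.powerset := Finset.powerset_mono.2 h
  rw [← Finset.sum_subset hsub]
  · refine Finset.sum_congr rfl fun τ hτ => ?_
    congr 1
    simp only [subsetWeight, sqSum_of_subset h h0]
    congr 1
    refine Finset.prod_subset (Finset.sdiff_subset_sdiff h subset_rfl) fun v hv hv' => ?_
    have : y v = 0 := h0 v fun h' => hv' (by simp_all)
    simp [this]
  · intro τ hτ hτ'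
    obtain ⟨v, hv, hvσ⟩ : ∃ v ∈ τ, v ∉ σ := by
      by_contra! hc
      exact hτ' (Finset.mem_powerset.2 hc)
    rw [subsetWeight, Finset.prod_eq_zero hv (h0 v hvσ), zero_mul, zero_smul]

/-- The square sum is the mean of the coordinates with the coordinates themselves as weights, so
some coordinate reaches it. Half of it is thus a continuous threshold that is always strictly
exceeded. -/
theorem exists_sqSum_le {y : V → ℝ} (hy : ∀ v, 0 ≤ y v) {σ : Finset V} (h1 : ∑ v ∈ σ, y v = 1) :
    ∃ v ∈ σ, sqSum y σ ≤ y v := by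
  by_contra! h
  have hne : σ.Nonempty := by
    by_contra hc
    simp [Finset.not_nonempty_iff_eq_empty.1 hc] at h1
  have hQ : sqSum y σ ≤ sqSum y σ * 1 := (mul_one _).ge
  obtain ⟨v, hv, hpos⟩ : ∃ v ∈ σ, 0 < y v := by
    by_contra! hc
    have := Finset.sum_nonpos hc
    linarith
  have : ∑ v ∈ σ, y v ^ 2 < ∑ v ∈ σ, sqSum y σ * y v := by
    refine Finset.sum_lt_sum (fun v hv => ?_) ⟨v, hv, ?_⟩
    · nlinarith [h v hv, hy v]
    · nlinarith [h v hv, hy v]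
  rw [← Finset.mul_sum, h1] at this
  simp [sqSum] at this

theorem sqSum_pos {y : V → ℝ} {σ : Finset V} (h1 : ∑ v ∈ σ, y v = 1) : 0 < sqSum y σ := by
  by_contra h
  have h0 : sqSum y σ = 0 := le_antisymm (not_lt.1 h) (Finset.sum_nonneg fun v _ => sq_nonneg _)
  have : ∀ v ∈ σ, y v = 0 := fun v hv => by
    have := (Finset.sum_eq_zero_iff_of_nonneg fun v _ => sq_nonneg (y v)).1 h0 v hv
    exact pow_eq_zero_iff two_ne_zero |>.1 this
  rw [Finset.sum_eq_zero this] at h1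
  exact zero_ne_one h1

theorem mem_of_subsetWeight_ne_zero {y : V → ℝ} {σ τ : Finset V} (hQ : 0 < sqSum y σ)
    (h : subsetWeight y σ τ ≠ 0) {v : V} (hv : v ∈ σ) (hvy : sqSum y σ / 2 ≤ y v) : v ∈ τ := by
  classical
  by_contra hvτ
  refine h ?_
  rw [subsetWeight, Finset.prod_eq_zero (i := v) (Finset.mem_sdiff.2 ⟨hv, hvτ⟩), mul_zero]
  refine max_eq_right ?_
  rw [sub_nonpos, le_div_iff₀ hQ]
  linarith

end BarycentricWeights

/-! ### Averages over the subsets of a carrier, and the cutoff of small coordinates. -/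

namespace GeomRealization

variable {V : Type u} {K : AbstractSimplicialComplex V}

/-- The carrier of a point of `|K|`. -/
noncomputable def carrier (x : GeomRealization K) : Finset V := (exists_face x).choose

theorem carrier_mem (x : GeomRealization K) : x.carrier ∈ K.faces := (exists_face x).choose_spec.1

theorem mem_carrier (x : GeomRealization K) {v : V} : v ∈ x.carrier ↔ x.1 v ≠ 0 :=
  (exists_face x).choose_spec.2 v

theorem eq_zero_of_notMem_carrier (x : GeomRealization K) (v : V) (h : v ∉ x.carrier) :
    x.1 v = 0 := not_not.1 fun h' => h (x.mem_carrier.2 h')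

theorem carrier_subset (x : GeomRealization K) {s : Finset V} (h : ∀ v ∉ s, x.1 v = 0) :
    x.carrier ⊆ s := fun v hv => by
  by_contra hvs
  exact x.mem_carrier.1 hv (h v hvs)

theorem sum_carrier (x : GeomRealization K) : ∑ v ∈ x.carrier, x.1 v = 1 :=
  x.sum_eq_one_of_forall_notMem x.eq_zero_of_notMem_carrier

theorem coord_pos (x : GeomRealization K) {v : V} (hv : v ∈ x.carrier) : 0 < x.1 v :=
  lt_of_le_of_ne (x.2.1 v) (Ne.symm (x.mem_carrier.1 hv))

/-- The map `|K| → W` averaging points `m τ` assigned to the simplices. -/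
noncomputable def average {W : Type*} [AddCommGroup W] [Module ℝ W] (m : Finset V → W)
    (x : GeomRealization K) : W :=
  x.carrier.powerset.centerMass (subsetWeight x.1 x.carrier) m

theorem average_eq {W : Type*} [AddCommGroup W] [Module ℝ W] (m : Finset V → W)
    (x : GeomRealization K) {s : Finset V} (h : ∀ v ∉ s, x.1 v = 0) :
    average m x = s.powerset.centerMass (subsetWeight x.1 s) m := by
  have h1 := sum_subsetWeight_smul (x.carrier_subset h) x.eq_zero_of_notMem_carrier m
  have h2 := sum_subsetWeight_smul (x.carrier_subset h) x.eq_zero_of_notMem_carrier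
    fun _ => (1 : ℝ)
  simp only [smul_eq_mul, mul_one] at h2
  simp only [average, Finset.centerMass, h1, h2]

theorem sum_subsetWeight_pos (x : GeomRealization K) {s : Finset V} (h : ∀ v ∉ s, x.1 v = 0) :
    0 < ∑ τ ∈ s.powerset, subsetWeight x.1 s τ := by
  have h2 := sum_subsetWeight_smul (x.carrier_subset h) x.eq_zero_of_notMem_carrier
    fun _ => (1 : ℝ)
  simp only [smul_eq_mul, mul_one] at h2
  rw [h2]
  exact Finset.sum_pos' (fun τ _ => subsetWeight_nonneg x.2.1 _ _)
    ⟨x.carrier, Finset.mem_powerset_self _, subsetWeight_self_pos fun v hv => x.coord_pos hv⟩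

theorem continuous_average {W : Type*} [NormedAddCommGroup W] [NormedSpace ℝ W]
    (m : Finset V → W) : Continuous (average m : GeomRealization K → W) := by
  classical
  rw [continuous_dom_iff]
  intro s hs
  have hQ : Continuous fun x : face K s => sqSum x.1.1 s :=
    continuous_finsetSum _ fun v _ => (continuous_face_coord s v).pow 2
  have hw : ∀ τ, Continuous fun x : face K s => subsetWeight x.1.1 s τ := by
    intro τ
    refine (continuous_finsetProd _ fun v _ => continuous_face_coord s v).mul
      (continuous_finsetProd _ fun v _ => ?_)
    refine (continuous_const.sub ((continuous_const.mul (continuous_face_coord s v)).div hQ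
      fun x => ?_)).max continuous_const
    exact (sqSum_pos (x.1.sum_eq_one_of_forall_notMem x.2)).ne'
  have : (fun x : face K s => average m x.1) = fun x : face K s =>
      (∑ τ ∈ s.powerset, subsetWeight x.1.1 s τ)⁻¹ •
        ∑ τ ∈ s.powerset, subsetWeight x.1.1 s τ • m τ :=
    funext fun x => average_eq m x.1 x.2
  rw [this]
  refine ((continuous_finsetSum _ fun τ _ => hw τ).inv₀ fun x => ?_).smul
    (continuous_finsetSum _ fun τ _ => (hw τ).smul continuous_const)
  exact (sum_subsetWeight_pos x.1 x.2).ne'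

/-- Only subsets τ containing every vertex with a large coordinate have nonzero weight. If v is such
a vertex, all points m τ that count lie in the convex set B v, and so does their average. -/
theorem average_mem {W : Type*} [AddCommGroup W] [Module ℝ W] {m : Finset V → W} {B : V → Set W}
    (hB : ∀ v, Convex ℝ (B v)) (hm : ∀ τ ∈ K.faces, ∀ v ∈ τ, m τ ∈ B v)
    (x : GeomRealization K) {v : V} (hv : sqSum x.1 x.carrier / 2 ≤ x.1 v) :
    average m x ∈ B v := by
  classical
  have hQ := sqSum_pos x.sum_carrier
  have hvc : v ∈ x.carrier := x.mem_carrier.2 (by linarith)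
  rw [average, ← Finset.centerMass_filter_ne_zero]
  refine (hB v).centerMass_mem (fun τ _ => subsetWeight_nonneg x.2.1 _ _) ?_ ?_
  · rw [Finset.sum_filter_ne_zero]
    exact sum_subsetWeight_pos x x.eq_zero_of_notMem_carrier
  · intro τ hτ
    rw [Finset.mem_filter, Finset.mem_powerset] at hτ
    have hvτ := mem_of_subsetWeight_ne_zero hQ hτ.2 hvc hv
    exact hm τ ((K.isRelLowerSet_faces x.carrier_mem).2 hτ.1 ⟨v, hvτ⟩) v hvτ

theorem exists_sqSum_carrier_lt (x : GeomRealization K) :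
    ∃ v, sqSum x.1 x.carrier / 2 < x.1 v := by
  obtain ⟨v, -, hv⟩ := exists_sqSum_le x.2.1 x.sum_carrier
  exact ⟨v, by linarith [sqSum_pos x.sum_carrier]⟩

/-- The deformation of `|K|` which annihilates the small coordinates. -/
noncomputable def cutoff (x : GeomRealization K) : GeomRealization K :=
  normalize (K := K) (fun v => max (x.1 v - sqSum x.1 x.carrier / 2) 0) (fun _ => le_max_right _ _)
    ⟨x.carrier, x.carrier_mem, fun v hv => by
      have := (sqSum_pos x.sum_carrier).le
      rw [x.eq_zero_of_notMem_carrier v hv]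
      exact max_eq_right (by linarith)⟩
    (by
      obtain ⟨v, hv⟩ := x.exists_sqSum_carrier_lt
      exact ⟨v, lt_max_of_lt_left (by linarith)⟩)

theorem lt_of_cutoff_ne_zero {x : GeomRealization K} {v : V} (h : x.cutoff.1 v ≠ 0) :
    sqSum x.1 x.carrier / 2 < x.1 v := by
  by_contra hc
  refine h ?_
  have : max (x.1 v - sqSum x.1 x.carrier / 2) 0 = 0 := max_eq_right (by linarith)
  simp only [cutoff, normalize, this, zero_div]

theorem cutoff_eq_zero {x : GeomRealization K} {v : V} (h : x.1 v = 0) : x.cutoff.1 v = 0 := by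
  by_contra hc
  have := lt_of_cutoff_ne_zero hc
  linarith [sqSum_pos x.sum_carrier]

theorem continuous_cutoff : Continuous (cutoff : GeomRealization K → GeomRealization K) := by
  rw [continuous_dom_iff]
  intro s hs
  refine continuous_normalize (fun v => ?_) ?_ (fun _ _ => le_max_right _ _) _ _
  · refine ((continuous_face_coord s v).sub (Continuous.div_const ?_ 2)).max continuous_const
    have : (fun x : face K s => sqSum x.1.1 x.1.carrier) = fun x : face K s => sqSum x.1.1 s :=
      funext fun x =>
        (sqSum_of_subset (x.1.carrier_subset x.2) x.1.eq_zero_of_notMem_carrier).symm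
    rw [this]
    exact continuous_finsetSum _ fun v _ => (continuous_face_coord s v).pow 2
  · refine (locallyFinite_face s).subset fun v t ht h => ht ?_
    have h' : t.1.1 v = 0 := h
    have := (sqSum_pos t.1.sum_carrier).le
    simp only [h']
    exact max_eq_right (by linarith)

end GeomRealization

/-- Nerve theorem for a cover by balls. A partition of unity gives φ : U → |K|; averaging points of
the intersections gives ψ : |K| → U. Convexity of the balls joins ψφ to the identity, while φψ is
contiguous to the cutoff of small coordinates, which is contiguous to the identity. -/
theorem isHPol_of_isOpen {W : Type u} [NormedAddCommGroup W] [NormedSpace ℝ W] {U : Set W}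
    (hU : IsOpen U) : IsHPol U := by
  classical
  have hball : ∀ x : U, ∃ ε > 0, Metric.ball x.1 ε ⊆ U := fun x => Metric.isOpen_iff.1 hU x.1 x.2
  choose ε hε hεU using hball
  let B : U → Set W := fun x => Metric.ball x.1 (ε x)
  let K : AbstractSimplicialComplex U :=
    { faces := {s | s.Nonempty ∧ ∃ x, ∀ i ∈ s, x ∈ B i}
      isRelLowerSet_faces := fun s hs =>
        ⟨hs.1, fun t ht hne => ⟨hne, hs.2.choose, fun i hi => hs.2.choose_spec i (ht hi)⟩⟩
      singleton_mem := fun x => ⟨Finset.singleton_nonempty x, x.1, fun i hi => by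
        rw [Finset.mem_singleton.1 hi]
        exact Metric.mem_ball_self (hε x)⟩ }
  obtain ⟨ρ, hρ⟩ := PartitionOfUnity.exists_isSubordinate (X := U) isClosed_univ
    (fun i => Subtype.val ⁻¹' (B i)) (fun i => Metric.isOpen_ball.preimage continuous_subtype_val)
    (fun x _ => Set.mem_iUnion.2 ⟨x, Metric.mem_ball_self (hε x)⟩)
  have hρB : ∀ {i x}, ρ i x ≠ 0 → x.1 ∈ B i := fun {i x} h => hρ i (subset_tsupport _ h)
  have hface : ∀ x : U, ∃ s ∈ K.faces, (∀ v ∉ s, ρ v x = 0) ∧ ∑ v ∈ s, ρ v x = 1 := by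
    intro x
    have hmem : ∀ v, v ∈ ρ.finsupport x ↔ ρ v x ≠ 0 := fun v => by
      rw [PartitionOfUnity.mem_finsupport]; rfl
    refine ⟨ρ.finsupport x, ⟨?_, x.1, fun i hi => hρB ((hmem i).1 hi)⟩, fun v hv => ?_,
      ρ.sum_finsupport (Set.mem_univ x)⟩
    · obtain ⟨i, hi⟩ := ρ.exists_pos (Set.mem_univ x)
      exact ⟨i, (hmem i).2 hi.ne'⟩
    · by_contra h
      exact hv ((hmem v).2 h)
  let φ : C(U, GeomRealization K) :=
    ⟨fun x => ⟨fun i => ρ i x, fun i => ρ.nonneg i x, hface x⟩,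
      GeomRealization.continuous_of_locallyFinite (fun v => (ρ v).continuous) ρ.locallyFinite⟩
  -- One point in the common intersection of the balls of each simplex; the value 0 off the complex
  -- plays no role.
  let m : Finset U → W := fun τ => if h : τ ∈ K.faces then h.2.choose else 0
  have hm : ∀ τ ∈ K.faces, ∀ v ∈ τ, m τ ∈ B v := fun τ hτ v hv => by
    simp only [m, dif_pos hτ]
    exact hτ.2.choose_spec v hv
  have hmem : ∀ (y : GeomRealization K) (v : U), sqSum y.1 y.carrier / 2 ≤ y.1 v →
      GeomRealization.average m y ∈ B v :=
    fun y v hv => GeomRealization.average_mem (fun v => convex_ball _ _) hm y hv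
  have hψU : ∀ y : GeomRealization K, GeomRealization.average m y ∈ U := fun y => by
    obtain ⟨v, hv⟩ := y.exists_sqSum_carrier_lt
    exact hεU v (hmem y v hv.le)
  let ψ : C(GeomRealization K, U) :=
    ⟨fun y => ⟨GeomRealization.average m y, hψU y⟩,
      (GeomRealization.continuous_average m).subtype_mk hψU⟩
  let r : C(GeomRealization K, GeomRealization K) :=
    ⟨GeomRealization.cutoff, GeomRealization.continuous_cutoff⟩
  have hr : ∀ s ∈ K.faces, LocallyFinite fun v =>
      Function.support fun t : GeomRealization.face K s => (r t.1).1 v := fun s hs =>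
    (GeomRealization.locallyFinite_face s).subset fun v t ht h =>
      ht (GeomRealization.cutoff_eq_zero h)
  refine ⟨U, K, ⟨⟨φ, ψ, ?_, ?_⟩⟩⟩
  -- If v is a large coordinate of φ x, then both x and ψ(φ x) lie in the ball of v, hence so does
  -- the segment between them.
  · have key : ∀ (x : U) (s : unitInterval),
        (1 - s.1) • GeomRealization.average m (φ x) + s.1 • x.1 ∈ U := by
      intro x s
      obtain ⟨v, hv⟩ := (φ x).exists_sqSum_carrier_lt
      refine hεU v (convex_ball _ _ (hmem _ v hv.le) (hρB (i := v) (x := x) ?_)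
        (sub_nonneg.2 s.2.2) s.2.1 (sub_add_cancel _ _))
      have := sqSum_pos (φ x).sum_carrier
      have h' : (φ x).1 v = ρ v x := rfl
      rw [h'] at hv
      linarith
    exact ⟨{ toFun := fun p => ⟨_, key p.2 p.1⟩
             continuous_toFun := by
              have h1 : Continuous fun p : unitInterval × U =>
                GeomRealization.average m (φ p.2) :=
                (GeomRealization.continuous_average m).comp (φ.continuous.comp continuous_snd)
              refine Continuous.subtype_mk ?_ _
              fun_prop
             map_zero_left := fun x => Subtype.ext (by simp [ψ])
             map_one_left := fun x => Subtype.ext (by simp) }⟩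
  -- The point ψ y lies in the balls of all vertices of φ(ψ y) and in those of all large coordinates
  -- of y, the only ones that survive in r y. So these vertices together span a simplex; without the
  -- cutoff the remaining vertices of y could spoil this.
  · have h1 : (φ.comp ψ).Homotopic r := by
      refine GeomRealization.homotopic_of_locallyFinite_face _ _ (fun s hs => ?_) hr fun y => ?_
      · exact (ρ.locallyFinite.preimage_continuous (ψ.continuous.comp
          (GeomRealization.continuous_face_val hs)))
      · refine ⟨(φ (ψ y)).carrier ∪ (r y).carrier, ⟨?_, (ψ y).1, fun i hi => ?_⟩, fun v hv => ?_⟩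
        · exact (φ (ψ y)).carrier_mem.1.mono Finset.subset_union_left
        · rcases Finset.mem_union.1 hi with hi | hi
          · exact hρB (GeomRealization.mem_carrier _ |>.1 hi)
          · exact hmem y i
              (GeomRealization.lt_of_cutoff_ne_zero (GeomRealization.mem_carrier _ |>.1 hi)).le
        · rw [Finset.mem_union, not_or] at hv
          exact ⟨GeomRealization.eq_zero_of_notMem_carrier _ _ hv.1,
            GeomRealization.eq_zero_of_notMem_carrier _ _ hv.2⟩
    refine h1.trans ?_
    refine GeomRealization.homotopic_of_locallyFinite_face _ _ hr
      (fun s _ => GeomRealization.locallyFinite_face s) fun y => ?_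
    exact ⟨y.carrier, y.carrier_mem, fun v hv =>
      ⟨GeomRealization.cutoff_eq_zero (y.eq_zero_of_notMem_carrier v hv),
        y.eq_zero_of_notMem_carrier v hv⟩⟩

/-! ### Polyhedra as open subsets of normed spaces -/

namespace GeomRealization

variable {V : Type u} (K : AbstractSimplicialComplex V)

/-- A neighbourhood of `|K|` in the space of bounded functions on the vertices. -/
def thickening : Set (lp (fun _ : V => ℝ) ⊤) :=
  {b | ∃ F ∈ K.faces, (∃ c, 0 ≤ c ∧ c < 1 / 2 ∧ ∀ v ∉ F, b v ≤ c * ‖b‖) ∧ ∃ v, ‖b‖ / 2 < b v}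

variable {K}

theorem lp_coord_le {b : lp (fun _ : V => ℝ) ⊤} (v : V) : |b v| ≤ ‖b‖ :=
  lp.norm_apply_le_norm ENNReal.top_ne_zero b v

/-- The uniform factor c < 1/2 leaves room for all of the possibly infinitely many coordinates off F
at once. Keeping the same F throughout the ball gives openness of the thickening and also local
finiteness of the retraction. -/
theorem exists_ball_thickening {b : lp (fun _ : V => ℝ) ⊤} {F : Finset V}
    (hc : ∃ c, 0 ≤ c ∧ c < 1 / 2 ∧ ∀ v ∉ F, b v ≤ c * ‖b‖) (hv : ∃ v, ‖b‖ / 2 < b v) :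
    ∃ δ > 0, ∀ b' ∈ Metric.ball b δ,
      (∃ c, 0 ≤ c ∧ c < 1 / 2 ∧ ∀ v ∉ F, b' v ≤ c * ‖b'‖) ∧ ∃ v, ‖b'‖ / 2 < b' v := by
  obtain ⟨c, hc0, hc1, hc⟩ := hc
  obtain ⟨v, hv⟩ := hv
  have hpos : 0 < ‖b‖ := by
    have := (abs_le.1 (lp_coord_le (b := b) v)).2
    linarith [norm_nonneg b]
  refine ⟨min ((1 / 2 - c) * ‖b‖ / 8) ((b v - ‖b‖ / 2) / 2), lt_min ?_ ?_, fun b' hb' => ?_⟩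
  · have : 0 < (1 / 2 - c) * ‖b‖ := mul_pos (by linarith) hpos
    linarith
  · linarith
  rw [Metric.mem_ball, dist_eq_norm, lt_min_iff] at hb'
  obtain ⟨h1, h2⟩ := hb'
  set d := ‖b' - b‖ with hd
  have hcoord : ∀ w, |b' w - b w| ≤ d := fun w => by
    have := lp_coord_le (b := b' - b) w
    simpa [lp.coeFn_sub] using this
  have hn1 : ‖b'‖ ≤ ‖b‖ + d := by
    have := norm_add_le b (b' - b)
    rwa [add_sub_cancel] at this
  have hn2 : ‖b‖ ≤ ‖b'‖ + d := by
    have := norm_sub_le b' (b' - b)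
    rwa [sub_sub_cancel] at this
  have hd0 : 0 ≤ d := norm_nonneg _
  -- The midpoint of c and 1/2 is the new factor; the first term of the radius was chosen for it.
  refine ⟨⟨(c + 1 / 2) / 2, by linarith, by linarith, fun w hw => ?_⟩, v, ?_⟩
  · have h3 := (abs_le.1 (hcoord w)).2
    have h4 := hc w hw
    have h5 : c * ‖b‖ ≤ c * ‖b'‖ + c * d := by nlinarith
    have h6 : (1 / 2 - c) * ‖b‖ ≤ (1 / 2 - c) * ‖b'‖ + (1 / 2 - c) * d := by nlinarith
    nlinarith
  · have h3 := (abs_le.1 (hcoord v)).1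
    linarith

theorem isOpen_thickening : IsOpen (thickening K) := by
  rw [Metric.isOpen_iff]
  rintro b ⟨F, hF, hc, hv⟩
  obtain ⟨δ, hδ, h⟩ := exists_ball_thickening hc hv
  exact ⟨δ, hδ, fun b' hb' => ⟨F, hF, h b' hb'⟩⟩

/-- The vector of barycentric coordinates. -/
def toLp (x : GeomRealization K) : lp (fun _ : V => ℝ) ⊤ :=
  ⟨fun v => x.1 v, memℓp_infty ⟨1, by
    rintro _ ⟨v, rfl⟩
    by_cases hv : v ∈ x.carrier
    · change ‖x.1 v‖ ≤ 1
      rw [Real.norm_of_nonneg (x.2.1 v)]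
      exact (Finset.single_le_sum (fun w _ => x.2.1 w) hv).trans_eq x.sum_carrier
    · simp only [x.eq_zero_of_notMem_carrier v hv, norm_zero, zero_le_one]⟩⟩

theorem toLp_apply (x : GeomRealization K) (v : V) : toLp x v = x.1 v := rfl

theorem continuous_toLp : Continuous (toLp : GeomRealization K → _) := by
  classical
  rw [continuous_dom_iff]
  intro s hs
  have : (fun x : face K s => toLp x.1) = fun x : face K s =>
      ∑ v ∈ s, x.1.1 v • lp.single (E := fun _ : V => ℝ) ⊤ v (1 : ℝ) := by
    funext x
    refine lp.ext (funext fun w => ?_)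
    rw [toLp_apply, lp.coeFn_sum, Finset.sum_apply]
    by_cases hw : w ∈ s
    · rw [Finset.sum_eq_single w]
      · simp
      · intro v _ hv
        simp [hv.symm]
      · exact fun h => (h hw).elim
    · have h0 : x.1.1 w = 0 := x.2 w hw
      rw [Finset.sum_eq_zero fun v hv => ?_]
      · exact h0
      · have : v ≠ w := fun h => hw (h ▸ hv)
        simp [this.symm]
  rw [this]
  exact continuous_finsetSum _ fun v _ => (continuous_face_coord s v).smul continuous_const

theorem exists_norm_toLp_le (x : GeomRealization K) : ∃ v, 0 < x.1 v ∧ ‖toLp x‖ ≤ x.1 v := by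
  obtain ⟨v, hv, hmax⟩ := x.carrier.exists_max_image x.1 (K.isRelLowerSet_faces x.carrier_mem).1
  refine ⟨v, x.coord_pos hv, lp.norm_le_of_forall_le (x.2.1 v) fun w => ?_⟩
  rw [toLp_apply, Real.norm_of_nonneg (x.2.1 w)]
  by_cases hw : w ∈ x.carrier
  · exact hmax w hw
  · have h0 : x.1 w = 0 := x.eq_zero_of_notMem_carrier w hw
    rw [h0]
    exact x.2.1 v

theorem toLp_mem (x : GeomRealization K) : toLp x ∈ thickening K := by
  obtain ⟨v, h0, hv⟩ := x.exists_norm_toLp_le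
  refine ⟨x.carrier, x.carrier_mem, ⟨0, le_rfl, by norm_num, fun w hw => ?_⟩, v, ?_⟩
  · rw [toLp_apply, x.eq_zero_of_notMem_carrier w hw, zero_mul]
  · rw [toLp_apply]
    linarith

/-- The retraction of the thickening to `|K|`. -/
noncomputable def retract (b : thickening K) : GeomRealization K :=
  normalize (K := K) (fun v => max (b.1 v - ‖b.1‖ / 2) 0) (fun _ => le_max_right _ _)
    (by
      obtain ⟨F, hF, ⟨c, h0, h1, hc⟩, -⟩ := b.2
      refine ⟨F, hF, fun v hv => max_eq_right ?_⟩
      have := hc v hv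
      nlinarith [norm_nonneg b.1])
    (by
      obtain ⟨F, hF, -, v, hv⟩ := b.2
      exact ⟨v, lt_max_of_lt_left (by linarith)⟩)

theorem lt_of_retract_ne_zero {b : thickening K} {v : V} (h : (retract b).1 v ≠ 0) :
    ‖b.1‖ / 2 < b.1 v := by
  by_contra hc
  refine h ?_
  have : max (b.1 v - ‖b.1‖ / 2) 0 = 0 := max_eq_right (by linarith)
  simp only [retract, normalize, this, zero_div]

theorem retract_mono {b : thickening K} {v w : V} (h : b.1 v ≤ b.1 w) :
    (retract b).1 v ≤ (retract b).1 w :=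
  div_le_div_of_nonneg_right (max_le_max_right _ (by linarith))
    (finsum_nonneg fun _ => le_max_right _ _)

theorem continuous_lp_coord (v : V) : Continuous fun b : lp (fun _ : V => ℝ) ⊤ => b v :=
  (lp.lipschitzWith_one_eval (E := fun _ : V => ℝ) ⊤ v).continuous

/-- The norm topology suffices for continuity into the weak topology because near each point only
coordinates in one fixed face exceed half the norm. -/
theorem continuous_retract : Continuous (retract : thickening K → GeomRealization K) := by
  refine continuous_normalize (fun v => ?_) ?_ (fun _ _ => le_max_right _ _) _ _
  · exact (((continuous_lp_coord v).comp continuous_subtype_val).sub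
      (continuous_subtype_val.norm.div_const 2)).max continuous_const
  · intro b
    obtain ⟨F, hF, hc, hv⟩ := b.2
    obtain ⟨δ, hδ, h⟩ := exists_ball_thickening hc hv
    refine ⟨Subtype.val ⁻¹' Metric.ball b.1 δ,
      continuous_subtype_val.continuousAt.preimage_mem_nhds (Metric.ball_mem_nhds _ hδ),
      F.finite_toSet.subset ?_⟩
    rintro v ⟨b', hb', hb'δ⟩
    by_contra hvF
    obtain ⟨c, h0, h1, hc⟩ := (h b'.1 hb'δ).1
    refine hb' (max_eq_right ?_)
    have := hc v hvF
    nlinarith [norm_nonneg b'.1]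

/-- The face F and the factor c of b serve for the whole segment: off F the retracted point
vanishes, and its nonzero coordinates sit where b is positive, so the norm along the segment is at
least (1 - r)‖b‖. A vertex of F at which b is maximal is also maximal for the retracted point, hence
stays above half the norm. -/
theorem segment_retract_mem (b : thickening K) (r : unitInterval) :
    (1 - r.1) • b.1 + r.1 • toLp (retract b) ∈ thickening K := by
  have hr0 := r.2.1
  have hr1 : 0 ≤ 1 - r.1 := sub_nonneg.2 r.2.2
  obtain ⟨F, hF, ⟨c, hc0, hc1, hc⟩, v₀, hv₀⟩ := b.2
  set y := retract b with hy
  have hval : ∀ v, ((1 - r.1) • b.1 + r.1 • toLp y : lp (fun _ : V => ℝ) ⊤) v =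
      (1 - r.1) * b.1 v + r.1 * y.1 v := fun v => rfl
  have hyF : ∀ v ∉ F, y.1 v = 0 := fun v hv => by
    by_contra h
    have h1 := lt_of_retract_ne_zero h
    have h2 := hc v hv
    nlinarith [norm_nonneg b.1]
  have hnorm : (1 - r.1) * ‖b.1‖ ≤ ‖(1 - r.1) • b.1 + r.1 • toLp y‖ := by
    have e : (1 - r.1) * ‖b.1‖ = ‖(1 - r.1) • b.1‖ := by
      rw [norm_smul, Real.norm_of_nonneg hr1]
    rw [e]
    refine lp.norm_le_of_forall_le (norm_nonneg _) fun v => ?_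
    refine le_trans ?_ (lp_coord_le v)
    rw [hval, lp.coeFn_smul, Pi.smul_apply, smul_eq_mul, Real.norm_eq_abs]
    by_cases h : y.1 v = 0
    · rw [h]
      simp
    · have h1 := lt_of_retract_ne_zero h
      have h2 : 0 ≤ b.1 v := by linarith [norm_nonneg b.1]
      rw [abs_of_nonneg (mul_nonneg hr1 h2)]
      refine le_trans ?_ (le_abs_self _)
      have := mul_nonneg hr0 (y.2.1 v)
      linarith
  refine ⟨F, hF, ⟨c, hc0, hc1, fun v hv => ?_⟩, ?_⟩
  · rw [hval, hyF v hv]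
    have h1 := mul_le_mul_of_nonneg_left (hc v hv) hr1
    have h2 := mul_le_mul_of_nonneg_left hnorm hc0
    linarith
  · have hv₀F : v₀ ∈ F := by
      by_contra h
      have h2 := hc v₀ h
      nlinarith [norm_nonneg b.1]
    obtain ⟨v, hv, hmax⟩ := F.exists_max_image (fun v => b.1 v) ⟨v₀, hv₀F⟩
    have hbv : ‖b.1‖ / 2 < b.1 v := hv₀.trans_le (hmax v₀ hv₀F)
    have hymax : ‖toLp y‖ ≤ y.1 v := by
      refine lp.norm_le_of_forall_le (y.2.1 v) fun w => ?_
      rw [toLp_apply, Real.norm_of_nonneg (y.2.1 w)]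
      by_cases hw : w ∈ F
      · exact retract_mono (hmax w hw)
      · rw [hyF w hw]
        exact y.2.1 v
    have hypos : 0 < y.1 v := by
      obtain ⟨w, hw, hw'⟩ := y.exists_norm_toLp_le
      have h1 := (abs_le.1 (lp_coord_le (b := toLp y) w)).2
      rw [toLp_apply] at h1
      linarith
    refine ⟨v, ?_⟩
    rw [hval]
    have h1 : ‖(1 - r.1) • b.1 + r.1 • toLp y‖ ≤ (1 - r.1) * ‖b.1‖ + r.1 * ‖toLp y‖ := by
      refine (norm_add_le _ _).trans ?_
      rw [norm_smul, norm_smul, Real.norm_of_nonneg hr0, Real.norm_of_nonneg hr1]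
    have h2 : r.1 * ‖toLp y‖ ≤ r.1 * y.1 v := mul_le_mul_of_nonneg_left hymax hr0
    have h3 : 0 ≤ (1 - r.1) * (b.1 v - ‖b.1‖ / 2) := mul_nonneg hr1 (by linarith)
    rcases hr0.eq_or_lt with h | h
    · have h4 : 0 < (1 - r.1) * (b.1 v - ‖b.1‖ / 2) := mul_pos (by linarith) (by linarith)
      have h5 : 0 ≤ r.1 * y.1 v := mul_nonneg hr0 hypos.le
      linarith
    · have h5 : 0 < r.1 * y.1 v := mul_pos h hypos
      linarith

theorem nonempty_homotopyEquiv_thickening :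
    Nonempty (ContinuousMap.HomotopyEquiv (GeomRealization K) (thickening K)) := by
  let i : C(GeomRealization K, thickening K) :=
    ⟨fun x => ⟨toLp x, toLp_mem x⟩, continuous_toLp.subtype_mk _⟩
  let r : C(thickening K, GeomRealization K) := ⟨retract, continuous_retract⟩
  refine ⟨⟨i, r, ?_, ?_⟩⟩
  · have hsupp : ∀ (x : GeomRealization K) (v : V), x.1 v = 0 → (retract (i x)).1 v = 0 := by
      intro x v hv
      by_contra h
      have h1 := lt_of_retract_ne_zero h
      have h2 : (i x).1 v = x.1 v := rfl
      rw [h2, hv] at h1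
      linarith [norm_nonneg (i x).1]
    refine homotopic_of_locallyFinite_face _ _ (fun s _ => ?_) (fun s _ => locallyFinite_face s)
      fun x => ⟨x.carrier, x.carrier_mem, fun v hv => ?_⟩
    · exact (locallyFinite_face s).subset fun v t ht h => ht (hsupp t.1 v h)
    · exact ⟨hsupp x v (x.eq_zero_of_notMem_carrier v hv), x.eq_zero_of_notMem_carrier v hv⟩
  · refine ContinuousMap.Homotopic.symm ⟨{ toFun := fun p => ⟨_, segment_retract_mem p.2 p.1⟩
                                           continuous_toFun := ?_
                                           map_zero_left := fun x => Subtype.ext (by simp)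
                                           map_one_left := fun x => Subtype.ext ?_ }⟩
    · have h1 : Continuous fun p : unitInterval × thickening K => toLp (retract p.2) :=
        continuous_toLp.comp (continuous_retract.comp continuous_snd)
      refine Continuous.subtype_mk ?_ _
      fun_prop
    · simp [i, r]

end GeomRealization

theorem IsHPol.of_homotopyEquiv {X Y : Type u} [TopologicalSpace X] [TopologicalSpace Y]
    (hY : IsHPol Y) (e : ContinuousMap.HomotopyEquiv X Y) : IsHPol X := by
  obtain ⟨V, K, ⟨e'⟩⟩ := hY
  exact ⟨V, K, ⟨e.trans e'⟩⟩

theorem IsHPol.exists_normedSpace {P : Type u} [TopologicalSpace P] (hP : IsHPol P) :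
    ∃ (W : Type u) (_ : NormedAddCommGroup W) (_ : NormedSpace ℝ W) (O : Set W), IsOpen O ∧
      Nonempty (ContinuousMap.HomotopyEquiv P O) := by
  obtain ⟨V, K, ⟨e⟩⟩ := hP
  obtain ⟨e'⟩ := GeomRealization.nonempty_homotopyEquiv_thickening (K := K)
  exact ⟨lp (fun _ : V => ℝ) ⊤, inferInstance, inferInstance, GeomRealization.thickening K,
    GeomRealization.isOpen_thickening, ⟨e.trans e'⟩⟩

/-! ### Function spaces -/

/-- The maps `Q → P` identifying the two members of each pair in `E`. -/
abbrev EqMaps (Q : Type u) [TopologicalSpace Q] (E : Set (Q × Q)) (P : Type u)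
    [TopologicalSpace P] : Type u :=
  {w : C(Q, P) // ∀ a ∈ E, w a.1 = w a.2}

namespace EqMaps

variable {Q : Type u} [TopologicalSpace Q] {E : Set (Q × Q)} {P P' : Type u}
  [TopologicalSpace P] [TopologicalSpace P']

/-- Composition with a map `P → P'`. -/
def postcomp (f : C(P, P')) : C(EqMaps Q E P, EqMaps Q E P') :=
  ⟨fun w => ⟨f.comp w.1, fun a ha => congrArg f (w.2 a ha)⟩,
    ((ContinuousMap.continuous_postcomp f).comp continuous_subtype_val).subtype_mk _⟩

theorem postcomp_homotopic [CompactSpace Q] [T2Space Q] {f g : C(P, P')} (h : f.Homotopic g) :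
    (postcomp f : C(EqMaps Q E P, _)).Homotopic (postcomp g) := by
  obtain ⟨H⟩ := h
  refine ⟨{ toFun := fun p => ⟨(H.toContinuousMap.curry p.1).comp p.2.1, fun a ha => ?_⟩
            continuous_toFun := ?_
            map_zero_left := fun w => Subtype.ext (ContinuousMap.ext fun q => ?_)
            map_one_left := fun w => Subtype.ext (ContinuousMap.ext fun q => ?_) }⟩
  · exact congrArg (H.toContinuousMap.curry p.1) (p.2.2 a ha)
  · refine Continuous.subtype_mk ?_ _
    refine ContinuousMap.continuous_of_continuous_uncurry _ ?_
    have h1 : Continuous fun x : (unitInterval × EqMaps Q E P) × Q => x.1.2.1 x.2 := by fun_prop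
    have h2 : Continuous fun x : (unitInterval × EqMaps Q E P) × Q => (x.1.1, x.1.2.1 x.2) :=
      (continuous_fst.comp continuous_fst).prodMk h1
    exact H.continuous.comp h2
  · exact H.map_zero_left (w.1 q)
  · exact H.map_one_left (w.1 q)

end EqMaps

/-- Postcomposition with a homotopy equivalence replaces P by an open subset O of a normed space.
The identifications in E are linear conditions and, Q being compact, taking values in O is an open
condition, so the maps form an open subset of a normed space. -/
theorem isHPol_eqMaps {Q : Type u} [TopologicalSpace Q] [CompactSpace Q] [T2Space Q]
    (E : Set (Q × Q)) {P : Type u} [TopologicalSpace P] (hP : IsHPol P) :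
    IsHPol (EqMaps Q E P) := by
  obtain ⟨W, _, _, O, hO, ⟨e⟩⟩ := hP.exists_normedSpace
  let M : Submodule ℝ C(Q, W) :=
    { carrier := {w | ∀ a ∈ E, w a.1 = w a.2}
      add_mem' := fun {w w'} h h' a ha => by simp [h a ha, h' a ha]
      zero_mem' := fun a _ => rfl
      smul_mem' := fun c w h a ha => by simp [h a ha] }
  let U : Set M := Subtype.val ⁻¹' {w : C(Q, W) | Set.MapsTo w Set.univ O}
  have hU : IsOpen U :=
    (ContinuousMap.isOpen_setOfPred_mapsTo isCompact_univ hO).preimage continuous_subtype_val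
  have e₁ : ContinuousMap.HomotopyEquiv (EqMaps Q E P) (EqMaps Q E O) :=
    { toFun := EqMaps.postcomp e.toFun
      invFun := EqMaps.postcomp e.invFun
      left_inv := EqMaps.postcomp_homotopic (E := E) e.left_inv
      right_inv := EqMaps.postcomp_homotopic (E := E) e.right_inv }
  let val : C(O, W) := ⟨Subtype.val, continuous_subtype_val⟩
  have hval : Topology.IsInducing (ContinuousMap.comp val : C(Q, O) → C(Q, W)) :=
    ContinuousMap.isInducing_postcomp val Topology.IsInducing.subtypeVal
  let e₂ : EqMaps Q E O ≃ₜ U :=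
    { toFun := fun w => ⟨⟨val.comp w.1, fun a ha => congrArg Subtype.val (w.2 a ha)⟩,
        fun q _ => (w.1 q).2⟩
      invFun := fun w => ⟨⟨fun q => ⟨w.1.1 q, w.2 (Set.mem_univ q)⟩,
        w.1.1.continuous.subtype_mk _⟩, fun a ha => Subtype.ext (w.1.2 a ha)⟩
      left_inv := fun w => rfl
      right_inv := fun w => rfl
      continuous_toFun := ((hval.continuous.comp continuous_subtype_val).subtype_mk _).subtype_mk _
      continuous_invFun := by
        refine Continuous.subtype_mk ?_ _
        rw [hval.continuous_iff]
        exact continuous_subtype_val.comp continuous_subtype_val }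
  exact (isHPol_of_isOpen hU).of_homotopyEquiv (e₁.trans e₂.toHomotopyEquiv)

/-! ### Recursion over finite sets and directedness -/

/-- The step may assume that the earlier choices are compatible, which a plain recursion cannot
carry along. The values are therefore defined unconditionally by `Classical.epsilon`, and
compatibility is proved afterwards by induction. -/
theorem exists_ssubset_recursion {α : Type*} {D : Finset α → Type*} [∀ C, Nonempty (D C)]
    (R : ∀ C C' : Finset α, D C → D C' → Prop)
    (step : ∀ (C : Finset α) (d : ∀ C', C' ⊂ C → D C'),
      (∀ C' C'' (h' : C' ⊂ C) (h'' : C'' ⊂ C'), R C' C'' (d C' h') (d C'' (h''.trans h'))) →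
      ∃ x : D C, ∀ C' h, R C C' x (d C' h)) :
    ∃ d : ∀ C, D C, ∀ C C', C' ⊂ C → R C C' (d C) (d C') := by
  classical
  let d : ∀ C, D C := Finset.strongInduction fun C ih =>
    Classical.epsilon fun x : D C => ∀ C' h, R C C' x (ih C' h)
  have hd : ∀ C, d C = Classical.epsilon fun x : D C => ∀ C', C' ⊂ C → R C C' x (d C') :=
    fun C => Finset.strongInduction_eq _ C
  refine ⟨d, fun C => ?_⟩
  induction C using Finset.strongInduction with
  | H C ih =>
    obtain ⟨x, hx⟩ := step C (fun C' _ => d C') fun C' C'' h' h'' => ih C' h' C'' h''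
    have := Classical.epsilon_spec (p := fun x : D C => ∀ C', C' ⊂ C → R C C' x (d C')) ⟨x, hx⟩
    rwa [← hd C] at this

namespace InvSystem

theorem exists_upper_bound (S : InvSystem.{u}) {ι : Type*} (s : Finset ι) (b : ι → S.Idx) :
    ∃ k, ∀ i ∈ s, b i ≤ k := by
  classical
  induction s using Finset.induction_on with
  | empty => exact ⟨S.nonempty.some, fun i hi => absurd hi (Finset.notMem_empty i)⟩
  | insert a s _ ih =>
    obtain ⟨k, hk⟩ := ih
    obtain ⟨l, h1, h2⟩ := S.directed (b a) k
    refine ⟨l, fun i hi => ?_⟩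
    rcases Finset.mem_insert.1 hi with rfl | hi
    · exact h1
    · exact (hk i hi).trans h2

theorem exists_monotone_ge (S : InvSystem.{u}) {α : Type*} (b : Finset α → S.Idx) :
    ∃ g : Finset α → S.Idx, (∀ C C', C' ⊆ C → g C' ≤ g C) ∧ ∀ C, b C ≤ g C := by
  classical
  have : ∀ C, Nonempty {x : S.Idx // b C ≤ x} := fun C => ⟨⟨b C, le_rfl⟩⟩
  obtain ⟨d, hd⟩ := exists_ssubset_recursion (D := fun C => {x : S.Idx // b C ≤ x})
    (fun C C' x y => y.1 ≤ x.1) fun C d _ => by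
      obtain ⟨k, hk⟩ := S.exists_upper_bound C.ssubsets.attach
        fun C' => (d C'.1 (Finset.mem_ssubsets.1 C'.2)).1
      obtain ⟨l, h1, h2⟩ := S.directed k (b C)
      exact ⟨⟨l, h2⟩, fun C' h =>
        (hk ⟨C', Finset.mem_ssubsets.2 h⟩ (Finset.mem_attach _ _)).trans h1⟩
  refine ⟨fun C => (d C).1, fun C C' h => ?_, fun C => (d C).2⟩
  rcases h.eq_or_ssubset with rfl | h
  · exact le_rfl
  · exact hd C C' h

/-- An index ν is replaced by its finite set of predecessors, on which recursion along strict
inclusion is possible. This also treats equivalent indices of a preorder correctly: they have the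
same predecessors and get the same value. -/
theorem exists_orderHom_ge (S Z : InvSystem.{u}) (b : Z.Idx → S.Idx) :
    ∃ g : Z.Idx →o S.Idx, ∀ ν, b ν ≤ g ν := by
  choose ub hub using fun C : Finset Z.Idx => S.exists_upper_bound C b
  obtain ⟨g, hg, hb⟩ := S.exists_monotone_ge ub
  refine ⟨⟨fun ν => g (Z.cofinite ν).toFinset, fun ν ν' h => hg _ _ ?_⟩, fun ν => ?_⟩
  · exact Set.Finite.toFinset_subset_toFinset.2 (Set.Iic_subset_Iic.2 h)
  · exact (hub _ ν ((Z.cofinite ν).mem_toFinset.2 le_rfl)).trans (hb _)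

end InvSystem

/-! ### Coherence with respect to all monotone maps -/

/-- The simplex category is generated by cofaces and codegeneracies. Coherence is stable under
composition, since each composite involves only finitely many conditions "for almost all n"; it
therefore holds for all monotone maps. -/
theorem orderHom_induction {P : ∀ {k m : ℕ}, (Fin (k + 1) →o Fin (m + 1)) → Prop}
    (id : ∀ m, P (OrderHom.id : Fin (m + 1) →o Fin (m + 1)))
    (comp : ∀ {l k m : ℕ} (θ : Fin (k + 1) →o Fin (m + 1)) (θ' : Fin (l + 1) →o Fin (k + 1)),
      P θ → P θ' → P (θ.comp θ'))
    (face : ∀ {m : ℕ} (j : Fin (m + 2)), P (coface j))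
    (deg : ∀ {m : ℕ} (j : Fin (m + 1)), P (codegeneracy j))
    {k m : ℕ} (θ : Fin (k + 1) →o Fin (m + 1)) : P θ := by
  let W : CategoryTheory.MorphismProperty SimplexCategory := fun a b f => P f.toOrderHom
  have : W.IsMultiplicative :=
    { id_mem := fun a => id a.len
      comp_mem := fun f g hf hg => comp g.toOrderHom f.toOrderHom hg hf }
  have hW : W = ⊤ := SimplexCategory.morphismProperty_eq_top W face deg
  have h : W (SimplexCategory.mkHom θ) := by
    rw [hW]
    trivial
  exact h

theorem simplex_map_comp {l k m : ℕ} (θ : Fin (k + 1) →o Fin (m + 1))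
    (θ' : Fin (l + 1) →o Fin (k + 1)) (t : Simplex l) :
    stdSimplex.map (θ.comp θ') t = stdSimplex.map θ (stdSimplex.map θ' t) := by
  rw [stdSimplex.map_comp_apply (S := ℝ) (⇑θ') (⇑θ) t]
  rfl

namespace CoarseCoherentMap

variable {X Y : InvSystem.{u}}

theorem maps_congr {f : Y.Idx →o X.Idx} (F : CoherentFamily X Y f) (n : ℕ) {m : ℕ}
    {μ μ' : MultiIndex Y.Idx m} (h : μ = μ') (x : X.obj (f (μ (Fin.last m)))) (t : Simplex m) :
    F n μ (x, t) = Y.map (le_of_eq (by rw [h])) (F n μ' (X.map (le_of_eq (by rw [h])) x, t)) := by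
  subst h
  rw [Y.map_id, X.map_id]

theorem cohAt (f : CoarseCoherentMap X Y) {m k : ℕ} (μ : MultiIndex Y.Idx m)
    (θ : Fin (k + 1) →o Fin (m + 1)) : CohAt f.maps μ θ := by
  revert μ
  refine orderHom_induction (P := fun {k m} θ => ∀ μ : MultiIndex Y.Idx m, CohAt f.maps μ θ)
    ?_ ?_ (fun j μ => f.face μ j) (fun j μ => f.degeneracy μ j) θ
  · intro m μ
    refine Eventually.of_forall fun n x t => ?_
    have h : stdSimplex.map (OrderHom.id : Fin (m + 1) →o Fin (m + 1)) t = t :=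
      stdSimplex.map_id_apply t
    refine (congrArg (fun s => f.maps n μ (x, s)) h).trans ?_
    exact maps_congr f.maps n (rfl : μ = μ.comp OrderHom.id) x t
  · intro l k m θ θ' h h' μ
    filter_upwards [h μ, h' (μ.comp θ)] with n hn hn' x t
    refine (congrArg (fun s => f.maps n μ (x, s)) (simplex_map_comp θ θ' t)).trans ((hn x _).trans ?_)
    refine (congrArg (Y.map _) (hn' _ t)).trans ((Y.map_comp _ _ _).trans ?_)
    exact congrArg (fun z => Y.map _ (f.maps n (μ.comp (θ.comp θ')) (z, t))) (X.map_comp _ _ _)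

/-- A coarse coherent mapping from a family coherent with respect to all monotone maps. -/
def ofCohAt (idx : Y.Idx →o X.Idx) (maps : CoherentFamily X Y idx)
    (h : ∀ {m k : ℕ} (μ : MultiIndex Y.Idx m) (θ : Fin (k + 1) →o Fin (m + 1)), CohAt maps μ θ) :
    CoarseCoherentMap X Y where
  idx := idx
  maps := maps
  face μ _ := h μ _
  degeneracy μ _ := h μ _

/-! ### Homotopy is an equivalence relation -/

theorem Homotopic.symm {f f' : CoarseCoherentMap X Y} (h : f.Homotopic f') : f'.Homotopic f := by
  obtain ⟨F, h1, h2, hF⟩ := h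
  let σ : ∀ i : X.Idx, ∀ m, C((X.obj i × unitInterval) × Simplex m,
      (X.obj i × unitInterval) × Simplex m) := fun i m =>
    ⟨fun p => ((p.1.1, unitInterval.symm p.1.2), p.2), by fun_prop⟩
  refine ⟨ofCohAt F.idx (fun n m μ => (F.maps n μ).comp (σ _ m)) ?_, h2, h1, ?_⟩
  · intro m k μ θ
    filter_upwards [F.cohAt μ θ] with n hn x t
    exact hn _ t
  · intro m μ
    filter_upwards [hF μ] with n hn x t
    obtain ⟨h3, h4⟩ := hn x t
    constructor
    · refine Eq.trans ?_ h4
      exact congrArg (fun s => F.maps n μ ((x, s), t)) unitInterval.symm_zero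
    · refine Eq.trans ?_ h3
      exact congrArg (fun s => F.maps n μ ((x, s), t)) unitInterval.symm_one

end CoarseCoherentMap

section Concat

variable {A T B : Type*} [TopologicalSpace A] [TopologicalSpace T] [TopologicalSpace B]

open Classical in
/-- Concatenation of two homotopies, with a junk value if they do not fit. -/
noncomputable def concat (a b : C((A × unitInterval) × T, B)) : C((A × unitInterval) × T, B) :=
  if h : ∀ x t, a ((x, 1), t) = b ((x, 0), t) then
    { toFun := fun p => if (p.1.2 : ℝ) ≤ 1 / 2 then
        a ((p.1.1, Set.projIcc 0 1 zero_le_one (2 * p.1.2 : ℝ)), p.2)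
        else b ((p.1.1, Set.projIcc 0 1 zero_le_one (2 * p.1.2 - 1 : ℝ)), p.2)
      continuous_toFun := by
        refine Continuous.if_le ?_ ?_ (by fun_prop) continuous_const ?_
        · exact a.continuous.comp (((continuous_fst.comp continuous_fst).prodMk
            (continuous_projIcc.comp (by fun_prop))).prodMk continuous_snd)
        · exact b.continuous.comp (((continuous_fst.comp continuous_fst).prodMk
            (continuous_projIcc.comp (by fun_prop))).prodMk continuous_snd)
        · intro p hp
          have h1 : (2 * p.1.2 : ℝ) = 1 := by rw [hp]; norm_num
          have h2 : (2 * p.1.2 - 1 : ℝ) = 0 := by rw [h1]; norm_num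
          rw [h2, h1]
          simpa [Set.projIcc_right, Set.projIcc_left] using h p.1.1 p.2 }
  else a

theorem concat_of_le {a b : C((A × unitInterval) × T, B)}
    (h : ∀ x t, a ((x, 1), t) = b ((x, 0), t)) (x : A) (s : unitInterval) (t : T)
    (hs : (s : ℝ) ≤ 1 / 2) :
    concat a b ((x, s), t) = a ((x, Set.projIcc 0 1 zero_le_one (2 * s : ℝ)), t) := by
  rw [concat, dif_pos h]
  exact if_pos hs

theorem concat_of_gt {a b : C((A × unitInterval) × T, B)}
    (h : ∀ x t, a ((x, 1), t) = b ((x, 0), t)) (x : A) (s : unitInterval) (t : T)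
    (hs : ¬ (s : ℝ) ≤ 1 / 2) :
    concat a b ((x, s), t) = b ((x, Set.projIcc 0 1 zero_le_one (2 * s - 1 : ℝ)), t) := by
  rw [concat, dif_pos h]
  exact if_neg hs

end Concat

namespace CoarseCoherentMap

variable {X Y : InvSystem.{u}}

/-- Both homotopies are first pulled back to an index function above theirs. Their ends then agree
only for almost all n depending on the multiindex, whence the junk value in `concat`. -/
theorem Homotopic.trans {f f' f'' : CoarseCoherentMap X Y} (h : f.Homotopic f')
    (h' : f'.Homotopic f'') : f.Homotopic f'' := by
  obtain ⟨F, h1, h2, hF⟩ := h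
  obtain ⟨G, h1', h2', hG⟩ := h'
  choose b hbF hbG using fun ν => X.directed (F.idx ν) (G.idx ν)
  obtain ⟨g, hg⟩ := InvSystem.exists_orderHom_ge X Y b
  have hgF : ∀ ν, F.idx ν ≤ g ν := fun ν => (hbF ν).trans (hg ν)
  have hgG : ∀ ν, G.idx ν ≤ g ν := fun ν => (hbG ν).trans (hg ν)
  let a : ∀ (n : ℕ) {m : ℕ} (μ : MultiIndex Y.Idx m),
      C((X.obj (g (μ (Fin.last m))) × unitInterval) × Simplex m, Y.obj (μ 0)) := fun n m μ =>
    (F.maps n μ).comp (((X.map (hgF _)).prodMap (ContinuousMap.id _)).prodMap (ContinuousMap.id _))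
  let b : ∀ (n : ℕ) {m : ℕ} (μ : MultiIndex Y.Idx m),
      C((X.obj (g (μ (Fin.last m))) × unitInterval) × Simplex m, Y.obj (μ 0)) := fun n m μ =>
    (G.maps n μ).comp (((X.map (hgG _)).prodMap (ContinuousMap.id _)).prodMap (ContinuousMap.id _))
  have hab : ∀ {m : ℕ} (μ : MultiIndex Y.Idx m),
      ∀ᶠ n in atTop, ∀ x t, a n μ ((x, 1), t) = b n μ ((x, 0), t) := by
    intro m μ
    filter_upwards [hF μ, hG μ] with n hn hn' x t
    have e1 := (hn (X.map (hgF _) x) t).2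
    have e2 := (hn' (X.map (hgG _) x) t).1
    rw [X.map_comp] at e1 e2
    exact e1.trans e2.symm
  have ha : ∀ {m k : ℕ} (μ : MultiIndex Y.Idx m) (θ : Fin (k + 1) →o Fin (m + 1)),
      CohAt (X := X.cylinder) (f := g) a μ θ := by
    intro m k μ θ
    filter_upwards [F.cohAt μ θ] with n hn x t
    refine (hn (X.map (hgF _) x.1, x.2) t).trans ?_
    exact congrArg (fun z => Y.map _ (F.maps n (μ.comp θ) ((z, x.2), t)))
      ((X.map_comp _ _ _).trans (X.map_comp _ _ _).symm)
  have hb : ∀ {m k : ℕ} (μ : MultiIndex Y.Idx m) (θ : Fin (k + 1) →o Fin (m + 1)),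
      CohAt (X := X.cylinder) (f := g) b μ θ := by
    intro m k μ θ
    filter_upwards [G.cohAt μ θ] with n hn x t
    refine (hn (X.map (hgG _) x.1, x.2) t).trans ?_
    exact congrArg (fun z => Y.map _ (G.maps n (μ.comp θ) ((z, x.2), t)))
      ((X.map_comp _ _ _).trans (X.map_comp _ _ _).symm)
  refine ⟨ofCohAt (X := X.cylinder) g (fun n m μ => concat (a n μ) (b n μ)) ?_,
    fun μ => (h1 μ).trans (hgF μ), fun μ => (h2' μ).trans (hgG μ), ?_⟩
  · intro m k μ θ
    filter_upwards [hab μ, hab (μ.comp θ), ha μ θ, hb μ θ] with n h1 h2 h3 h4 x t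
    by_cases hs : (x.2 : ℝ) ≤ 1 / 2
    · refine (concat_of_le h1 x.1 x.2 _ hs).trans ((h3 (x.1, _) t).trans ?_)
      exact congrArg _ (concat_of_le h2 _ x.2 _ hs).symm
    · refine (concat_of_gt h1 x.1 x.2 _ hs).trans ((h4 (x.1, _) t).trans ?_)
      exact congrArg _ (concat_of_gt h2 _ x.2 _ hs).symm
  · intro m μ
    filter_upwards [hab μ, hF μ, hG μ] with n h0 hn hn' x t
    constructor
    · refine (concat_of_le h0 x 0 t (by norm_num)).trans ?_
      have e : Set.projIcc (0 : ℝ) 1 zero_le_one (2 * ((0 : unitInterval) : ℝ)) = 0 := by simp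
      rw [e]
      refine ((hn (X.map (hgF _) x) t).1).trans ?_
      exact congrArg (fun z => f.maps n μ (z, t)) (X.map_comp _ _ _)
    · refine (concat_of_gt h0 x 1 t (by norm_num)).trans ?_
      have e : Set.projIcc (0 : ℝ) 1 zero_le_one (2 * ((1 : unitInterval) : ℝ) - 1) = 1 := by
        have : (2 * ((1 : unitInterval) : ℝ) - 1) = 1 := by norm_num
        rw [this]
        simp
      rw [e]
      refine ((hn' (X.map (hgG _) x) t).2).trans ?_
      exact congrArg (fun z => f''.maps n μ (z, t)) (X.map_comp _ _ _)

end CoarseCoherentMap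

/-! ### A natural self-map of the simplex -/

section Reparametrization

theorem simplex_map_val {k m : ℕ} (θ : Fin (k + 1) →o Fin (m + 1)) (t : Simplex k)
    (j : Fin (m + 1)) :
    (stdSimplex.map θ t).1 j = ∑ l, if θ l = j then t.1 l else 0 := by
  have h := FunOnFinite.linearMap_apply_apply ℝ ℝ (⇑θ) (⇑t) j
  rw [Finset.sum_filter] at h
  exact h

/-- The sum of the first `j` coordinates. -/
def partialSum {m : ℕ} (t : Simplex m) (j : ℕ) : ℝ := ∑ l : Fin (m + 1), if l.val < j then t.1 l else 0

theorem partialSum_zero {m : ℕ} (t : Simplex m) : partialSum t 0 = 0 := by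
  simp [partialSum]

theorem partialSum_succ {m : ℕ} (t : Simplex m) (j : Fin (m + 1)) :
    partialSum t (j.val + 1) = partialSum t j.val + t.1 j := by
  have e : t.1 j = ∑ l, if l = j then t.1 l else 0 := by simp
  rw [partialSum, partialSum, e, ← Finset.sum_add_distrib]
  refine Finset.sum_congr rfl fun l _ => ?_
  rcases lt_trichotomy l.val j.val with h | h | h
  · have : l ≠ j := fun e => by simp [e] at h
    simp [h, this, h.trans (Nat.lt_succ_self _)]
  · have : l = j := Fin.ext h
    simp [this]
  · have h1 : l ≠ j := fun e => by simp [e] at h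
    have h2 : ¬ l.val < j.val + 1 := by omega
    have h3 : ¬ l.val < j.val := by omega
    simp [h1, h2, h3]

theorem partialSum_mono {m : ℕ} (t : Simplex m) : Monotone (partialSum t) := by
  intro i j h
  refine Finset.sum_le_sum fun l _ => ?_
  by_cases h1 : l.val < i
  · simp [h1, h1.trans_le h]
  · simp only [h1, if_false]
    split_ifs
    · exact t.2.1 l
    · exact le_rfl

theorem partialSum_top {m : ℕ} (t : Simplex m) : partialSum t (m + 1) = 1 := by
  have h : ∀ l : Fin (m + 1), l.val < m + 1 := fun l => l.2
  simp only [partialSum, h, if_true]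
  exact t.2.2

/-- The clamped doubling map. -/
noncomputable def clampTwice (r : ℝ) : ℝ := min 1 (2 * r)

theorem clampTwice_mono : Monotone clampTwice := fun a b h => min_le_min le_rfl (by linarith)

theorem sum_sub_partialSum {m : ℕ} (t : Simplex m) (φ : ℝ → ℝ) (h0 : φ 0 = 0) (j : ℕ)
    (hj : j ≤ m + 1) :
    (∑ l : Fin (m + 1), if l.val < j then φ (partialSum t (l.val + 1)) - φ (partialSum t l.val)
      else 0) = φ (partialSum t j) := by
  induction j with
  | zero => simp [partialSum_zero, h0]
  | succ j ih =>
    rw [← add_sub_cancel (φ (partialSum t j)) (φ (partialSum t (j + 1))), ← ih (by omega)]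
    have hj' : j < m + 1 := hj
    have : φ (partialSum t (j + 1)) - φ (partialSum t j) = ∑ l : Fin (m + 1),
        if l = ⟨j, hj'⟩ then φ (partialSum t (l.val + 1)) - φ (partialSum t l.val) else 0 := by
      rw [Fintype.sum_ite_eq']
    rw [ih (by omega), this, ← ih (by omega), ← Finset.sum_add_distrib]
    refine Finset.sum_congr rfl fun l _ => ?_
    rcases lt_trichotomy l.val j with h | h | h
    · have h1 : l ≠ ⟨j, hj'⟩ := fun e => by simp [e] at h
      simp [h, h1, h.trans (Nat.lt_succ_self _)]
    · have h1 : l = ⟨j, hj'⟩ := Fin.ext h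
      simp [h1]
    · have h1 : l ≠ ⟨j, hj'⟩ := fun e => by simp [e] at h
      have h2 : ¬ l.val < j + 1 := by omega
      have h3 : ¬ l.val < j := by omega
      simp [h1, h2, h3]

/-- The self-map of `Δ^m` doubling the distribution function. -/
noncomputable def frontLoad {m : ℕ} (t : Simplex m) : Simplex m :=
  ⟨fun j => clampTwice (partialSum t (j.val + 1)) - clampTwice (partialSum t j.val),
    fun j => sub_nonneg.2 (clampTwice_mono (partialSum_mono t (Nat.le_succ _))), by
    have h := sum_sub_partialSum t clampTwice (by simp [clampTwice]) (m + 1) le_rfl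
    have h' : ∀ l : Fin (m + 1), l.val < m + 1 := fun l => l.2
    simp only [h', if_true] at h
    rw [h, partialSum_top]
    norm_num [clampTwice]⟩

theorem partialSum_frontLoad {m : ℕ} (t : Simplex m) (j : ℕ) (hj : j ≤ m + 1) :
    partialSum (frontLoad t) j = clampTwice (partialSum t j) :=
  sum_sub_partialSum t clampTwice (by simp [clampTwice]) j hj

theorem simplex_ext_partialSum {m : ℕ} {s t : Simplex m}
    (h : ∀ j ≤ m + 1, partialSum s j = partialSum t j) : s = t := by
  refine Subtype.ext (funext fun j => ?_)
  have h1 := partialSum_succ s j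
  have h2 := partialSum_succ t j
  rw [h _ j.2, h _ j.2.le] at h1
  linarith

/-- By monotonicity the vertices sent below j form an initial segment, and i is its length. So θ
only selects values of the distribution function, and operations on those values that fix 0 and are
monotone, such as clamped doubling, commute with θ. -/
theorem exists_partialSum_map {k m : ℕ} (θ : Fin (k + 1) →o Fin (m + 1)) (j : ℕ) :
    ∃ i ≤ k + 1, (∀ l : Fin (k + 1), (θ l).val < j ↔ l.val < i) ∧
      ∀ t : Simplex k, partialSum (stdSimplex.map θ t) j = partialSum t i := by
  let D : Finset (Fin (k + 1)) := Finset.univ.filter fun l => (θ l).val < j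
  have hi : ∀ l : Fin (k + 1), (θ l).val < j ↔ l.val < D.sup fun l => l.val + 1 := by
    intro l
    rw [Finset.lt_sup_iff]
    constructor
    · exact fun h => ⟨l, by simpa [D] using h, Nat.lt_succ_self _⟩
    · rintro ⟨l', hl', h⟩
      have h1 : (θ l').val < j := by simpa [D] using hl'
      exact lt_of_le_of_lt (θ.monotone (Fin.le_def.2 (Nat.lt_succ_iff.1 h))) h1
  refine ⟨D.sup fun l => l.val + 1, Finset.sup_le fun l _ => l.2, hi, fun t => ?_⟩
  simp only [partialSum, simplex_map_val, ← hi]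
  have : ∀ l : Fin (m + 1), (if l.val < j then ∑ x, (if θ x = l then t.1 x else 0) else 0) =
      ∑ x, if θ x = l then (if (θ x).val < j then t.1 x else 0) else 0 := by
    intro l
    by_cases h : l.val < j
    · rw [if_pos h]
      refine Finset.sum_congr rfl fun x _ => ?_
      by_cases hx : θ x = l
      · simp [hx, h]
      · simp [hx]
    · rw [if_neg h]
      symm
      refine Finset.sum_eq_zero fun x _ => ?_
      by_cases hx : θ x = l
      · simp [hx, h]
      · simp [hx]
  simp only [this]
  rw [Finset.sum_comm]
  simp

theorem frontLoad_map {k m : ℕ} (θ : Fin (k + 1) →o Fin (m + 1)) (t : Simplex k) :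
    frontLoad (stdSimplex.map θ t) = stdSimplex.map θ (frontLoad t) := by
  refine simplex_ext_partialSum fun j hj => ?_
  obtain ⟨i, hi, -, h⟩ := exists_partialSum_map θ j
  rw [partialSum_frontLoad _ _ hj, h, h, partialSum_frontLoad _ _ hi]

theorem continuous_partialSum {m : ℕ} (j : ℕ) : Continuous fun t : Simplex m => partialSum t j := by
  refine continuous_finsetSum _ fun l _ => ?_
  split_ifs
  · exact (continuous_apply l).comp continuous_subtype_val
  · exact continuous_const

theorem continuous_frontLoad {m : ℕ} : Continuous (frontLoad : Simplex m → Simplex m) := by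
  refine Continuous.subtype_mk (continuous_pi fun j => ?_) _
  have : ∀ j, Continuous fun t : Simplex m => clampTwice (partialSum t j) := fun j =>
    continuous_const.min (continuous_const.mul (continuous_partialSum j))
  exact (this _).sub (this _)

/-- The straight segment from `a` to `b` in a simplex. -/
noncomputable def simplexSegment {m : ℕ} (s : unitInterval) (a b : Simplex m) : Simplex m :=
  ⟨(1 - s.1) • a.1 + s.1 • b.1,
    convex_stdSimplex ℝ _ a.2 b.2 (sub_nonneg.2 s.2.2) s.2.1 (sub_add_cancel _ _)⟩

theorem simplexSegment_zero {m : ℕ} (a b : Simplex m) : simplexSegment 0 a b = a :=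
  Subtype.ext (by simp [simplexSegment])

theorem simplexSegment_one {m : ℕ} (a b : Simplex m) : simplexSegment 1 a b = b :=
  Subtype.ext (by simp [simplexSegment])

theorem simplexSegment_map {k m : ℕ} (θ : Fin (k + 1) →o Fin (m + 1)) (s : unitInterval)
    (a b : Simplex k) : simplexSegment s (stdSimplex.map θ a) (stdSimplex.map θ b) =
      stdSimplex.map θ (simplexSegment s a b) := by
  refine Subtype.ext (funext fun j => ?_)
  rw [simplex_map_val]
  change (1 - s.1) * (stdSimplex.map θ a).1 j + s.1 * (stdSimplex.map θ b).1 j = _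
  rw [simplex_map_val, simplex_map_val, Finset.mul_sum, Finset.mul_sum, ← Finset.sum_add_distrib]
  refine Finset.sum_congr rfl fun l _ => ?_
  split_ifs
  · rfl
  · ring

theorem continuous_simplexSegment {T : Type*} [TopologicalSpace T] {m : ℕ} {s : T → unitInterval}
    {a b : T → Simplex m} (hs : Continuous s) (ha : Continuous a) (hb : Continuous b) :
    Continuous fun x => simplexSegment (s x) (a x) (b x) := by
  refine Continuous.subtype_mk ?_ _
  fun_prop

theorem sumBefore_eq {i k : ℕ} (t : Simplex (i + k)) : sumBefore t = partialSum t i := by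
  have h : ∀ f : Fin (i + (k + 1)) → ℝ, ∑ l, f l = ∑ j : Fin i, f (Fin.castAdd (k + 1) j) +
      ∑ j : Fin (k + 1), f (Fin.natAdd i j) := fun f => Fin.sum_univ_add f
  refine ((h fun l => if l.val < i then t.1 l else 0).trans ?_).symm
  have h1 : ∀ j : Fin i, (Fin.castAdd (k + 1) j).val < i := fun j => j.2
  have h2 : ∀ j : Fin (k + 1), ¬ (Fin.natAdd i j).val < i := fun j => by simp
  simp only [h1, h2, if_true, if_false, Finset.sum_const_zero, add_zero]
  rfl

theorem inPiece_iff {i k : ℕ} (t : Simplex (i + k)) :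
    InPiece i k t ↔ partialSum t i ≤ 1 / 2 ∧ 1 / 2 ≤ partialSum t (i + 1) := by
  have h := partialSum_succ t (backIncl i k 0)
  have h' : (backIncl i k 0).val = i := rfl
  rw [h'] at h
  rw [InPiece, sumBefore_eq, h]

/-- On P_i the distribution function of b_i(t), regarded in the front face, is twice that of t up to
i and equals 1 beyond. The maps b_i on the various pieces are therefore restrictions of one self-map
of Δ^m. -/
theorem frontLoad_eq {i k : ℕ} (t : Simplex (i + k)) (ht : InPiece i k t) :
    frontLoad t = stdSimplex.map (frontIncl i k) (pieceB t ht) := by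
  have ht' := (inPiece_iff t).1 ht
  have hb : ∀ j : Fin i, (pieceB t ht).1 j.castSucc = 2 * t.1 (frontIncl i k j.castSucc) :=
    fun j => by simp [pieceB]
  have hs : ∀ j ≤ i, partialSum (pieceB t ht) j = 2 * partialSum t j := by
    intro j hj
    induction j with
    | zero => simp [partialSum_zero]
    | succ j ih =>
      have h1 := partialSum_succ (pieceB t ht) (⟨j, hj⟩ : Fin i).castSucc
      have h2 := partialSum_succ t (frontIncl i k (⟨j, hj⟩ : Fin i).castSucc)
      rw [hb] at h1
      have e1 : ((⟨j, hj⟩ : Fin i).castSucc).val = j := rfl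
      have e2 : (frontIncl i k (⟨j, hj⟩ : Fin i).castSucc).val = j := rfl
      rw [e1, ih (by omega)] at h1
      rw [e2] at h2
      rw [h1, h2]
      ring
  refine simplex_ext_partialSum fun j hj => ?_
  rw [partialSum_frontLoad _ _ hj]
  obtain ⟨l, hl, h1, h2⟩ := exists_partialSum_map (frontIncl i k) j
  have h1' : ∀ x : Fin (i + 1), x.val < j ↔ x.val < l := h1
  rw [h2]
  rcases le_or_gt j i with h | h
  · have : l = j := by
      rcases lt_trichotomy l j with h3 | h3 | h3
      · have := (h1' ⟨l, by omega⟩).1 h3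
        simp at this
      · exact h3
      · have := (h1' ⟨j, by omega⟩).2 h3
        simp at this
    rw [this, hs j h, clampTwice, min_eq_right]
    have := partialSum_mono t h
    linarith
  · have : l = i + 1 := by
      refine le_antisymm hl ?_
      have := (h1' ⟨i, by omega⟩).1 h
      exact this
    rw [this, partialSum_top, clampTwice, min_eq_left]
    have := partialSum_mono t (Nat.succ_le_of_lt h)
    have h3 := ht'.2
    simp only [Nat.succ_eq_add_one] at this
    linarith

theorem exists_partialSum_le {m : ℕ} (t : Simplex m) :
    ∃ i : Fin (m + 1), partialSum t i.val ≤ 1 / 2 ∧ 1 / 2 ≤ partialSum t (i.val + 1) := by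
  by_contra! h
  have : ∀ j ≤ m + 1, partialSum t j ≤ 1 / 2 := by
    intro j hj
    induction j with
    | zero => rw [partialSum_zero]; norm_num
    | succ j ih => exact (h ⟨j, hj⟩ (ih (by omega))).le
  have h1 := this (m + 1) le_rfl
  rw [partialSum_top] at h1
  norm_num at h1

end Reparametrization

/-! ### Factorizations in terms of pulled back coherent mappings -/

namespace CoarseMorphism

variable {A : Type u} [TopologicalSpace A] {S Z : InvSystem.{u}}

/-- The coarse coherent mapping `f^n_ν̄(p^n_{f(ν_m)}(a), η(t))`. -/
def pullAux (p : CoarseMorphism A S) (f : CoarseCoherentMap S Z) (η : ∀ m, C(Simplex m, Simplex m))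
    (hη : ∀ {m k : ℕ} (θ : Fin (k + 1) →o Fin (m + 1)) (t : Simplex k),
      η m (stdSimplex.map θ t) = stdSimplex.map θ (η k t)) :
    CoarseCoherentMap (InvSystem.rudimentary A) Z :=
  CoarseCoherentMap.ofCohAt ⟨fun _ => PUnit.unit, fun _ _ _ => le_refl _⟩
    (fun n m ν => (f.maps n ν).comp
      ((p.maps n (f.idx (ν (Fin.last m)))).prodMap (η m))) fun {m k} ν θ => by
    filter_upwards [f.cohAt ν θ,
      p.comm (f.idx.monotone (ν.monotone (Fin.le_last (θ (Fin.last k)))))] with n hn hn' a t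
    have h1 : f.maps n ν (p.maps n (f.idx (ν (Fin.last m))) a, η m (stdSimplex.map θ t)) =
        f.maps n ν (p.maps n (f.idx (ν (Fin.last m))) a, stdSimplex.map θ (η k t)) :=
      congrArg (fun s => f.maps n ν (p.maps n (f.idx (ν (Fin.last m))) a, s)) (hη θ t)
    refine h1.trans ((hn _ _).trans ?_)
    exact congrArg (fun x => Z.map _ (f.maps n (ν.comp θ) (x, η k t))) (hn' a)

/-- The coarse coherent mapping `f^n_ν̄(p^n_{f(ν_m)}(a), t)`. -/
def pull (p : CoarseMorphism A S) (f : CoarseCoherentMap S Z) :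
    CoarseCoherentMap (InvSystem.rudimentary A) Z :=
  p.pullAux f (fun _ => ContinuousMap.id _) fun _ _ => rfl

/-- The explicit representative of the composite of `f` and `C*(p)`. -/
noncomputable def pullFront (p : CoarseMorphism A S) (f : CoarseCoherentMap S Z) :
    CoarseCoherentMap (InvSystem.rudimentary A) Z :=
  p.pullAux f (fun _ => ⟨frontLoad, continuous_frontLoad⟩) fun θ t => frontLoad_map θ t

/-- Both `frontLoad` and the straight segment to the identity are natural in the simplex, so the
segment deforms the simplex variable coherently. -/
theorem pullFront_homotopic_pull (p : CoarseMorphism A S) (f : CoarseCoherentMap S Z) :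
    (p.pullFront f).Homotopic (p.pull f) := by
  let F : CoarseCoherentMap (InvSystem.rudimentary A).cylinder Z :=
    CoarseCoherentMap.ofCohAt ⟨fun _ => PUnit.unit, fun _ _ _ => le_refl _⟩
      (fun n m ν => (f.maps n ν).comp
        (⟨fun x => (p.maps n (f.idx (ν (Fin.last m))) x.1.1,
            simplexSegment x.1.2 (frontLoad x.2) x.2),
          ((p.maps n _).continuous.comp (continuous_fst.comp continuous_fst)).prodMk
            (continuous_simplexSegment (continuous_snd.comp continuous_fst)
              (continuous_frontLoad.comp continuous_snd) continuous_snd)⟩ :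
          C((A × unitInterval) × Simplex m, S.obj (f.idx (ν (Fin.last m))) × Simplex m)))
      fun {m k} ν θ => by
      filter_upwards [f.cohAt ν θ,
        p.comm (f.idx.monotone (ν.monotone (Fin.le_last (θ (Fin.last k)))))] with n hn hn' a t
      have h1 : simplexSegment a.2 (frontLoad (stdSimplex.map θ t)) (stdSimplex.map θ t) =
          stdSimplex.map θ (simplexSegment a.2 (frontLoad t) t) := by
        rw [frontLoad_map, simplexSegment_map]
      refine (congrArg (fun s => f.maps n ν (p.maps n (f.idx (ν (Fin.last m))) a.1, s)) h1).trans
        ((hn _ _).trans ?_)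
      exact congrArg (fun x => Z.map _
        (f.maps n (ν.comp θ) (x, simplexSegment a.2 (frontLoad t) t))) (hn' a.1)
  refine ⟨F, fun _ => le_refl _, fun _ => le_refl _, fun {m} ν => Eventually.of_forall
    fun n x t => ⟨?_, ?_⟩⟩
  · exact congrArg (fun s => f.maps n ν (p.maps n (f.idx (ν (Fin.last m))) x, s))
      (simplexSegment_zero (frontLoad t) t)
  · exact congrArg (fun s => f.maps n ν (p.maps n (f.idx (ν (Fin.last m))) x, s))
      (simplexSegment_one (frontLoad t) t)

theorem homotopic_of_eventually_eq {f f' : CoarseCoherentMap (InvSystem.rudimentary A) Z}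
    (h : ∀ {m : ℕ} (ν : MultiIndex Z.Idx m), ∀ᶠ n in atTop, ∀ (a : A) (t : Simplex m),
      f.maps n ν (a, t) = f'.maps n ν (a, t)) : f.Homotopic f' := by
  let F : CoarseCoherentMap (InvSystem.rudimentary A).cylinder Z :=
    CoarseCoherentMap.ofCohAt ⟨fun _ => PUnit.unit, fun _ _ _ => le_refl _⟩
      (fun n m ν => (f.maps n ν).comp
        (⟨fun x => (x.1.1, x.2), by fun_prop⟩ : C((A × unitInterval) × Simplex m, A × Simplex m)))
      fun {m k} ν θ => by
      filter_upwards [f.cohAt ν θ] with n hn a t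
      exact hn a.1 t
  refine ⟨F, fun _ => le_refl _, fun _ => le_refl _, fun {m} ν => ?_⟩
  filter_upwards [h ν] with n hn x t
  exact ⟨rfl, hn x t⟩

/-- C*(p) ignores its simplex variable, so a_i drops out of the composition formula; what is left is
coherence of f along the inclusion of the front face ν₀…ν_i. -/
theorem isComp_iff_pullFront (p : CoarseMorphism A S) (f : CoarseCoherentMap S Z)
    (i k : ℕ) (ν : MultiIndex Z.Idx (i + k)) : ∀ᶠ n in atTop, ∀ (a : A) (t : Simplex (i + k))
      (ht : InPiece i k t), (p.pullFront f).maps n ν (a, t) =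
        f.maps n (ν.comp (frontIncl i k))
          (S.map (f.idx.monotone (ν.monotone (frontIncl_last_le i k)))
            (p.maps n (f.idx (ν (backIncl i k 0))) a), pieceB t ht) := by
  filter_upwards [f.cohAt ν (frontIncl i k),
    p.comm (f.idx.monotone (ν.monotone (Fin.le_last (frontIncl i k (Fin.last i))))),
    p.comm (f.idx.monotone (ν.monotone (frontIncl_last_le i k)))] with n h1 h2 h3 a t ht
  have e : (p.pullFront f).maps n ν (a, t) =
      f.maps n ν (p.maps n (f.idx (ν (Fin.last (i + k)))) a, frontLoad t) := rfl
  rw [e, frontLoad_eq t ht]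
  refine (h1 _ _).trans ((Z.map_id _ _).trans ?_)
  exact congrArg (fun x => f.maps n (ν.comp (frontIncl i k)) (x, pieceB t ht))
    ((h2 a).trans (h3 a).symm)

/-- The finitely many pieces P_i cover Δ^m, so every representative of the composite agrees with
`pullFront` for almost all n. From here on the composition formula is no longer needed. -/
theorem factors_iff (p : CoarseMorphism A S) (h : CoarseCoherentMap (InvSystem.rudimentary A) Z)
    (f : CoarseCoherentMap S Z) : p.Factors h f ↔ h.Homotopic (p.pull f) := by
  constructor
  · rintro ⟨c, ⟨e, hc⟩, hh⟩
    refine hh.trans (CoarseCoherentMap.Homotopic.trans ?_ (p.pullFront_homotopic_pull f))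
    refine homotopic_of_eventually_eq fun {m} ν => ?_
    have key : ∀ i : Fin (m + 1), ∀ᶠ n in atTop, ∀ (a : A) (t : Simplex m),
        partialSum t i.val ≤ 1 / 2 ∧ 1 / 2 ≤ partialSum t (i.val + 1) →
        c.maps n ν (a, t) = (p.pullFront f).maps n ν (a, t) := by
      intro i
      obtain ⟨i, hi⟩ := i
      obtain ⟨k, rfl⟩ := Nat.exists_eq_add_of_le (Nat.lt_succ_iff.1 hi)
      filter_upwards [hc i k ν, p.isComp_iff_pullFront f i k ν] with n h1 h2 a t ht
      have ht' := (inPiece_iff t).2 ht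
      exact (h1 a t ht').trans (h2 a t ht').symm
    filter_upwards [eventually_all.2 key] with n hn a t
    obtain ⟨i, hi⟩ := exists_partialSum_le t
    exact hn i a t hi
  · intro hh
    refine ⟨p.pullFront f, ⟨fun _ => rfl, fun i k ν => ?_⟩,
      hh.trans (p.pullFront_homotopic_pull f).symm⟩
    filter_upwards [p.isComp_iff_pullFront f i k ν] with n hn a t ht
    exact hn a t ht

end CoarseMorphism

/-! ### Gluing and homotopy extension -/

theorem exists_glue {W Y ι : Type*} [TopologicalSpace W] [TopologicalSpace Y] [Finite ι]
    (F : ι → Set W) (hF : ∀ i, IsClosed (F i)) (hc : ∀ w, ∃ i, w ∈ F i) (f : ∀ i, C(F i, Y))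
    (hf : ∀ i j w (hi : w ∈ F i) (hj : w ∈ F j), f i ⟨w, hi⟩ = f j ⟨w, hj⟩) :
    ∃ g : C(W, Y), ∀ i w (h : w ∈ F i), g w = f i ⟨w, h⟩ := by
  choose c hcF using hc
  let g : W → Y := fun w => f (c w) ⟨w, hcF w⟩
  have hg : ∀ i w (h : w ∈ F i), g w = f i ⟨w, h⟩ := fun i w h => hf _ _ _ _ _
  refine ⟨⟨g, (locallyFinite_of_finite F).continuous ?_ hF fun i => ?_⟩, hg⟩
  · rw [Set.eq_univ_iff_forall]
    exact fun w => Set.mem_iUnion.2 ⟨c w, hcF w⟩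
  · rw [continuousOn_iff_continuous_domRestrict]
    have : (F i).domRestrict g = f i := funext fun w => hg i w.1 w.2
    rw [this]
    exact (f i).continuous

/-- A gauge on a space `K`, with a partial scaling by which the frontier `{g = 1}` absorbs. -/
structure Gauge (K : Type*) [TopologicalSpace K] where
  g : K → ℝ
  continuous_g : Continuous g
  le_one : ∀ x, g x ≤ 1
  scale : K → ℝ → K
  continuousOn_scale : ContinuousOn (fun p : K × ℝ => scale p.1 p.2) {p | g p.1 ≤ p.2 ∧ 0 < p.2}
  scale_one : ∀ x, scale x 1 = x
  g_scale : ∀ x r, g x ≤ r → 0 < r → g (scale x r) = g x / r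

namespace Gauge

variable {K : Type*} [TopologicalSpace K]

/-- The frontier of a gauge. -/
abbrev Frontier (G : Gauge K) : Type _ := {x : K // G.g x = 1}

/-- The gauge whose frontier is empty. -/
def trivial (K : Type*) [TopologicalSpace K] : Gauge K where
  g _ := 0
  continuous_g := continuous_const
  le_one _ := zero_le_one
  scale x _ := x
  continuousOn_scale := continuous_fst.continuousOn
  scale_one _ := rfl
  g_scale _ _ _ _ := (zero_div _).symm

/-- The gauge on the product whose frontier is the boundary of the product. -/
def prod {K' : Type*} [TopologicalSpace K'] (G : Gauge K) (G' : Gauge K') : Gauge (K × K') where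
  g x := max (G.g x.1) (G'.g x.2)
  continuous_g := (G.continuous_g.comp continuous_fst).max (G'.continuous_g.comp continuous_snd)
  le_one x := max_le (G.le_one _) (G'.le_one _)
  scale x r := (G.scale x.1 r, G'.scale x.2 r)
  continuousOn_scale := by
    refine ContinuousOn.prodMk ?_ ?_
    · refine G.continuousOn_scale.comp (f := fun p : (K × K') × ℝ => (p.1.1, p.2))
        (by fun_prop) fun p hp => ?_
      exact ⟨(le_max_left _ _).trans hp.1, hp.2⟩
    · refine G'.continuousOn_scale.comp (f := fun p : (K × K') × ℝ => (p.1.2, p.2))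
        (by fun_prop) fun p hp => ?_
      exact ⟨(le_max_right _ _).trans hp.1, hp.2⟩
  scale_one x := Prod.ext (G.scale_one _) (G'.scale_one _)
  g_scale x r h h0 := by
    change max (G.g (G.scale x.1 r)) (G'.g (G'.scale x.2 r)) = _
    rw [G.g_scale x.1 r ((le_max_left _ _).trans h) h0,
      G'.g_scale x.2 r ((le_max_right _ _).trans h) h0]
    exact max_div_div_right h0.le _ _

/-- The gauge on the unit interval whose frontier consists of the end points. -/
noncomputable def interval : Gauge unitInterval where
  g x := |2 * (x : ℝ) - 1|
  continuous_g := by fun_prop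
  le_one x := abs_le.2 ⟨by linarith [x.2.1], by linarith [x.2.2]⟩
  scale x r := Set.projIcc 0 1 zero_le_one (1 / 2 + ((x : ℝ) - 1 / 2) / r)
  continuousOn_scale := by
    refine continuous_projIcc.comp_continuousOn ?_
    refine continuousOn_const.add (ContinuousOn.div (by fun_prop) (by fun_prop) fun p hp => hp.2.ne')
  scale_one x := by
    rw [div_one, add_sub_cancel]
    exact Set.projIcc_val _ x
  g_scale x r h h0 := by
    have h' := abs_le.1 h
    have h1 : -(1 / 2) ≤ ((x : ℝ) - 1 / 2) / r := by
      rw [le_div_iff₀ h0]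
      linarith
    have h2 : ((x : ℝ) - 1 / 2) / r ≤ 1 / 2 := by
      rw [div_le_iff₀ h0]
      linarith
    rw [Set.projIcc_of_mem zero_le_one ⟨by linarith, by linarith⟩]
    change |2 * (1 / 2 + ((x : ℝ) - 1 / 2) / r) - 1| = _
    have e : 2 * (1 / 2 + ((x : ℝ) - 1 / 2) / r) - 1 = (2 * (x : ℝ) - 1) / r := by
      field_simp
      ring
    rw [e, abs_div, abs_of_pos h0]

variable {A P : Type*} [TopologicalSpace A] [TopologicalSpace P]

/-- Radial projection from the point at height 2 above the centre, expressed by the scaling,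
retracts K × I onto the bottom together with the sides over the frontier. -/
theorem homotopy_extension (G : Gauge K) (h : C(A × K, P)) (b : C((A × G.Frontier) × unitInterval, P))
    (h0 : ∀ a l, b ((a, l), 0) = h (a, l.1)) :
    ∃ H : C((A × K) × unitInterval, P), (∀ a x, H ((a, x), 0) = h (a, x)) ∧
      ∀ a l s, H ((a, l.1), s) = b ((a, l), s) := by
  -- At `true` the ray from height 2 through (x, s) meets the bottom, after scaling x by (2 - s)/2.
  -- At `false` it meets the side, at height 2 - (2 - s)/g(x).
  let F : Bool → Set ((A × K) × unitInterval) := fun i => bif i then {w | G.g w.1.2 ≤ (2 - w.2) / 2}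
    else {w | (2 - (w.2 : ℝ)) / 2 ≤ G.g w.1.2}
  have hg : Continuous fun w : (A × K) × unitInterval => G.g w.1.2 := G.continuous_g.comp (by fun_prop)
  have hpos : ∀ w : (A × K) × unitInterval, 0 < (2 - (w.2 : ℝ)) / 2 := fun w => by linarith [w.2.2.2]
  have c1 : Continuous fun w : F true => G.scale w.1.1.2 ((2 - (w.1.2 : ℝ)) / 2) := by
    refine G.continuousOn_scale.comp_continuous
      (f := fun w : F true => (w.1.1.2, (2 - (w.1.2 : ℝ)) / 2)) (by fun_prop) fun w => ?_
    exact ⟨w.2, hpos w.1⟩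
  have hlpos : ∀ w : F false, 0 < G.g w.1.1.2 := fun w => (hpos w.1).trans_le w.2
  have c2 : Continuous fun w : F false => G.scale w.1.1.2 (G.g w.1.1.2) := by
    refine G.continuousOn_scale.comp_continuous
      (f := fun w : F false => (w.1.1.2, G.g w.1.1.2)) ?_ fun w => ?_
    · exact Continuous.prodMk (by fun_prop) (hg.comp continuous_subtype_val)
    · exact ⟨le_rfl, hlpos w⟩
  have hl : ∀ w : F false, G.g (G.scale w.1.1.2 (G.g w.1.1.2)) = 1 := fun w => by
    rw [G.g_scale _ _ le_rfl (hlpos w), div_self (hlpos w).ne']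
  let f₁ : C(F true, P) := ⟨fun w => h (w.1.1.1, G.scale w.1.1.2 ((2 - (w.1.2 : ℝ)) / 2)),
    h.continuous.comp (Continuous.prodMk (by fun_prop) c1)⟩
  let f₂ : C(F false, P) := ⟨fun w => b ((w.1.1.1, ⟨G.scale w.1.1.2 (G.g w.1.1.2), hl w⟩),
      Set.projIcc 0 1 zero_le_one (2 - (2 - (w.1.2 : ℝ)) / G.g w.1.1.2)), by
    refine b.continuous.comp (Continuous.prodMk (Continuous.prodMk (by fun_prop)
      (c2.subtype_mk _)) (continuous_projIcc.comp ?_))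
    refine continuous_const.sub (Continuous.div (by fun_prop) (hg.comp continuous_subtype_val)
      fun w => (hlpos w).ne')⟩
  have key : ∀ w (h1 : w ∈ F true) (h2 : w ∈ F false), f₁ ⟨w, h1⟩ = f₂ ⟨w, h2⟩ := by
    intro w h1 h2
    have e : G.g w.1.2 = (2 - (w.2 : ℝ)) / 2 := le_antisymm h1 h2
    have e' : 2 - (2 - (w.2 : ℝ)) / G.g w.1.2 = 0 := by
      rw [e]
      have := hpos w
      have h2 : 2 - (w.2 : ℝ) ≠ 0 := fun h => by rw [h] at this; norm_num at this
      rw [div_div_cancel₀ h2, sub_self]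
    have e2 : Set.projIcc (0 : ℝ) 1 zero_le_one (2 - (2 - (w.2 : ℝ)) / G.g w.1.2) = 0 := by
      rw [e']
      exact Set.projIcc_left _
    refine Eq.symm ((congrArg (fun s => b ((w.1.1, ⟨G.scale w.1.2 (G.g w.1.2), hl ⟨w, h2⟩⟩), s))
      e2).trans ((h0 _ _).trans ?_))
    exact congrArg (fun r => h (w.1.1, G.scale w.1.2 r)) e
  obtain ⟨H, hH⟩ := exists_glue F (fun i => by
      cases i
      · exact isClosed_le (by fun_prop) hg
      · exact isClosed_le hg (by fun_prop))
    (fun w => (le_total (G.g w.1.2) ((2 - w.2) / 2)).elim (fun h => ⟨true, h⟩) fun h => ⟨false, h⟩)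
    (fun i => match i with
      | true => f₁
      | false => f₂)
    (fun i j w hi hj => by
      cases i <;> cases j
      · rfl
      · exact (key w hj hi).symm
      · exact key w hi hj
      · rfl)
  refine ⟨H, fun a x => ?_, fun a l s => ?_⟩
  · have e : (2 - ((0 : unitInterval) : ℝ)) / 2 = 1 := by norm_num
    have hm : ((a, x), (0 : unitInterval)) ∈ F true := by
      change G.g x ≤ (2 - ((0 : unitInterval) : ℝ)) / 2
      rw [e]
      exact G.le_one x
    refine (hH true _ hm).trans ?_
    refine congrArg (fun y => h (a, y)) ?_
    change G.scale x ((2 - ((0 : unitInterval) : ℝ)) / 2) = x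
    rw [e, G.scale_one]
  · have hm : ((a, l.1), s) ∈ F false := by
      change (2 - (s : ℝ)) / 2 ≤ G.g l.1
      rw [l.2]
      linarith [s.2.1]
    refine (hH false _ hm).trans ?_
    have e1 : (⟨G.scale l.1 (G.g l.1), hl ⟨((a, l.1), s), hm⟩⟩ : G.Frontier) = l :=
      Subtype.ext ((congrArg (G.scale l.1) l.2).trans (G.scale_one _))
    have e2 : Set.projIcc (0 : ℝ) 1 zero_le_one (2 - (2 - (s : ℝ)) / G.g l.1) = s := by
      rw [l.2, div_one, sub_sub_cancel]
      exact Set.projIcc_val _ s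
    change b ((a, ⟨G.scale l.1 (G.g l.1), hl ⟨((a, l.1), s), hm⟩⟩),
      Set.projIcc (0 : ℝ) 1 zero_le_one (2 - (2 - (s : ℝ)) / G.g l.1)) = _
    rw [e1, e2]

theorem interval_eq_one_iff (t : unitInterval) : interval.g t = 1 ↔ t = 0 ∨ t = 1 := by
  change |2 * (t : ℝ) - 1| = 1 ↔ _
  rw [abs_eq zero_le_one]
  constructor
  · rintro (h | h)
    · exact Or.inr (Subtype.ext (by change (t : ℝ) = 1; linarith))
    · exact Or.inl (Subtype.ext (by change (t : ℝ) = 0; linarith))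
  · rintro (rfl | rfl)
    · right; simp
    · left; norm_num

/-- Over a square of maps on the frontier, lifts to `K` over three sides extend to a lift over the
fourth side. -/
theorem exists_fourth_side (G : Gauge K)
    (b : C((A × G.Frontier) × (unitInterval × unitInterval), P)) (d c₀ c₁ : C((A × K) × unitInterval, P))
    (hd : ∀ a l t, d ((a, l.1), t) = b ((a, l), (0, t)))
    (hc₀ : ∀ a l s, c₀ ((a, l.1), s) = b ((a, l), (s, 0)))
    (hc₁ : ∀ a l s, c₁ ((a, l.1), s) = b ((a, l), (s, 1)))
    (h₀ : ∀ a x, c₀ ((a, x), 0) = d ((a, x), 0)) (h₁ : ∀ a x, c₁ ((a, x), 0) = d ((a, x), 1)) :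
    ∃ E : C((A × K) × unitInterval, P), (∀ a l t, E ((a, l.1), t) = b ((a, l), (1, t))) ∧
      (∀ a x, E ((a, x), 0) = c₀ ((a, x), 1)) ∧ ∀ a x, E ((a, x), 1) = c₁ ((a, x), 1) := by
  let G₂ := G.prod interval
  -- The frontier of K × I consists of the two ends, carrying c₀ and c₁, and of the frontier of K
  -- times I, carrying b. The fourth side is the end of a homotopy of d that extends these data.
  let F : Fin 3 → Set ((A × (G.prod interval).Frontier) × unitInterval) := ![{w | w.1.2.1.2 = 0}, {w | w.1.2.1.2 = 1}, {w | G.g w.1.2.1.1 = 1}]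
  let f₀ : C(F 0, P) := c₀.comp ⟨fun w => ((w.1.1.1, w.1.1.2.1.1), w.1.2), by fun_prop⟩
  let f₁ : C(F 1, P) := c₁.comp ⟨fun w => ((w.1.1.1, w.1.1.2.1.1), w.1.2), by fun_prop⟩
  let f₂ : C(F 2, P) := b.comp ⟨fun w => ((w.1.1.1, ⟨w.1.1.2.1.1, w.2⟩), (w.1.2, w.1.1.2.1.2)), by
    refine Continuous.prodMk (Continuous.prodMk (by fun_prop) (Continuous.subtype_mk ?_ _)) ?_
    · fun_prop
    · fun_prop⟩
  have k01 : ∀ w (h : w ∈ F 0) (h' : w ∈ F 1), f₀ ⟨w, h⟩ = f₁ ⟨w, h'⟩ := fun w h h' => by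
    have : (0 : unitInterval) = 1 := (Eq.symm h).trans h'
    exact absurd this zero_ne_one
  have k02 : ∀ w (h : w ∈ F 0) (h' : w ∈ F 2), f₀ ⟨w, h⟩ = f₂ ⟨w, h'⟩ := fun w h h' => by
    refine (hc₀ w.1.1 ⟨w.1.2.1.1, h'⟩ w.2).trans ?_
    exact congrArg (fun t => b ((w.1.1, ⟨w.1.2.1.1, h'⟩), (w.2, t))) (Eq.symm h)
  have k12 : ∀ w (h : w ∈ F 1) (h' : w ∈ F 2), f₁ ⟨w, h⟩ = f₂ ⟨w, h'⟩ := fun w h h' => by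
    refine (hc₁ w.1.1 ⟨w.1.2.1.1, h'⟩ w.2).trans ?_
    exact congrArg (fun t => b ((w.1.1, ⟨w.1.2.1.1, h'⟩), (w.2, t))) (Eq.symm h)
  obtain ⟨B, hB⟩ := exists_glue F (fun i => by
      fin_cases i
      · exact isClosed_eq (by fun_prop) continuous_const
      · exact isClosed_eq (by fun_prop) continuous_const
      · exact isClosed_eq (G.continuous_g.comp (by fun_prop)) continuous_const)
    (fun w => by
      have h : max (G.g w.1.2.1.1) (interval.g w.1.2.1.2) = 1 := w.1.2.2
      rcases max_choice (G.g w.1.2.1.1) (interval.g w.1.2.1.2) with h' | h'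
      · exact ⟨2, h'.symm.trans h⟩
      · rcases (interval_eq_one_iff _).1 (h'.symm.trans h) with h'' | h''
        · exact ⟨0, h''⟩
        · exact ⟨1, h''⟩)
    (fun i => match i with
      | 0 => f₀
      | 1 => f₁
      | 2 => f₂)
    (fun i j w hi hj => by
      fin_cases i <;> fin_cases j
      · rfl
      · exact k01 w hi hj
      · exact k02 w hi hj
      · exact (k01 w hj hi).symm
      · rfl
      · exact k12 w hi hj
      · exact (k02 w hj hi).symm
      · exact (k12 w hj hi).symm
      · rfl)
  let d' : C(A × (K × unitInterval), P) := d.comp ⟨fun w => ((w.1, w.2.1), w.2.2), by fun_prop⟩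
  obtain ⟨H, hH0, hHL⟩ := G₂.homotopy_extension d' B (by
    intro a l
    have h : max (G.g l.1.1) (interval.g l.1.2) = 1 := l.2
    rcases max_choice (G.g l.1.1) (interval.g l.1.2) with h' | h'
    · have h2 : G.g l.1.1 = 1 := h'.symm.trans h
      exact (hB 2 ((a, l), 0) h2).trans (hd a ⟨l.1.1, h2⟩ l.1.2).symm
    · rcases (interval_eq_one_iff _).1 (h'.symm.trans h) with h'' | h''
      · refine (hB 0 ((a, l), 0) h'').trans ((h₀ a l.1.1).trans ?_)
        exact congrArg (fun t => d ((a, l.1.1), t)) h''.symm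
      · refine (hB 1 ((a, l), 0) h'').trans ((h₁ a l.1.1).trans ?_)
        exact congrArg (fun t => d ((a, l.1.1), t)) h''.symm)
  have hfr : ∀ (x : K) (t : unitInterval), t = 0 ∨ t = 1 → G₂.g (x, t) = 1 := fun x t ht => by
    have h1 : interval.g t = 1 := (interval_eq_one_iff t).2 ht
    change max (G.g x) (interval.g t) = 1
    rw [h1]
    exact max_eq_right (G.le_one x)
  refine ⟨H.comp ⟨fun w => ((w.1.1, (w.1.2, w.2)), 1), by fun_prop⟩, fun a l t => ?_,
    fun a x => ?_, fun a x => ?_⟩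
  · have hl : G₂.g (l.1, t) = 1 := by
      change max (G.g l.1) (interval.g t) = 1
      rw [l.2]
      exact max_eq_left (interval.le_one t)
    exact (hHL a ⟨(l.1, t), hl⟩ 1).trans (hB 2 ((a, ⟨(l.1, t), hl⟩), 1) l.2)
  · have hl := hfr x 0 (Or.inl rfl)
    exact (hHL a ⟨(x, 0), hl⟩ 1).trans (hB 0 ((a, ⟨(x, 0), hl⟩), 1) rfl)
  · have hl := hfr x 1 (Or.inr rfl)
    exact (hHL a ⟨(x, 1), hl⟩ 1).trans (hB 1 ((a, ⟨(x, 1), hl⟩), 1) rfl)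

end Gauge

/-- Sequences must be defined for every n although the constructions succeed only for almost all n;
hence the nonemptiness arguments that accompany each use. -/
theorem exists_of_eventually_exists {α : ℕ → Type*} [∀ n, Nonempty (α n)] {p : ∀ n, α n → Prop}
    (h : ∀ᶠ n in atTop, ∃ x, p n x) : ∃ x : ∀ n, α n, ∀ᶠ n in atTop, p n (x n) :=
  ⟨fun n => Classical.epsilon (p n), h.mono fun _ hn => Classical.epsilon_spec hn⟩

/-! ### Extension property of strong expansions -/

namespace CoarseCoherentMap

/-- The coherent mapping into a space given by a sequence of mappings of one term. -/
def ofSeq {S : InvSystem.{u}} {Q : Type u} [TopologicalSpace Q] (i : S.Idx)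
    (k : ℕ → C(S.obj i, Q)) : CoarseCoherentMap S (InvSystem.rudimentary Q) :=
  ofCohAt ⟨fun _ => i, fun _ _ _ => le_rfl⟩ (fun n _ _ => (k n).comp ContinuousMap.fst)
    fun _ _ => Eventually.of_forall fun n x _ => congrArg (k n) (S.map_id i x).symm

end CoarseCoherentMap

namespace CoarseMorphism

variable {A : Type u} [TopologicalSpace A] {S Z : InvSystem.{u}}

theorem IsStrongExpansion.homotopic_of_pull {p : CoarseMorphism A S} (hp : p.IsStrongExpansion)
    (hZ : Z.InHPol) {f f' : CoarseCoherentMap S Z} (h : (p.pull f).Homotopic (p.pull f')) :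
    f.Homotopic f' := by
  obtain ⟨f₀, -, hf₀⟩ := hp.2 Z hZ (p.pull f')
  have hr : (p.pull f').Homotopic (p.pull f') := h.symm.trans h
  exact (hf₀ f ((p.factors_iff _ _).2 h.symm)).trans (hf₀ f' ((p.factors_iff _ _).2 hr)).symm

/-- Homotopies over the space between sequences defined over terms of the system come from
homotopies over the system. -/
theorem IsStrongExpansion.exists_homotopy {p : CoarseMorphism A S} (hp : p.IsStrongExpansion)
    {Q : Type u} [TopologicalSpace Q] (hQ : IsHPol Q) {i j : S.Idx} (k : ℕ → C(S.obj i, Q))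
    (l : ℕ → C(S.obj j, Q)) (H : ℕ → C(A × unitInterval, Q))
    (hH : ∀ᶠ n in atTop, ∀ a, H n (a, 0) = k n (p.maps n i a) ∧ H n (a, 1) = l n (p.maps n j a)) :
    ∃ (r : S.Idx) (hi : i ≤ r) (hj : j ≤ r) (G : ℕ → C(S.obj r × unitInterval, Q)),
      ∀ᶠ n in atTop, ∀ x, G n (x, 0) = l n (S.map hj x) ∧ G n (x, 1) = k n (S.map hi x) := by
  have h : (p.pull (CoarseCoherentMap.ofSeq i k)).Homotopic
      (p.pull (CoarseCoherentMap.ofSeq j l)) := by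
    refine ⟨CoarseCoherentMap.ofCohAt (X := (InvSystem.rudimentary A).cylinder)
      ⟨fun _ => PUnit.unit, fun _ _ _ => le_rfl⟩ (fun n _ _ => (H n).comp ContinuousMap.fst)
      fun _ _ => Eventually.of_forall fun n x _ => rfl, fun _ => le_rfl, fun _ => le_rfl, ?_⟩
    intro m μ
    filter_upwards [hH] with n hn x t
    exact hn x
  obtain ⟨F, h1, h2, hF⟩ := (hp.homotopic_of_pull (fun _ => hQ) h).symm
  let c : MultiIndex PUnit 0 := ⟨fun _ => PUnit.unit, fun _ _ _ => le_rfl⟩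
  let pt : Simplex 0 := stdSimplex.vertex 0
  refine ⟨F.idx PUnit.unit, h2 _, h1 _, fun n => (F.maps n c).comp
    ⟨fun x => (x, pt), by fun_prop⟩, ?_⟩
  filter_upwards [hF c] with n hn x
  exact hn x pt

end CoarseMorphism

theorem continuous_prod_sum_sigma {T P X ι : Type*} {Y : ι → Type*} [TopologicalSpace T]
    [TopologicalSpace P] [TopologicalSpace X] [∀ i, TopologicalSpace (Y i)]
    {f : T × (X ⊕ (i : ι) × Y i) → P}
    (h : Continuous fun x : T × X => f (x.1, Sum.inl x.2))
    (h' : ∀ i, Continuous fun x : T × Y i => f (x.1, Sum.inr ⟨i, x.2⟩)) : Continuous f := by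
  have h1 : Continuous fun x : T × ((i : ι) × Y i) => f (x.1, Sum.inr x.2) := by
    have h2 : Continuous fun x : (i : ι) × (Y i × T) => f (x.2.2, Sum.inr ⟨x.1, x.2.1⟩) :=
      continuous_sigma fun i => (h' i).comp (continuous_snd.prodMk continuous_fst)
    exact h2.comp (Homeomorph.sigmaProdDistrib.continuous.comp continuous_swap)
  have h3 : Continuous fun x : T × X ⊕ T × ((i : ι) × Y i) =>
      f (Homeomorph.prodSumDistrib.symm x) := continuous_sum_dom.2 ⟨h, h1⟩
  refine (h3.comp (Homeomorph.prodSumDistrib (X := T) (Y := X)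
    (Z := (i : ι) × Y i)).continuous).congr fun x => ?_
  exact congrArg f (Homeomorph.symm_apply_apply _ x)

/-! ### Families of maps with a common restriction to the frontier. -/

section Glued

variable {K : Type} [TopologicalSpace K]

/-- Finitely many copies of `K` with frontier identified, before the identification. -/
abbrev Copies {Γ : Type u} (G : Gauge K) (s : Finset Γ) : Type u :=
  G.Frontier ⊕ (_ : s) × K

/-- The relation identifying the frontiers of the copies of `K`. -/
def Copies.rel {Γ : Type u} (G : Gauge K) (s : Finset Γ) : Set (Copies G s × Copies G s) :=
  {a | ∃ (γ : s) (l : G.Frontier), a = (Sum.inl l, Sum.inr ⟨γ, l.1⟩)}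

theorem Copies.eq_of_mem_rel {Γ : Type u} {G : Gauge K} {s : Finset Γ} {P : Type*}
    {w : Copies G s → P} (h : ∀ (γ : s) (l : G.Frontier), w (Sum.inl l) = w (Sum.inr ⟨γ, l.1⟩))
    (a : Copies G s × Copies G s) (ha : a ∈ Copies.rel G s) : w a.1 = w a.2 := by
  obtain ⟨γ, l, rfl⟩ := ha
  exact h γ l

/-- The inclusion of copies. -/
def Copies.incl {Γ : Type u} (G : Gauge K) {s s' : Finset Γ} (h : s ⊆ s') :
    C(Copies G s, Copies G s') where
  toFun := Sum.map id fun x => ⟨⟨x.1.1, h x.1.2⟩, x.2⟩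
  continuous_toFun := continuous_id.sumMap (continuous_sigma fun γ =>
    continuous_sigmaMk (σ := fun _ : s' => K) (i := ⟨γ.1, h γ.2⟩))

/-- Restriction of families of maps to a smaller set of copies. -/
def gluedRestrict {Γ : Type u} (G : Gauge K) (P : Type u) [TopologicalSpace P] {s s' : Finset Γ}
    (h : s ⊆ s') :
    C(EqMaps (Copies G s') (Copies.rel G s') P, EqMaps (Copies G s) (Copies.rel G s) P) where
  toFun w := ⟨w.1.comp (Copies.incl G h),
    Copies.eq_of_mem_rel fun γ l => w.2 _ ⟨⟨γ.1, h γ.2⟩, l, rfl⟩⟩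
  continuous_toFun := ((ContinuousMap.continuous_precomp _).comp continuous_subtype_val).subtype_mk _

/-- The system of families of maps `K → P` with a common restriction to the frontier, over the
finite subsets of an index set. -/
abbrev InvSystem.gluedMaps (Γ : Type u) (G : Gauge K) (P : Type u) [TopologicalSpace P] :
    InvSystem.{u} where
  Idx := Finset Γ
  nonempty := ⟨∅⟩
  directed s s' := by
    classical exact ⟨s ∪ s', Finset.subset_union_left, Finset.subset_union_right⟩
  cofinite s := s.powerset.finite_toSet.subset fun _ h => Finset.mem_coe.2 (Finset.mem_powerset.2 h)
  obj s := EqMaps (Copies G s) (Copies.rel G s) P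
  map h := gluedRestrict G P h
  map_id _ w := Subtype.ext (ContinuousMap.ext fun x => by rcases x with x | x <;> rfl)
  map_comp _ _ w := Subtype.ext (ContinuousMap.ext fun x => by rcases x with x | x <;> rfl)

theorem InvSystem.gluedMaps_inHPol [CompactSpace K] [T2Space K] (Γ : Type u) (G : Gauge K)
    {P : Type u} [TopologicalSpace P] (hP : IsHPol P) : (InvSystem.gluedMaps Γ G P).InHPol := by
  intro s
  have : CompactSpace G.Frontier :=
    isCompact_iff_compactSpace.1 (isClosed_eq G.continuous_g continuous_const).isCompact
  exact isHPol_eqMaps _ hP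

/-- Maps into a term of the system of glued maps. -/
def gluedLift {Γ : Type u} {G : Gauge K} {s : Finset Γ} {T P : Type u} [TopologicalSpace T]
    [TopologicalSpace P] (f : C(T × G.Frontier, P)) (g : s → C(T × K, P))
    (h : ∀ γ a (l : G.Frontier), g γ (a, l.1) = f (a, l)) :
    C(T, (InvSystem.gluedMaps Γ G P).obj s) :=
  let F : C(T × Copies G s, P) := ⟨fun x => Sum.elim (fun l => f (x.1, l))
    (fun y => g y.1 (x.1, y.2)) x.2, by
      refine continuous_prod_sum_sigma f.continuous fun γ => ?_
      exact (g γ).continuous⟩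
  ⟨fun a => ⟨F.curry a, Copies.eq_of_mem_rel fun γ l => (h γ a l).symm⟩,
    F.curry.continuous.subtype_mk _⟩

/-- Evaluation in a family of maps. -/
def EqMaps.eval {Q : Type u} [TopologicalSpace Q] [LocallyCompactSpace Q] {E : Set (Q × Q)}
    {P : Type u} [TopologicalSpace P] : C(EqMaps Q E P × Q, P) :=
  ⟨fun x => x.1.1 x.2, by fun_prop⟩

end Glued

/-! ### Dragging maps along homotopies on the frontier. -/

namespace Gauge

variable {K A B P : Type*} [TopologicalSpace K] [TopologicalSpace A] [TopologicalSpace B]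
  [TopologicalSpace P]

theorem homotopy_extension_one (G : Gauge K) (h : C(A × K, P))
    (b : C((A × G.Frontier) × unitInterval, P)) (h1 : ∀ a l, b ((a, l), 1) = h (a, l.1)) :
    ∃ H : C((A × K) × unitInterval, P), (∀ a x, H ((a, x), 1) = h (a, x)) ∧
      ∀ a l s, H ((a, l.1), s) = b ((a, l), s) := by
  obtain ⟨H, h2, h3⟩ := G.homotopy_extension h
    (b.comp ⟨fun w => (w.1, unitInterval.symm w.2), by fun_prop⟩) fun a l => by
      refine Eq.trans ?_ (h1 a l)
      exact congrArg (fun s => b ((a, l), s)) unitInterval.symm_zero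
  refine ⟨H.comp ⟨fun w => (w.1, unitInterval.symm w.2), by fun_prop⟩, fun a x => ?_,
    fun a l s => ?_⟩
  · refine Eq.trans ?_ (h2 a x)
    exact congrArg (fun s => H ((a, x), s)) unitInterval.symm_one
  · refine (h3 a l (unitInterval.symm s)).trans ?_
    exact congrArg (fun s => b ((a, l), s)) (unitInterval.symm_symm s)

/-- The diagram chase behind the extension property. -/
theorem exists_extension_of_square (G : Gauge K) (π : C(A, B))
    (W : C((A × G.Frontier) × unitInterval, P)) (J U : C((B × G.Frontier) × unitInterval, P))
    (v : C(B × K, P)) (hv : ∀ b l, U ((b, l), 0) = v (b, l.1))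
    (hUJ : ∀ b l, J ((b, l), 0) = U ((b, l), 1)) :
    ∃ f : C(B × K, P), (∀ b l, f (b, l.1) = J ((b, l), 1)) ∧
      ∀ (g γ : C(A × K, P)) (R₁ R₂ V : C((A × K) × unitInterval, P))
        (sq : C((A × G.Frontier) × (unitInterval × unitInterval), P)),
        (∀ a l s, R₁ ((a, l.1), s) = J ((π a, l), s)) → (∀ a x, R₁ ((a, x), 1) = g (a, x)) →
        (∀ a l s, R₂ ((a, l.1), s) = W ((a, l), s)) → (∀ a x, R₂ ((a, x), 0) = γ (a, x)) →
        (∀ a x, R₂ ((a, x), 1) = R₁ ((a, x), 0)) →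
        (∀ a x, V ((a, x), 0) = γ (a, x)) → (∀ a x, V ((a, x), 1) = v (π a, x)) →
        (∀ a l t, sq ((a, l), (0, t)) = V ((a, l.1), t)) →
        (∀ a l s, sq ((a, l), (s, 0)) = γ (a, l.1)) →
        (∀ a l s, sq ((a, l), (s, 1)) = U ((π a, l), s)) →
        (∀ a l t, sq ((a, l), (1, t)) = W ((a, l), t)) →
        ∃ E : C((A × K) × unitInterval, P), (∀ a x, E ((a, x), 0) = g (a, x)) ∧
          (∀ a x, E ((a, x), 1) = f (π a, x)) ∧ ∀ a (l : G.Frontier) t, E ((a, l.1), t) = g (a, l.1) := by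
  -- The map f is v dragged first along U and then along J. It is found before g, γ and the
  -- homotopies over A are given.
  obtain ⟨RU, hRU0, hRUL⟩ := G.homotopy_extension v U hv
  obtain ⟨R₃, hR₃0, hR₃L⟩ := G.homotopy_extension
    (RU.comp ⟨fun x => (x, 1), by fun_prop⟩) J fun b l => (hUJ b l).trans (hRUL b l 1).symm
  refine ⟨R₃.comp ⟨fun x => (x, 1), by fun_prop⟩, fun b l => hR₃L b l 1, ?_⟩
  intro g γ R₁ R₂ V sq h1 h2 h3 h4 h5 h6 h7 s1 s2 s3 s4
  let pm : C((A × K) × unitInterval, (B × K) × unitInterval) :=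
    ⟨fun w => ((π w.1.1, w.1.2), w.2), by fun_prop⟩
  -- E₁ joins γ to the end of RU and lies over W on the frontier. Comparing it with R₂, which lies
  -- over the same W, gives E₂ from the end of R₂ to the end of RU, constant on the frontier;
  -- transporting E₂ along J gives E₃ from g to f, again constant there.
  obtain ⟨E₁, e1, e2, e3⟩ := G.exists_fourth_side sq V (γ.comp ContinuousMap.fst) (RU.comp pm)
    (fun a l t => (s1 a l t).symm) (fun a l s => (s2 a l s).symm)
    (fun a l s => (hRUL _ l s).trans (s3 a l s).symm) (fun a x => (h6 a x).symm)
    (fun a x => (hRU0 _ x).trans (h7 a x).symm)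
  obtain ⟨E₂, e4, e5, e6⟩ := G.exists_fourth_side
    (W.comp ⟨fun w => (w.1, w.2.1), by fun_prop⟩) (γ.comp ContinuousMap.fst) R₂ E₁
    (fun a (l : G.Frontier) t => (h4 a l.1).symm.trans (h3 a l 0)) (fun a l s => h3 a l s)
    (fun a l s => (e1 a l s).trans (s4 a l s)) h4 e2
  obtain ⟨E₃, e7, e8, e9⟩ := G.exists_fourth_side
    (J.comp ⟨fun w => ((π w.1.1, w.1.2), w.2.1), by fun_prop⟩) E₂ R₁ (R₃.comp pm)
    (fun a (l : G.Frontier) t => (e4 a l t).trans ((h3 a l 1).symm.trans ((h5 a l.1).trans (h1 a l 0))))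
    (fun a l s => h1 a l s) (fun a l s => hR₃L _ l s)
    (fun a x => ((e5 a x).trans (h5 a x)).symm)
    (fun a x => (hR₃0 _ x).trans ((e6 a x).trans (e3 a x)).symm)
  refine ⟨E₃, fun a x => (e8 a x).trans (h2 a x), fun a x => e9 a x, fun a l t => ?_⟩
  exact (e7 a l t).trans ((h1 a l 1).symm.trans (h2 a l.1))

end Gauge

/-! ### Strong expansions have the extension property. -/

namespace CoarseMorphism

variable {A : Type u} [TopologicalSpace A] {S : InvSystem.{u}}

/-- Over a gauged compact space, maps that factor through the system over the frontier factor
through the system up to a homotopy relative to the frontier. -/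
def ExtensionProperty (p : CoarseMorphism A S) : Prop :=
  ∀ (K : Type) [TopologicalSpace K] [CompactSpace K] [T2Space K] (G : Gauge K)
    (P : Type u) [TopologicalSpace P], IsHPol P → ∀ (i : S.Idx) (g : ℕ → C(A × K, P))
    (f : ℕ → C(S.obj i × G.Frontier, P)),
    (∀ᶠ n in atTop, ∀ a (l : G.Frontier), g n (a, l.1) = f n (p.maps n i a, l)) →
    ∃ (j : S.Idx) (h : i ≤ j) (f' : ℕ → C(S.obj j × K, P)), ∀ᶠ n in atTop,
      (∀ x (l : G.Frontier), f' n (x, l.1) = f n (S.map h x, l)) ∧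
      ∃ E : C((A × K) × unitInterval, P), (∀ a x, E ((a, x), 0) = g n (a, x)) ∧
        (∀ a x, E ((a, x), 1) = f' n (p.maps n j a, x)) ∧
        ∀ a (l : G.Frontier) t, E ((a, l.1), t) = g n (a, l.1)

/-- Existence and uniqueness control the frontier values only up to a loop of homotopies. Since that
loop is determined by the term at ∅ of the system of families, it is available before a member of
the index set is selected, and g transported backwards around it is a member whose factorization
yields that of g. -/
theorem IsStrongExpansion.extensionProperty {p : CoarseMorphism A S} (hp : p.IsStrongExpansion) :
    p.ExtensionProperty := by
  intro K _ _ _ G P _ hP i g f hgf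
  have : CompactSpace G.Frontier :=
    isCompact_iff_compactSpace.1 (isClosed_eq G.continuous_g continuous_const).isCompact
  -- All sequences with the prescribed frontier values are admitted as indices, because the one
  -- needed later depends on homotopies produced by the whole system.
  let Γ : Type u := {γ : ℕ → C(A × K, P) //
    ∀ᶠ n in atTop, ∀ a (l : G.Frontier), γ n (a, l.1) = f n (p.maps n i a, l)}
  let Z : InvSystem.{u} := InvSystem.gluedMaps Γ G P
  have hZ : Z.InHPol := InvSystem.gluedMaps_inHPol Γ G hP
  -- the morphism from `A` to the system of glued maps
  let Good : ℕ → Finset Γ → Prop := fun n s =>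
    ∀ γ : s, ∀ a (l : G.Frontier), γ.1.1 n (a, l.1) = f n (p.maps n i a, l)
  have hGood : ∀ s, ∀ᶠ n in atTop, Good n s := fun s => eventually_all.2 fun γ => γ.1.2
  have hr : ∀ n (s : Finset Γ), ∃ r : C(A, Z.obj s), Good n s →
      (∀ a l, (r a).1 (Sum.inl l) = f n (p.maps n i a, l)) ∧
      ∀ a (γ : s) x, (r a).1 (Sum.inr ⟨γ, x⟩) = γ.1.1 n (a, x) := by
    intro n s
    by_cases hs : Good n s
    · exact ⟨gluedLift (Γ := Γ) (G := G) (s := s)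
        ((f n).comp ((p.maps n i).prodMap (ContinuousMap.id _))) (fun γ => γ.1.1 n) hs,
        fun _ => ⟨fun a l => rfl, fun a γ x => rfl⟩⟩
    -- For the finitely many other n any map into the term will do; the constant family g n always
    -- qualifies.
    · exact ⟨gluedLift (Γ := Γ) (G := G) (s := s)
        ((g n).comp ((ContinuousMap.id _).prodMap ⟨_, continuous_subtype_val⟩)) (fun γ => g n)
        fun _ _ _ => rfl, fun h => absurd h hs⟩
  choose r hr using hr
  let R : CoarseMorphism A Z := ⟨r, fun {s s'} h => by
    filter_upwards [hGood s, hGood s'] with n h1 h2 a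
    refine Subtype.ext (ContinuousMap.ext fun x => ?_)
    rcases x with l | ⟨γ, x⟩
    · exact ((hr n s' h2).1 a l).trans ((hr n s h1).1 a l).symm
    · exact ((hr n s' h2).2 a ⟨γ.1, h γ.2⟩ x).trans ((hr n s h1).2 a γ x).symm⟩
  obtain ⟨u, hu, -⟩ := hp.2 Z hZ R.toCoherent
  obtain ⟨W, _, _, hW⟩ := (p.factors_iff _ _).1 hu
  let pt : Simplex 0 := stdSimplex.vertex 0
  let c : MultiIndex (Finset Γ) 0 := OrderHom.const _ ∅
  let k : ℕ → C(S.obj (u.idx ∅), Z.obj ∅) := fun n => (u.maps n c).comp ⟨fun x => (x, pt), by fun_prop⟩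
  let k' : ℕ → C(S.obj i, Z.obj ∅) := fun n => gluedLift (Γ := Γ) (G := G) (s := ∅) (f n)
    (fun γ => absurd γ.2 (Finset.notMem_empty _)) fun γ => absurd γ.2 (Finset.notMem_empty _)
  let ω : ℕ → C(A × unitInterval, Z.obj ∅) := fun n =>
    (W.maps n c).comp ⟨fun x => (x, pt), by fun_prop⟩
  have hω : ∀ᶠ n in atTop, ∀ a, ω n (a, 0) = k' n (p.maps n i a) ∧
      ω n (a, 1) = k n (p.maps n (u.idx ∅) a) := by
    filter_upwards [hW c, hGood ∅] with n h1 h2 a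
    refine ⟨(h1 a pt).1.trans (Subtype.ext (ContinuousMap.ext fun x => ?_)), (h1 a pt).2⟩
    rcases x with l | ⟨γ, x⟩
    · exact (hr n ∅ h2).1 a l
    · exact absurd γ.2 (Finset.notMem_empty _)
  -- Over A, ω leads from the frontier values f to the component k of u at ∅; uniqueness gives J
  -- over S_j leading from k back to f. Nothing relates J to ω, so together they form a loop that
  -- may be essential.
  obtain ⟨j, hij, huj, J, hJ⟩ := hp.exists_homotopy (hZ ∅) k' k ω hω
  -- the choice of an element of the index set
  let WL : ℕ → C((A × G.Frontier) × unitInterval, P) := fun n => EqMaps.eval.comp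
    ⟨fun x => (ω n (x.1.1, x.2), Sum.inl x.1.2), by fun_prop⟩
  let JL : ℕ → C((S.obj j × G.Frontier) × unitInterval, P) := fun n => EqMaps.eval.comp
    ⟨fun x => (J n (x.1.1, x.2), Sum.inl x.1.2), by fun_prop⟩
  have hγ : ∀ᶠ n in atTop, ∃ γ : C(A × K, P),
      (∀ a (l : G.Frontier), γ (a, l.1) = f n (p.maps n i a, l)) ∧
      ∃ R₁ R₂ : C((A × K) × unitInterval, P),
        (∀ a (l : G.Frontier) s, R₁ ((a, l.1), s) = JL n ((p.maps n j a, l), s)) ∧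
        (∀ a x, R₁ ((a, x), 1) = g n (a, x)) ∧
        (∀ a (l : G.Frontier) s, R₂ ((a, l.1), s) = WL n ((a, l), s)) ∧
        (∀ a x, R₂ ((a, x), 0) = γ (a, x)) ∧ (∀ a x, R₂ ((a, x), 1) = R₁ ((a, x), 0)) := by
    -- R₁ drags g backwards along J, and R₂ drags the result backwards along ω. The map γ reached
    -- has frontier values f again, so the sequence of these maps belongs to Γ.
    filter_upwards [hgf, hω, hJ, p.comm hij, p.comm huj] with n h1 h2 h3 h4 h5
    obtain ⟨R₁, hR₁, hR₁L⟩ := G.homotopy_extension_one (g n)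
      ((JL n).comp ⟨fun x => ((p.maps n j x.1.1, x.1.2), x.2), by fun_prop⟩) fun a l => by
        refine Eq.trans ?_ (h1 a l).symm
        refine (congrArg (fun w => w.1 (Sum.inl l)) (h3 (p.maps n j a)).2).trans ?_
        exact congrArg (fun x => f n (x, l)) (h4 a)
    obtain ⟨R₂, hR₂, hR₂L⟩ := G.homotopy_extension_one
      (R₁.comp ⟨fun x => (x, 0), by fun_prop⟩) (WL n) fun a l => by
        refine Eq.trans ?_ (hR₁L a l 0).symm
        refine (congrArg (fun w => w.1 (Sum.inl l)) (h2 a).2).trans ?_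
        refine Eq.trans ?_ (congrArg (fun w => w.1 (Sum.inl l)) (h3 (p.maps n j a)).1).symm
        exact congrArg (fun x => (k n x).1 (Sum.inl l)) (h5 a).symm
    refine ⟨R₂.comp ⟨fun x => (x, 0), by fun_prop⟩, fun a l => (hR₂L a l 0).trans ?_, R₁, R₂, hR₁L,
      hR₁, hR₂L, fun _ _ => rfl, hR₂⟩
    exact congrArg (fun w => w.1 (Sum.inl l)) (h2 a).1
  have : Nonempty C(A × K, P) := ⟨g 0⟩
  obtain ⟨γ₀, hγ₀⟩ := exists_of_eventually_exists hγ
  let γ : Γ := ⟨γ₀, hγ₀.mono fun n h => h.1⟩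
  -- On the edge ∅ ≤ {γ} the maps of u give U, leading from the frontier values of the component v
  -- at {γ} to k, where J starts. Accordingly σ runs from vertex 1 to vertex 0.
  let ν : MultiIndex (Finset Γ) 1 := ⟨![∅, {γ}], Fin.monotone_iff_le_succ.2 fun x => by
    rw [Subsingleton.elim x 0]
    exact Finset.empty_subset _⟩
  let c' : MultiIndex (Finset Γ) 0 := OrderHom.const _ {γ}
  let θ₀ : Fin 1 →o Fin 2 := OrderHom.const _ 0
  let θ₁ : Fin 1 →o Fin 2 := OrderHom.const _ 1
  let σ : C(unitInterval, Simplex 1) :=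
    ⟨fun s => simplexSegment s (stdSimplex.map θ₁ pt) (stdSimplex.map θ₀ pt),
      continuous_simplexSegment continuous_id continuous_const continuous_const⟩
  have σ0 : σ 0 = stdSimplex.map θ₁ pt := simplexSegment_zero _ _
  have σ1 : σ 1 = stdSimplex.map θ₀ pt := simplexSegment_one _ _
  have hγmem : γ ∈ ({γ} : Finset Γ) := Finset.mem_singleton_self γ
  let κ : K → Copies G ({γ} : Finset Γ) := fun x => Sum.inr ⟨⟨γ, hγmem⟩, x⟩
  have hκ : Continuous κ := continuous_inr.comp
    (continuous_sigmaMk (σ := fun _ : ({γ} : Finset Γ) => K) (i := ⟨γ, hγmem⟩))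
  obtain ⟨j', hj, hj'⟩ := S.directed j (u.idx {γ})
  let uγ : ∀ n, C(S.obj (u.idx {γ}) × Simplex 0, Z.obj {γ}) := fun n => u.maps n c'
  let uν : ∀ n, C(S.obj (u.idx {γ}) × Simplex 1, Z.obj ∅) := fun n => u.maps n ν
  let Wγ : ∀ n, C((A × unitInterval) × Simplex 0, Z.obj {γ}) := fun n => W.maps n c'
  let Wν : ∀ n, C((A × unitInterval) × Simplex 1, Z.obj ∅) := fun n => W.maps n ν
  let v : ℕ → C(S.obj j' × K, P) := fun n => EqMaps.eval.comp
    ⟨fun x => (uγ n (S.map hj' x.1, pt), κ x.2), by fun_prop⟩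
  let U : ℕ → C((S.obj j' × G.Frontier) × unitInterval, P) := fun n => EqMaps.eval.comp
    ⟨fun x => (uν n (S.map hj' x.1.1, σ x.2), Sum.inl x.1.2), by fun_prop⟩
  have : Nonempty C(S.obj j' × K, P) := ⟨v 0⟩
  choose! f' hf'' using fun n => G.exists_extension_of_square (p.maps n j') (WL n)
      ((JL n).comp ⟨fun x => ((S.map hj x.1.1, x.1.2), x.2), by fun_prop⟩) (U n) (v n)
  have hf' : ∀ᶠ n in atTop, (∀ x l, U n ((x, l), 0) = v n (x, l.1)) ∧
      ∀ x l, JL n ((S.map hj x, l), 0) = U n ((x, l), 1) := by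
    filter_upwards [u.cohAt ν θ₀, u.cohAt ν θ₁, hJ] with n h1 h2 h3
    refine ⟨?_, ?_⟩
    · intro x l
      refine (congrArg (fun t => (uν n (S.map hj' x, t)).1 (Sum.inl l)) σ0).trans ?_
      refine (congrArg (fun w => w.1 (Sum.inl l)) (h2 (S.map hj' x) pt)).trans ?_
      refine Eq.trans ?_ ((uγ n (S.map hj' x, pt)).2 _ ⟨⟨γ, hγmem⟩, l, rfl⟩)
      exact congrArg (fun y => (uγ n (y, pt)).1 (Sum.inl l)) (S.map_id _ _)
    · intro x l
      refine (congrArg (fun w => w.1 (Sum.inl l)) (h3 (S.map hj x)).1).trans (Eq.symm ?_)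
      refine (congrArg (fun t => (uν n (S.map hj' x, t)).1 (Sum.inl l)) σ1).trans ?_
      refine (congrArg (fun w => w.1 (Sum.inl l)) (h1 (S.map hj' x) pt)).trans ?_
      exact congrArg (fun y => (k n y).1 (Sum.inl l))
        ((S.map_comp _ _ _).trans (S.map_comp _ _ _).symm)

  refine ⟨j', hij.trans hj, f', ?_⟩
  filter_upwards [hf', hγ₀, hJ, p.comm hj, p.comm hj', hGood {γ}, hGood ∅, hW c', hW ν,
    W.cohAt ν θ₀, W.cohAt ν θ₁] with n h1 h2 h3 h4 h5 g1 g2 w1 w2 w3 w4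
  replace h1 := hf'' n h1.1 h1.2
  obtain ⟨h2, R₁, R₂, hR₁L, hR₁, hR₂L, hR₂, hR₁₂⟩ := h2
  refine ⟨fun x l => (h1.1 x l).trans ?_, ?_⟩
  · refine (congrArg (fun w => w.1 (Sum.inl l)) (h3 (S.map hj x)).2).trans ?_
    exact congrArg (fun y => f n (y, l)) (S.map_comp _ _ _)
  -- The homotopy V from γ to v is the component of W at {γ}; the square on the frontier is the
  -- component of W on the edge.
  · refine h1.2 (g n) (γ₀ n) R₁ R₂
      (EqMaps.eval.comp ⟨fun x => (Wγ n ((x.1.1, x.2), pt), κ x.1.2), by fun_prop⟩)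
      (EqMaps.eval.comp ⟨fun x => (Wν n ((x.1.1, x.2.2), σ x.2.1), Sum.inl x.1.2), by fun_prop⟩)
      ?_ hR₁ hR₂L hR₂ hR₁₂ ?_ ?_ ?_ ?_ ?_ ?_
    · intro a l s
      exact (hR₁L a l s).trans (congrArg (fun x => JL n ((x, l), s)) (h4 a).symm)
    · intro a x
      refine (congrArg (fun w => w.1 (κ x)) (w1 a pt).1).trans ?_
      exact (hr n {γ} g1).2 a ⟨γ, hγmem⟩ x
    · intro a x
      refine (congrArg (fun w => w.1 (κ x)) (w1 a pt).2).trans ?_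
      exact congrArg (fun y => (uγ n (y, pt)).1 (κ x)) (h5 a).symm
    · intro a l t
      refine (congrArg (fun s => (Wν n ((a, t), s)).1 (Sum.inl l)) σ0).trans ?_
      refine (congrArg (fun w => w.1 (Sum.inl l)) (w4 (a, t) pt)).trans ?_
      exact (Wγ n ((a, t), pt)).2 _ ⟨⟨γ, hγmem⟩, l, rfl⟩
    · intro a l s
      refine (congrArg (fun w => w.1 (Sum.inl l)) (w2 a (σ s)).1).trans ?_
      exact ((hr n ∅ g2).1 a l).trans (h2 a l).symm
    · intro a l s
      refine (congrArg (fun w => w.1 (Sum.inl l)) (w2 a (σ s)).2).trans ?_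
      exact congrArg (fun y => (uν n (y, σ s)).1 (Sum.inl l)) (h5 a).symm
    · intro a l t
      refine (congrArg (fun s => (Wν n ((a, t), s)).1 (Sum.inl l)) σ1).trans ?_
      exact congrArg (fun w => w.1 (Sum.inl l)) (w3 (a, t) pt)

end CoarseMorphism

theorem exists_concat {A B : Type*} [TopologicalSpace A] [TopologicalSpace B]
    (a b : C(A × unitInterval, B)) (h : ∀ x, a (x, 1) = b (x, 0)) :
    ∃ c : C(A × unitInterval, B), (∀ x, c (x, 0) = a (x, 0)) ∧ (∀ x, c (x, 1) = b (x, 1)) ∧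
      ∀ x y, (∀ s, a (x, s) = y) → (∀ s, b (x, s) = y) → ∀ s, c (x, s) = y := by
  let a' : C((A × unitInterval) × Unit, B) := a.comp ContinuousMap.fst
  let b' : C((A × unitInterval) × Unit, B) := b.comp ContinuousMap.fst
  have h' : ∀ x t, a' ((x, 1), t) = b' ((x, 0), t) := fun x _ => h x
  refine ⟨(concat a' b').comp ⟨fun x => (x, ()), by fun_prop⟩, fun x => ?_, fun x => ?_,
    fun x y ha hb s => ?_⟩
  · refine (concat_of_le h' x 0 () (by norm_num)).trans ?_
    exact congrArg (fun s => a (x, s)) (by simp)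
  · refine (concat_of_gt h' x 1 () (by norm_num)).trans ?_
    refine congrArg (fun s => b (x, s)) ?_
    have : (2 * ((1 : unitInterval) : ℝ) - 1) = 1 := by norm_num
    rw [this]
    simp
  · by_cases hs : (s : ℝ) ≤ 1 / 2
    · exact (concat_of_le h' x s () hs).trans (ha _)
    · exact (concat_of_gt h' x s () hs).trans (hb _)

/-! ### The extension property of products -/

namespace CoarseMorphism

variable {X Y : Type u} [TopologicalSpace X] [TopologicalSpace Y] {S T : InvSystem.{u}}

/-- The first extension ends at a single index k of T, so the second takes place over the one space
`T.obj k`. Its prescribed frontier values are those kept by the first extension, and the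
concatenated homotopy remains constant on the frontier. -/
theorem ExtensionProperty.prod {p : CoarseMorphism X S} {q : CoarseMorphism Y T}
    (hq : (oneProd X q).ExtensionProperty)
    (hp : ∀ μ : T.Idx, (p.prodOne (T.obj μ)).ExtensionProperty) :
    (p.prod q).ExtensionProperty := by
  intro K _ _ _ G P _ hP i g f hgf
  obtain ⟨k, hk, g', hg'⟩ := hq K G P hP i.2 g
    (fun n => (f n).comp (((p.maps n i.1).prodMap (ContinuousMap.id _)).prodMap
      (ContinuousMap.id _))) (hgf.mono fun n h a l => h a l)
  obtain ⟨j, hj, f', hf'⟩ := hp k K G P hP i.1 g'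
    (fun n => (f n).comp (((ContinuousMap.id _).prodMap (T.map hk)).prodMap (ContinuousMap.id _)))
    (hg'.mono fun n h a l => h.1 a l)
  refine ⟨(j, k), ⟨hj, hk⟩, f', ?_⟩
  filter_upwards [hg', hf'] with n h1 h2
  obtain ⟨-, E₁, a0, a1, aL⟩ := h1
  obtain ⟨hL, E₂, b0, b1, bL⟩ := h2
  refine ⟨fun x l => hL x l, ?_⟩
  obtain ⟨E, e0, e1, eL⟩ := exists_concat E₁
    (E₂.comp ⟨fun x => (((x.1.1.1, q.maps n k x.1.1.2), x.1.2), x.2), by fun_prop⟩)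
    fun x => (a1 x.1 x.2).trans (b0 (x.1.1, q.maps n k x.1.2) x.2).symm
  refine ⟨E, fun a x => (e0 _).trans (a0 a x), fun a x => (e1 _).trans (b1 (a.1, q.maps n k a.2) x),
    fun a l t => eL _ _ (aL a l) (fun s => ?_) t⟩
  exact (bL (a.1, q.maps n k a.2) l s).trans
    ((a1 a l.1).symm.trans (aL a l 1))

end CoarseMorphism

/-! ### Boundaries of simplices -/

/-- A map from a compact space to a Hausdorff space is proper, and properness survives the product
with the arbitrary space T; hence T × C → T × W is closed and a quotient map. -/
theorem exists_descend {T C W P : Type*} [TopologicalSpace T] [TopologicalSpace C]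
    [TopologicalSpace W] [TopologicalSpace P] [CompactSpace C] [T2Space W] (φ : C(C, W))
    (hφ : Function.Surjective φ) (f : C(T × C, P))
    (hf : ∀ x c c', φ c = φ c' → f (x, c) = f (x, c')) :
    ∃ g : C(T × W, P), ∀ x c, g (x, φ c) = f (x, c) := by
  let Φ : C(T × C, T × W) := (ContinuousMap.id T).prodMap φ
  have hΦ' : IsProperMap Φ := isProperMap_id.prodMap φ.continuous.isProperMap
  have hΦ : Topology.IsQuotientMap Φ := hΦ'.isClosedMap.isQuotientMap Φ.continuous
    (Function.surjective_id.prodMap hφ)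
  have hf' : Function.FactorsThrough f Φ := by
    rintro ⟨x, c⟩ ⟨x', c'⟩ h
    obtain rfl : x = x' := congrArg Prod.fst h
    exact hf x c c' (congrArg Prod.snd h)
  exact ⟨hΦ.lift f hf', fun x c =>
    congrArg (fun g : C(T × C, P) => g (x, c)) (hΦ.lift_comp f hf')⟩

theorem exists_simplex_support {m : ℕ} (t : Simplex m) :
    ∃ (k : ℕ) (φ : Fin (k + 1) ↪o Fin (m + 1)) (t' : Simplex k),
      stdSimplex.map φ t' = t ∧ ∀ l, t.1 (φ l) ≠ 0 := by
  classical
  let s : Finset (Fin (m + 1)) := Finset.univ.filter fun l => t.1 l ≠ 0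
  have hs : s.Nonempty := by
    by_contra h
    rw [Finset.not_nonempty_iff_eq_empty] at h
    have h1 : ∑ l, t.1 l = 1 := t.2.2
    rw [Finset.sum_eq_zero fun l _ => by
      by_contra h'
      have : l ∈ s := Finset.mem_filter.2 ⟨Finset.mem_univ _, h'⟩
      rw [h] at this
      exact Finset.notMem_empty _ this] at h1
    exact zero_ne_one h1
  obtain ⟨k, hk⟩ := Nat.exists_eq_succ_of_ne_zero (Finset.card_pos.2 hs).ne'
  let φ : Fin (k + 1) ↪o Fin (m + 1) := s.orderEmbOfFin hk
  have hφ : ∀ l, t.1 l ≠ 0 ↔ ∃ x, φ x = l := fun l => by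
    have h : Set.range φ = s := Finset.range_orderEmbOfFin s hk
    rw [← Set.mem_range, h]
    simp [s]
  have hsum : ∑ x, t.1 (φ x) = 1 := by
    refine Eq.trans ?_ t.2.2
    refine Finset.sum_of_injOn φ φ.injective.injOn (fun _ _ => Finset.mem_coe.2 (Finset.mem_univ _)) ?_ fun _ _ => rfl
    intro l _ hl
    by_contra h
    obtain ⟨x, hx⟩ := (hφ l).1 h
    exact hl ⟨x, Finset.mem_coe.2 (Finset.mem_univ _), hx⟩
  refine ⟨k, φ, ⟨fun x => t.1 (φ x), fun x => t.2.1 _, hsum⟩, Subtype.ext (funext fun l => ?_),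
    fun l => (hφ _).2 ⟨l, rfl⟩⟩
  refine (simplex_map_val φ.toOrderHom _ l).trans ?_
  by_cases h : t.1 l = 0
  · rw [h]
    refine Finset.sum_eq_zero fun x _ => ?_
    split_ifs with h'
    · exact (congrArg t.1 h').trans h
    · rfl
  · obtain ⟨x, rfl⟩ := (hφ l).1 h
    rw [Finset.sum_eq_single x]
    · exact if_pos rfl
    · exact fun y _ hy => if_neg fun h => hy (φ.injective h)
    · exact fun h => absurd (Finset.mem_univ _) h

theorem exists_of_simplex_map_ne_zero {k m : ℕ} (θ : Fin (k + 1) →o Fin (m + 1)) (t : Simplex k)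
    (l : Fin (m + 1)) (h : (stdSimplex.map θ t).1 l ≠ 0) : ∃ x, θ x = l := by
  by_contra! h'
  refine h ((simplex_map_val θ t l).trans (Finset.sum_eq_zero fun x _ => if_neg (h' x)))

theorem simplex_map_injective {k m : ℕ} (θ : Fin (k + 1) ↪o Fin (m + 1)) :
    Function.Injective (stdSimplex.map (S := ℝ) θ) := by
  intro s t h
  refine Subtype.ext (funext fun x => ?_)
  have key : ∀ r : Simplex k, (stdSimplex.map θ r).1 (θ x) = r.1 x := fun r => by
    refine (simplex_map_val θ.toOrderHom r (θ x)).trans ?_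
    rw [Finset.sum_eq_single x]
    · exact if_pos rfl
    · exact fun y _ hy => if_neg fun h => hy (θ.injective h)
    · exact fun h => absurd (Finset.mem_univ _) h
  rw [← key, h, key]

theorem exists_orderHom_lift {α : Type*} [Preorder α] {k m : ℕ} (e : Fin (m + 1) ↪o α)
    (φ : Fin (k + 1) →o α) (h : ∀ l, ∃ x, e x = φ l) :
    ∃ ψ : Fin (k + 1) →o Fin (m + 1), ∀ l, e (ψ l) = φ l := by
  choose ψ hψ using h
  refine ⟨⟨ψ, fun a b hab => e.le_iff_le.1 ?_⟩, hψ⟩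
  rw [hψ, hψ]
  exact φ.monotone hab

theorem simplex_scale_mem {m : ℕ} (t : Simplex m) {r : ℝ}
    (h : ∀ l, 1 - (m + 1) * t.1 l ≤ r) (hr : 0 < r) :
    (fun l => (1 - (1 - (m + 1) * t.1 l) / r) / (m + 1)) ∈ stdSimplex ℝ (Fin (m + 1)) := by
  constructor
  · intro l
    have : (1 - (m + 1) * t.1 l) / r ≤ 1 := (div_le_one hr).2 (h l)
    exact div_nonneg (sub_nonneg.2 this) (by positivity)
  · have h1 : ∑ l, t.1 l = 1 := t.2.2
    have h2 : ∑ l : Fin (m + 1), (1 - (m + 1) * t.1 l) = 0 := by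
      rw [Finset.sum_sub_distrib, ← Finset.mul_sum, h1]
      simp
    rw [← Finset.sum_div, Finset.sum_sub_distrib, ← Finset.sum_div, h2]
    simp only [zero_div, sub_zero, Finset.sum_const, Finset.card_univ, Fintype.card_fin, nsmul_eq_mul]
    have : (m + 1 : ℝ) ≠ 0 := by positivity
    push_cast
    field_simp

theorem sup'_le_iff_forall {m : ℕ} {f : Fin (m + 1) → ℝ} {r : ℝ} :
    Finset.univ.sup' Finset.univ_nonempty f ≤ r ↔ ∀ l, f l ≤ r := by
  simp

open Classical in
/-- Scaling of a simplex from its barycenter. -/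
noncomputable def simplexScale {m : ℕ} (t : Simplex m) (r : ℝ) : Simplex m :=
  if h : (∀ l, 1 - (m + 1) * t.1 l ≤ r) ∧ 0 < r then ⟨_, simplex_scale_mem t h.1 h.2⟩ else t

theorem simplexScale_val {m : ℕ} {t : Simplex m} {r : ℝ}
    (h : (∀ l, 1 - (m + 1) * t.1 l ≤ r) ∧ 0 < r) :
    (simplexScale t r).1 = fun l => (1 - (1 - (m + 1) * t.1 l) / r) / (m + 1) := by
  rw [simplexScale, dif_pos h]

/-- The gauge of a simplex whose frontier is the boundary. -/
noncomputable def simplexGauge (m : ℕ) : Gauge (Simplex m) where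
  g t := Finset.univ.sup' Finset.univ_nonempty fun l => 1 - (m + 1) * t.1 l
  continuous_g := Continuous.finset_sup'_apply _ fun l _ => continuous_const.sub
    (continuous_const.mul ((continuous_apply l).comp continuous_subtype_val))
  le_one t := Finset.sup'_le _ _ fun l _ => by
    have := t.2.1 l
    have : 0 ≤ (m + 1 : ℝ) * t.1 l := by positivity
    linarith
  scale := simplexScale
  continuousOn_scale := by
    rw [continuousOn_iff_continuous_domRestrict, continuous_induced_rng]
    have h : ∀ p : {p : Simplex m × ℝ | (Finset.univ.sup' Finset.univ_nonempty
        fun l => 1 - (m + 1) * p.1.1 l) ≤ p.2 ∧ 0 < p.2},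
        (∀ l, 1 - (m + 1) * p.1.1.1 l ≤ p.1.2) ∧ 0 < p.1.2 :=
      fun p => ⟨sup'_le_iff_forall.1 p.2.1, p.2.2⟩
    refine Continuous.congr (f := fun (p : {p : Simplex m × ℝ | (Finset.univ.sup' Finset.univ_nonempty
        fun l => 1 - (m + 1) * p.1.1 l) ≤ p.2 ∧ 0 < p.2}) => fun l => (1 - (1 - (m + 1) * p.1.1.1 l) / p.1.2) / (m + 1))
      (continuous_pi fun l => ?_) fun p => ?_
    · have hl : Continuous fun p : {p : Simplex m × ℝ | (Finset.univ.sup' Finset.univ_nonempty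
          fun l => 1 - (m + 1) * p.1.1 l) ≤ p.2 ∧ 0 < p.2} => p.1.1.1 l :=
        (continuous_apply l).comp (continuous_subtype_val.comp
          (continuous_fst.comp continuous_subtype_val))
      refine Continuous.div_const (continuous_const.sub (Continuous.div
        (continuous_const.sub (continuous_const.mul hl)) (by fun_prop) fun p => (h p).2.ne')) _
    · exact (simplexScale_val (h p)).symm
  scale_one t := by
    have h : (∀ l, 1 - (m + 1) * t.1 l ≤ 1) ∧ (0 : ℝ) < 1 := ⟨fun l => by
      have := t.2.1 l
      have : 0 ≤ (m + 1 : ℝ) * t.1 l := by positivity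
      linarith, zero_lt_one⟩
    refine Subtype.ext ((simplexScale_val h).trans (funext fun l => ?_))
    have : (m + 1 : ℝ) ≠ 0 := by positivity
    field_simp
    ring
  g_scale t r h hr := by
    rw [simplexScale_val ⟨sup'_le_iff_forall.1 h, hr⟩]
    have h1 : (m + 1 : ℝ) ≠ 0 := by positivity
    have h2 : ∀ l, 1 - (m + 1) * ((1 - (1 - (m + 1) * t.1 l) / r) / (m + 1)) =
        (1 - (m + 1) * t.1 l) / r := fun l => by
      field_simp
      ring
    simp only [h2]
    refine le_antisymm (sup'_le_iff_forall.2 fun l => ?_) ((div_le_iff₀ hr).2 ?_)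
    · exact div_le_div_of_nonneg_right
        (Finset.le_sup' (fun l : Fin (m + 1) => 1 - (m + 1) * t.1 l) (Finset.mem_univ l)) hr.le
    · refine sup'_le_iff_forall.2 fun l => (div_le_iff₀ hr).1 ?_
      exact Finset.le_sup' (fun l : Fin (m + 1) => (1 - (m + 1) * t.1 l) / r) (Finset.mem_univ l)

theorem exists_eq_zero_of_simplexGauge {m : ℕ} {t : Simplex m} (h : (simplexGauge m).g t = 1) :
    ∃ l, t.1 l = 0 := by
  obtain ⟨l, -, hl⟩ := Finset.exists_mem_eq_sup' Finset.univ_nonempty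
    fun l : Fin (m + 1) => 1 - (m + 1) * t.1 l
  have h' : 1 - (m + 1) * t.1 l = 1 := hl.symm.trans h
  refine ⟨l, ?_⟩
  have : (m + 1 : ℝ) * t.1 l = 0 := by linarith
  exact (mul_eq_zero.1 this).resolve_left (by positivity)

theorem simplexGauge_eq_one {m : ℕ} {t : Simplex m} {l : Fin (m + 1)} (h : t.1 l = 0) :
    (simplexGauge m).g t = 1 := by
  refine le_antisymm ((simplexGauge m).le_one t) ?_
  refine le_trans ?_ (Finset.le_sup' (fun l : Fin (m + 1) => 1 - (m + 1) * t.1 l) (Finset.mem_univ l))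
  simp only [h, mul_zero, sub_zero, le_refl]

theorem simplexGauge_map_eq_one {m : ℕ} (k : Fin m) (θ : Fin (k.1 + 1) ↪o Fin (m + 1))
    (t : Simplex k.1) : (simplexGauge m).g (stdSimplex.map θ t) = 1 := by
  have : ∃ l, (stdSimplex.map θ t).1 l = 0 := by
    by_contra! h
    have hs : Function.Surjective θ := fun l => exists_of_simplex_map_ne_zero θ.toOrderHom t l (h l)
    have := Fintype.card_le_of_surjective θ hs
    simp at this
    omega
  obtain ⟨l, hl⟩ := this
  exact simplexGauge_eq_one hl

theorem simplexGauge_prod_frontier_cases {m : ℕ} {J : Type*} [TopologicalSpace J] (GJ : Gauge J)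
    (l : ((simplexGauge m).prod GJ).Frontier) :
    (∃ (k : Fin m) (θ : Fin (k.1 + 1) ↪o Fin (m + 1)) (t : Simplex k.1) (j : J),
      l.1 = (stdSimplex.map θ t, j)) ∨ ∃ (t : Simplex m) (j : GJ.Frontier), l.1 = (t, j.1) := by
  obtain ⟨⟨t, j⟩, hl⟩ := l
  have hl' : max ((simplexGauge m).g t) (GJ.g j) = 1 := hl
  rcases max_choice ((simplexGauge m).g t) (GJ.g j) with h | h
  · obtain ⟨l, h0⟩ := exists_eq_zero_of_simplexGauge (h.symm.trans hl')
    obtain ⟨k, θ, t', ht', hθ⟩ := exists_simplex_support t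
    have hk : k < m := by
      by_contra hk
      have h1 := Fintype.card_le_of_injective θ θ.injective
      simp only [Fintype.card_fin] at h1
      obtain rfl : k = m := by omega
      obtain ⟨x, rfl⟩ := Finite.surjective_of_injective θ.injective l
      exact hθ x h0
    exact Or.inl ⟨⟨k, hk⟩, θ, t', j, Prod.ext ht'.symm rfl⟩
  · exact Or.inr ⟨t, ⟨j, h.symm.trans hl'⟩, rfl⟩

theorem simplexGauge_prod_map_eq_one {m : ℕ} {J : Type*} [TopologicalSpace J] (GJ : Gauge J)
    (k : Fin m) (θ : Fin (k.1 + 1) ↪o Fin (m + 1)) (t : Simplex k.1) (j : J) :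
    ((simplexGauge m).prod GJ).g (stdSimplex.map θ t, j) = 1 := by
  change max ((simplexGauge m).g _) (GJ.g j) = 1
  rw [simplexGauge_map_eq_one k θ t]
  exact max_eq_left (GJ.le_one j)

theorem simplexGauge_prod_frontier_eq_one {m : ℕ} {J : Type*} [TopologicalSpace J] (GJ : Gauge J)
    (t : Simplex m) (j : GJ.Frontier) : ((simplexGauge m).prod GJ).g (t, j.1) = 1 := by
  change max ((simplexGauge m).g _) (GJ.g j.1) = 1
  rw [j.2]
  exact max_eq_right ((simplexGauge m).le_one t)

/-- Compatible maps on the faces of a simplex times `J`, and on the simplex times the frontier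
of `J`, define a map on the frontier of the product. -/
theorem exists_boundary_map {m : ℕ} {J T P : Type*} [TopologicalSpace J] [CompactSpace J]
    [T2Space J] [TopologicalSpace T] [TopologicalSpace P] (GJ : Gauge J)
    (b : ∀ k : Fin m, (Fin (k.1 + 1) ↪o Fin (m + 1)) → C(T × (Simplex k.1 × J), P))
    (bF : C(T × (Simplex m × GJ.Frontier), P))
    (hb : ∀ (k k' : Fin m) (_ : k' < k) (θ : Fin (k.1 + 1) ↪o Fin (m + 1))
      (φ : Fin (k'.1 + 1) ↪o Fin (k.1 + 1)) x t j,
      b k θ (x, (stdSimplex.map φ t, j)) = b k' (φ.trans θ) (x, (t, j)))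
    (hF : ∀ (k : Fin m) (θ : Fin (k.1 + 1) ↪o Fin (m + 1)) x t (j : GJ.Frontier),
      b k θ (x, (t, j.1)) = bF (x, (stdSimplex.map θ t, j))) :
    ∃ B : C(T × ((simplexGauge m).prod GJ).Frontier, P),
      (∀ k (θ : Fin (k.1 + 1) ↪o Fin (m + 1)) x t j hl,
        B (x, ⟨(stdSimplex.map θ t, j), hl⟩) = b k θ (x, (t, j))) ∧
      ∀ x t (j : GJ.Frontier) hl, B (x, ⟨(t, j.1), hl⟩) = bF (x, (t, j)) := by
  have hcJ : CompactSpace GJ.Frontier :=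
    isCompact_iff_compactSpace.1 (isClosed_eq GJ.continuous_g continuous_const).isCompact
  let φ : (Simplex m × GJ.Frontier) ⊕
      (i : (k : Fin m) × (Fin (k.1 + 1) ↪o Fin (m + 1))) × (Simplex i.1.1 × J) →
      ((simplexGauge m).prod GJ).Frontier :=
    Sum.elim (fun x => ⟨(x.1, x.2.1), simplexGauge_prod_frontier_eq_one GJ x.1 x.2⟩)
      fun x => ⟨(stdSimplex.map x.1.2 x.2.1, x.2.2), simplexGauge_prod_map_eq_one GJ x.1.1 x.1.2 x.2.1 x.2.2⟩
  have hφ : Continuous φ := by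
    have h1 : Continuous fun x : Simplex m × GJ.Frontier => (x.1, x.2.1) := by fun_prop
    have h2 : ∀ i : (k : Fin m) × (Fin (k.1 + 1) ↪o Fin (m + 1)), Continuous
        fun x : Simplex i.1.1 × J => (stdSimplex.map (S := ℝ) i.2 x.1, x.2) := fun i =>
      ((stdSimplex.continuous_map i.2).comp continuous_fst).prodMk continuous_snd
    exact (h1.subtype_mk fun x => simplexGauge_prod_frontier_eq_one GJ x.1 x.2).sumElim
      (continuous_sigma fun i => (h2 i).subtype_mk fun x =>
        simplexGauge_prod_map_eq_one GJ i.1 i.2 x.1 x.2)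
  have hφs : Function.Surjective φ := by
    intro l
    rcases simplexGauge_prod_frontier_cases GJ l with ⟨k, θ, t, j, h⟩ | ⟨t, j, h⟩
    · exact ⟨Sum.inr ⟨⟨k, θ⟩, (t, j)⟩, Subtype.ext h.symm⟩
    · exact ⟨Sum.inl (t, j), Subtype.ext h.symm⟩
  let f : C(T × ((Simplex m × GJ.Frontier) ⊕
      (i : (k : Fin m) × (Fin (k.1 + 1) ↪o Fin (m + 1))) × (Simplex i.1.1 × J)), P) :=
    ⟨fun x => Sum.elim (fun y => bF (x.1, y)) (fun y => b y.1.1 y.1.2 (x.1, y.2)) x.2, by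
      refine continuous_prod_sum_sigma bF.continuous fun i => ?_
      exact (b i.1 i.2).continuous⟩
  -- If two faces share a point, both contain the face spanned by its support; both values are
  -- compared with the value on that face.
  have hbb : ∀ (k₁ k₂ : Fin m) (θ₁ : Fin (k₁.1 + 1) ↪o Fin (m + 1))
      (θ₂ : Fin (k₂.1 + 1) ↪o Fin (m + 1)) x t₁ t₂ j,
      stdSimplex.map (S := ℝ) θ₁ t₁ = stdSimplex.map θ₂ t₂ →
      b k₁ θ₁ (x, (t₁, j)) = b k₂ θ₂ (x, (t₂, j)) := by
    intro k₁ k₂ θ₁ θ₂ x t₁ t₂ j h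
    obtain ⟨k, φ, t, ht, hφ⟩ := exists_simplex_support (stdSimplex.map (S := ℝ) θ₁ t₁)
    have key : ∀ (k' : Fin m) (θ : Fin (k'.1 + 1) ↪o Fin (m + 1)) (t' : Simplex k'.1),
        stdSimplex.map (S := ℝ) θ t' = stdSimplex.map θ₁ t₁ →
        ∃ hk : k < m, b k' θ (x, (t', j)) = b ⟨k, hk⟩ φ (x, (t, j)) := by
      intro k' θ t' h'
      obtain ⟨ψ, hψ⟩ := exists_orderHom_lift θ φ.toOrderHom fun l =>
        exists_of_simplex_map_ne_zero θ.toOrderHom t' (φ l) (by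
          refine Eq.trans_ne ?_ (hφ l)
          exact congrArg (fun s : Simplex m => s.1 (φ l)) h')
      have hψs : StrictMono ψ := ψ.monotone.strictMono_of_injective fun a b hab =>
        φ.injective ((hψ a).symm.trans ((congrArg θ hab).trans (hψ b)))
      let ψ' : Fin (k + 1) ↪o Fin (k'.1 + 1) := OrderEmbedding.ofStrictMono ψ hψs
      obtain rfl : ψ'.trans θ = φ := RelEmbedding.ext hψ
      have ht' : stdSimplex.map (S := ℝ) ψ' t = t' := simplex_map_injective θ (by
        rw [h', ← ht]
        exact (simplex_map_comp θ.toOrderHom ψ'.toOrderHom t).symm)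
      have hk : k ≤ k'.1 := by
        have h1 := Fintype.card_le_of_injective ψ' ψ'.injective
        rw [Fintype.card_fin, Fintype.card_fin] at h1
        exact Nat.le_of_succ_le_succ h1
      refine ⟨hk.trans_lt k'.2, ?_⟩
      rw [← ht']
      rcases hk.eq_or_lt with hk | hk
      · subst hk
        have h1 : ψ' = RelEmbedding.refl _ := RelEmbedding.ext fun l =>
          congrFun ((StrictMono.range_inj (g := id) ψ'.strictMono strictMono_id).1
            ((Finite.surjective_of_injective ψ'.injective).range_eq.trans Set.range_id.symm)) l
        rw [h1]
        exact congrArg (fun s => b k' θ (x, (s, j))) (stdSimplex.map_id_apply t)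
      · exact hb k' ⟨k, hk.trans k'.2⟩ hk θ ψ' x t j
    obtain ⟨hk, h1⟩ := key k₁ θ₁ t₁ rfl
    obtain ⟨_, h2⟩ := key k₂ θ₂ t₂ h.symm
    exact h1.trans h2.symm
  obtain ⟨B, hB⟩ := exists_descend ⟨φ, hφ⟩ hφs f (by
    intro x y y' h
    have h' : (φ y).1 = (φ y').1 := congrArg Subtype.val h
    rcases y with ⟨t, j⟩ | ⟨⟨k, θ⟩, t, j⟩ <;> rcases y' with ⟨t', j'⟩ | ⟨⟨k', θ'⟩, t', j'⟩
    · obtain rfl : t = t' := congrArg Prod.fst h'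
      obtain rfl : j = j' := Subtype.ext (congrArg Prod.snd h')
      rfl
    · obtain rfl : t = stdSimplex.map θ' t' := congrArg Prod.fst h'
      obtain rfl : j.1 = j' := congrArg Prod.snd h'
      exact (hF k' θ' x t' j).symm
    · obtain rfl : stdSimplex.map θ t = t' := congrArg Prod.fst h'
      obtain rfl : j = j'.1 := congrArg Prod.snd h'
      exact hF k θ x t j'
    · obtain rfl : j = j' := congrArg Prod.snd h'
      exact hbb k k' θ θ' x t t' j (congrArg Prod.fst h'))
  refine ⟨B, fun k θ x t j hl => ?_, fun x t j hl => ?_⟩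
  · exact hB x (Sum.inr ⟨⟨k, θ⟩, (t, j)⟩)
  · exact hB x (Sum.inl (t, j))

/-! ### Recursion over nondegenerate multiindices -/

/-- Here D i is not known to be inhabited before the recursion reaches i. Values are therefore taken
in `Option`, with `none` if no compatible choice exists, and induction shows that `none` never
occurs. -/
theorem exists_rank_recursion {I : Type*} (rank : I → ℕ) {D : I → Type*}
    (R : ∀ i j : I, D i → D j → Prop)
    (step : ∀ (i : I) (d : ∀ j, rank j < rank i → D j),
      (∀ j j' hj hj', rank j' < rank j → R j j' (d j hj) (d j' hj')) →
      ∃ x : D i, ∀ j hj, R i j x (d j hj)) :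
    ∃ d : ∀ i, D i, ∀ i j, rank j < rank i → R i j (d i) (d j) := by
  classical
  let wf : WellFounded fun i j : I => rank i < rank j := InvImage.wf rank Nat.lt_wfRel.wf
  let ok : ∀ i, (∀ j, rank j < rank i → Option (D j)) → D i → Prop := fun i ih x =>
    ∀ j hj, ∃ y, ih j hj = some y ∧ R i j x y
  let F : ∀ i, (∀ j, rank j < rank i → Option (D j)) → Option (D i) := fun i ih =>
    if h : ∃ x, ok i ih x then some h.choose else none
  let d : ∀ i, Option (D i) := wf.fix F
  have hd : ∀ i, d i = F i fun j _ => d j := fun i => wf.fix_eq F i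
  have key : ∀ i, ∃ x, d i = some x ∧ ok i (fun j _ => d j) x := by
    intro i
    induction i using wf.induction with
    | _ i ih =>
      choose e he heR using ih
      obtain ⟨x, hx⟩ := step i e fun j j' hj hj' hlt => by
        obtain ⟨y, hy, h⟩ := heR j hj j' hlt
        change d j' = some y at hy
        rw [he j' hj'] at hy
        obtain rfl := Option.some.inj hy
        exact h
      have h : ∃ x, ok i (fun j _ => d j) x := ⟨x, fun j hj => ⟨_, he j hj, hx j hj⟩⟩
      refine ⟨h.choose, ?_, h.choose_spec⟩
      rw [hd]
      exact dif_pos h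
  choose e he heR using key
  refine ⟨e, fun i j h => ?_⟩
  obtain ⟨y, hy, hR⟩ := heR i j h
  change d j = some y at hy
  rw [he j] at hy
  obtain rfl := Option.some.inj hy
  exact hR

/-- Nondegenerate multiindices. -/
abbrev StrictChain (M : Type u) [Preorder M] : Type u := (m : ℕ) × (Fin (m + 1) ↪o M)

/-! ### Lifting problems, solved one simplex at a time. -/

namespace CoarseMorphism

variable {A : Type u} [TopologicalSpace A] {S : InvSystem.{u}}

/-- A coherent family `h` on `A × J` whose restriction to the frontier of `J` factors, through a
coherent family `e` on the system. -/
structure LiftingProblem (p : CoarseMorphism A S) (Z : InvSystem.{u}) {J : Type}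
    [TopologicalSpace J] (GJ : Gauge J) where
  h : ℕ → ∀ {m : ℕ} (ν : MultiIndex Z.Idx m), C(A × (Simplex m × J), Z.obj (ν 0))
  idx : Z.Idx →o S.Idx
  e : ℕ → ∀ {m : ℕ} (ν : MultiIndex Z.Idx m),
    C(S.obj (idx (ν (Fin.last m))) × (Simplex m × GJ.Frontier), Z.obj (ν 0))
  h_coh : ∀ {m k : ℕ} (ν : MultiIndex Z.Idx m) (θ : Fin (k + 1) →o Fin (m + 1)),
    ∀ᶠ n in atTop, ∀ a t j, h n ν (a, (stdSimplex.map θ t, j)) =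
      Z.map (ν.monotone (Fin.zero_le (θ 0))) (h n (ν.comp θ) (a, (t, j)))
  e_coh : ∀ {m k : ℕ} (ν : MultiIndex Z.Idx m) (θ : Fin (k + 1) →o Fin (m + 1)),
    ∀ᶠ n in atTop, ∀ x t j, e n ν (x, (stdSimplex.map θ t, j)) =
      Z.map (ν.monotone (Fin.zero_le (θ 0))) (e n (ν.comp θ)
        (S.map (idx.monotone (ν.monotone (Fin.le_last (θ (Fin.last k))))) x, (t, j)))
  h_frontier : ∀ {m : ℕ} (ν : MultiIndex Z.Idx m), ∀ᶠ n in atTop, ∀ a t (j : GJ.Frontier),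
    h n ν (a, (t, j.1)) = e n ν (p.maps n _ a, (t, j))

variable {p : CoarseMorphism A S} {Z : InvSystem.{u}} {J : Type} [TopologicalSpace J] {GJ : Gauge J}

/-- A solution of a lifting problem at one nondegenerate multiindex. -/
structure LiftingProblem.Solution (D : p.LiftingProblem Z GJ) (i : StrictChain Z.Idx) where
  idx : S.Idx
  le : D.idx (i.2 (Fin.last i.1)) ≤ idx
  f : ℕ → C(S.obj idx × (Simplex i.1 × J), Z.obj (i.2 0))
  H : ℕ → C((A × (Simplex i.1 × J)) × unitInterval, Z.obj (i.2 0))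
  H_zero : ∀ᶠ n in atTop, ∀ x, H n (x, 0) = D.h n i.2.toOrderHom x
  H_one : ∀ᶠ n in atTop, ∀ a x, H n ((a, x), 1) = f n (p.maps n idx a, x)
  f_frontier : ∀ᶠ n in atTop, ∀ x t (j : GJ.Frontier),
    f n (x, (t, j.1)) = D.e n i.2.toOrderHom (S.map le x, (t, j))
  H_frontier : ∀ᶠ n in atTop, ∀ a t (j : GJ.Frontier) r,
    H n ((a, (t, j.1)), r) = D.h n i.2.toOrderHom (a, (t, j.1))

/-- The solution at `i` restricts to the solution at `j`. -/
def LiftingProblem.Solution.Extends {D : p.LiftingProblem Z GJ} {i j : StrictChain Z.Idx}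
    (x : D.Solution i) (y : D.Solution j) : Prop :=
  ∀ (θ : Fin (j.1 + 1) →o Fin (i.1 + 1)) (hθ : ∀ l, i.2 (θ l) = j.2 l), ∃ hle : y.idx ≤ x.idx,
    ∀ᶠ n in atTop,
      (∀ z t s, x.f n (z, (stdSimplex.map θ t, s)) =
        Z.map ((i.2.monotone (Fin.zero_le _)).trans_eq (hθ 0)) (y.f n (S.map hle z, (t, s)))) ∧
      ∀ a t s r, x.H n ((a, (stdSimplex.map θ t, s)), r) =
        Z.map ((i.2.monotone (Fin.zero_le _)).trans_eq (hθ 0)) (y.H n ((a, (t, s)), r))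

variable [CompactSpace J] [T2Space J]

/-- The solutions on the proper faces and the data e define B on the boundary of Δ^m × J, over an
index `lam` beyond all of theirs. Homotopy extension deforms h to a map g whose boundary values
factor through B, so the extension property applies to g. -/
theorem LiftingProblem.exists_solution_step (D : p.LiftingProblem Z GJ) (hp : p.ExtensionProperty)
    (hZ : Z.InHPol) (m : ℕ) (e : Fin (m + 1) ↪o Z.Idx)
    (c : ∀ (k : Fin m) (θ : Fin (k.1 + 1) ↪o Fin (m + 1)), D.Solution ⟨k.1, θ.trans e⟩)
    (hc : ∀ (k k' : Fin m) (_ : k' < k) (θ : Fin (k.1 + 1) ↪o Fin (m + 1))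
      (φ : Fin (k'.1 + 1) ↪o Fin (k.1 + 1)), (c k θ).Extends (c k' (φ.trans θ))) :
    ∃ x : D.Solution ⟨m, e⟩, ∀ k θ, x.Extends (c k θ) := by
  have hP : IsHPol (Z.obj (e 0)) := hZ _
  let e' : MultiIndex Z.Idx m := e.toOrderHom
  -- a default value
  obtain ⟨i₀, -, f₀, -⟩ := hp (Simplex m × J) (Gauge.trivial _) _ hP S.nonempty.some
    (fun n => D.h n e')
    (fun n => ⟨fun x => absurd x.2.2 zero_ne_one, by
      have : IsEmpty (S.obj S.nonempty.some × (Gauge.trivial (Simplex m × J)).Frontier) :=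
        ⟨fun x => absurd x.2.2 zero_ne_one⟩
      exact continuous_of_discreteTopology⟩)
    (Eventually.of_forall fun n a l => absurd l.2 zero_ne_one)
  obtain ⟨lam₀, hlam₀⟩ := S.exists_upper_bound
    (Finset.univ : Finset ((k : Fin m) × (Fin (k.1 + 1) ↪o Fin (m + 1)))) fun i => (c i.1 i.2).idx
  obtain ⟨lam₁, h01, hi1⟩ := S.directed lam₀ i₀
  obtain ⟨lam, h1, hε⟩ := S.directed lam₁ (D.idx (e (Fin.last m)))
  have hlam : ∀ k θ, (c k θ).idx ≤ lam := fun k θ =>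
    ((hlam₀ ⟨k, θ⟩ (Finset.mem_univ _)).trans h01).trans h1
  have hle : ∀ (k : Fin m) (θ : Fin (k.1 + 1) ↪o Fin (m + 1)), e 0 ≤ e (θ 0) := fun k θ =>
    e.monotone (Fin.zero_le _)
  -- the frontier
  let b : ∀ (_ : ℕ) (k : Fin m) (θ : Fin (k.1 + 1) ↪o Fin (m + 1)),
      C(S.obj lam × (Simplex k.1 × J), Z.obj (e 0)) := fun n k θ =>
    ((Z.map (hle k θ)).comp ((c k θ).f n)).comp ((S.map (hlam k θ)).prodMap (ContinuousMap.id _))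
  let bF : ℕ → C(S.obj lam × (Simplex m × GJ.Frontier), Z.obj (e 0)) := fun n =>
    (D.e n e').comp ((S.map hε).prodMap (ContinuousMap.id _))
  let bH : ∀ (_ : ℕ) (k : Fin m) (θ : Fin (k.1 + 1) ↪o Fin (m + 1)),
      C((A × unitInterval) × (Simplex k.1 × J), Z.obj (e 0)) := fun n k θ =>
    ((Z.map (hle k θ)).comp ((c k θ).H n)).comp ⟨fun x => ((x.1.1, x.2), x.1.2), by fun_prop⟩
  let bHF : ℕ → C((A × unitInterval) × (Simplex m × GJ.Frontier), Z.obj (e 0)) := fun n =>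
    (D.h n e').comp ⟨fun x => (x.1.1, (x.2.1, x.2.2.1)), by fun_prop⟩
  have hrel : ∀ᶠ n in atTop, ∀ (k k' : Fin m) (_ : k' < k) (θ : Fin (k.1 + 1) ↪o Fin (m + 1))
      (φ : Fin (k'.1 + 1) ↪o Fin (k.1 + 1)),
      (∀ x t j, b n k θ (x, (stdSimplex.map φ t, j)) = b n k' (φ.trans θ) (x, (t, j))) ∧
      ∀ x t j, bH n k θ (x, (stdSimplex.map φ t, j)) = bH n k' (φ.trans θ) (x, (t, j)) := by
    refine eventually_all.2 fun k => eventually_all.2 fun k' => ?_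
    by_cases hk : k' < k
    · refine Eventually.mono (eventually_all.2 fun θ => eventually_all.2 fun φ => ?_)
        fun n h _ => h
      obtain ⟨h1, h2⟩ := hc k k' hk θ φ φ.toOrderHom fun _ => rfl
      filter_upwards [h2] with n hn
      refine ⟨fun x t j => ?_, fun x t j => ?_⟩
      · refine (congrArg (Z.map (hle k θ)) (hn.1 (S.map (hlam k θ) x) t j)).trans
          ((Z.map_comp _ _ _).trans ?_)
        exact congrArg (fun z => Z.map _ ((c k' (φ.trans θ)).f n (z, (t, j)))) (S.map_comp _ _ _)
      · exact (congrArg (Z.map (hle k θ)) (hn.2 x.1 t j x.2)).trans (Z.map_comp _ _ _)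
    · exact Eventually.of_forall fun n h => absurd h hk
  have hrelF : ∀ᶠ n in atTop, ∀ (k : Fin m) (θ : Fin (k.1 + 1) ↪o Fin (m + 1)),
      (∀ x t (j : GJ.Frontier), b n k θ (x, (t, j.1)) = bF n (x, (stdSimplex.map θ t, j))) ∧
      ∀ x t (j : GJ.Frontier), bH n k θ (x, (t, j.1)) = bHF n (x, (stdSimplex.map θ t, j)) := by
    refine eventually_all.2 fun k => eventually_all.2 fun θ => ?_
    filter_upwards [(c k θ).f_frontier, (c k θ).H_frontier, D.e_coh e' θ.toOrderHom,
      D.h_coh e' θ.toOrderHom] with n h1 h2 h3 h4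
    refine ⟨fun x t j => ?_, fun x t j => ?_⟩
    · refine (congrArg (Z.map (hle k θ)) (h1 (S.map (hlam k θ) x) t j)).trans
        (Eq.trans ?_ (h3 (S.map hε x) t j).symm)
      exact congrArg (fun z => Z.map (hle k θ) (D.e n (e'.comp θ.toOrderHom) (z, (t, j))))
        ((S.map_comp _ _ _).trans (S.map_comp _ _ _).symm)
    · exact (congrArg (Z.map (hle k θ)) (h2 x.1 t j x.2)).trans (h4 x.1 t j.1).symm
  have hB : ∀ᶠ n in atTop, ∃ B : C(S.obj lam × ((simplexGauge m).prod GJ).Frontier, Z.obj (e 0)),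
      (∀ k (θ : Fin (k.1 + 1) ↪o Fin (m + 1)) x t j hl,
        B (x, ⟨(stdSimplex.map θ t, j), hl⟩) = b n k θ (x, (t, j))) ∧
      ∀ x t (j : GJ.Frontier) hl, B (x, ⟨(t, j.1), hl⟩) = bF n (x, (t, j)) := by
    filter_upwards [hrel, hrelF] with n h1 h2
    exact exists_boundary_map GJ (b n) (bF n) (fun k k' hk θ φ => (h1 k k' hk θ φ).1)
      fun k θ => (h2 k θ).1
  -- Some map is required for the n at which the boundary data do not fit; it is the restriction of
  -- a map supplied by the extension property for the empty frontier.
  have : Nonempty C(S.obj lam × ((simplexGauge m).prod GJ).Frontier, Z.obj (e 0)) :=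
    ⟨(f₀ 0).comp ((S.map (hi1.trans h1)).prodMap ⟨_, continuous_subtype_val⟩)⟩
  obtain ⟨B, hB⟩ := exists_of_eventually_exists hB
  -- extension of the homotopy
  have hg : ∀ᶠ n in atTop, ∃ g : C(A × (Simplex m × J), Z.obj (e 0)),
      (∀ a (l : ((simplexGauge m).prod GJ).Frontier), g (a, l.1) = B n (p.maps n lam a, l)) ∧
      ∃ H : C((A × (Simplex m × J)) × unitInterval, Z.obj (e 0)),
        (∀ x, H (x, 0) = D.h n e' x) ∧ (∀ x, H (x, 1) = g x) ∧
        (∀ k (θ : Fin (k.1 + 1) ↪o Fin (m + 1)) a t j r,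
          H ((a, (stdSimplex.map θ t, j)), r) = bH n k θ ((a, r), (t, j))) ∧
        ∀ a t (j : GJ.Frontier) r, H ((a, (t, j.1)), r) = D.h n e' (a, (t, j.1)) := by
    have hcoh : ∀ᶠ n in atTop, ∀ (k : Fin m) (θ : Fin (k.1 + 1) ↪o Fin (m + 1)) a t j,
        D.h n e' (a, (stdSimplex.map θ t, j)) =
          Z.map (hle k θ) (D.h n (e'.comp θ.toOrderHom) (a, (t, j))) :=
      eventually_all.2 fun k => eventually_all.2 fun θ => D.h_coh e' θ.toOrderHom
    have hH₀ : ∀ᶠ n in atTop, ∀ (k : Fin m) (θ : Fin (k.1 + 1) ↪o Fin (m + 1)) x,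
        (c k θ).H n (x, 0) = D.h n (e'.comp θ.toOrderHom) x :=
      eventually_all.2 fun k => eventually_all.2 fun θ => (c k θ).H_zero
    have hH₁ : ∀ᶠ n in atTop, ∀ (k : Fin m) (θ : Fin (k.1 + 1) ↪o Fin (m + 1)) a x,
        (c k θ).H n ((a, x), 1) = (c k θ).f n (p.maps n (c k θ).idx a, x) :=
      eventually_all.2 fun k => eventually_all.2 fun θ => (c k θ).H_one
    have hcomm : ∀ᶠ n in atTop, ∀ (k : Fin m) (θ : Fin (k.1 + 1) ↪o Fin (m + 1)) a,
        S.map (hlam k θ) (p.maps n lam a) = p.maps n (c k θ).idx a :=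
      eventually_all.2 fun k => eventually_all.2 fun θ => p.comm (hlam k θ)
    filter_upwards [hrel, hrelF, hB, D.h_frontier e', p.comm hε, hcoh, hH₀, hH₁, hcomm]
      with n h1 h2 h3 h4 h5 h6 h7 h8 h9
    obtain ⟨C, hC, hCF⟩ := exists_boundary_map GJ (bH n) (bHF n)
      (fun k k' hk θ φ => (h1 k k' hk θ φ).2) fun k θ => (h2 k θ).2
    obtain ⟨H, hH0, hHL⟩ := ((simplexGauge m).prod GJ).homotopy_extension (D.h n e')
      (C.comp ⟨fun x => ((x.1.1, x.2), x.1.2), by fun_prop⟩) (by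
        rintro a ⟨l, hl⟩
        rcases simplexGauge_prod_frontier_cases GJ ⟨l, hl⟩ with ⟨k, θ, t, j, h⟩ | ⟨t, j, h⟩
        · obtain rfl : l = (stdSimplex.map θ t, j) := h
          refine (hC k θ (a, 0) t j hl).trans (Eq.trans ?_ (h6 k θ a t j).symm)
          exact congrArg (Z.map (hle k θ)) (h7 k θ (a, (t, j)))
        · obtain rfl : l = (t, j.1) := h
          exact hCF (a, 0) t j hl)
    refine ⟨H.comp ⟨fun x => (x, 1), by fun_prop⟩, ?_, H, fun x => hH0 x.1 x.2, fun _ => rfl,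
      fun k θ a t j r => ?_, fun a t j r => ?_⟩
    · rintro a ⟨l, hl⟩
      refine (hHL a ⟨l, hl⟩ 1).trans ?_
      rcases simplexGauge_prod_frontier_cases GJ ⟨l, hl⟩ with ⟨k, θ, t, j, h⟩ | ⟨t, j, h⟩
      · obtain rfl : l = (stdSimplex.map θ t, j) := h
        refine (hC k θ (a, 1) t j hl).trans (Eq.trans ?_ (h3.1 k θ _ t j hl).symm)
        refine congrArg (Z.map (hle k θ)) ((h8 k θ a (t, j)).trans ?_)
        exact congrArg (fun z => (c k θ).f n (z, (t, j))) (h9 k θ a).symm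
      · obtain rfl : l = (t, j.1) := h
        refine (hCF (a, 1) t j hl).trans (Eq.trans ?_ (h3.2 _ t j hl).symm)
        refine (h4 a t j).trans ?_
        exact congrArg (fun z => D.e n e' (z, (t, j))) (h5 a).symm
    · have hl := simplexGauge_prod_map_eq_one GJ k θ t j
      exact (hHL a ⟨_, hl⟩ r).trans (hC k θ (a, r) t j hl)
    · have hl := simplexGauge_prod_frontier_eq_one GJ t j
      exact (hHL a ⟨_, hl⟩ r).trans (hCF (a, r) t j hl)
  have : Nonempty C(A × (Simplex m × J), Z.obj (e 0)) := ⟨D.h 0 e'⟩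
  obtain ⟨g, hg⟩ := exists_of_eventually_exists hg
  obtain ⟨j₁, hj₁, f, hf⟩ := hp _ ((simplexGauge m).prod GJ) _ hP lam g B
    (hg.mono fun n h => h.1)
  have hH : ∀ᶠ n in atTop, ∃ H : C((A × (Simplex m × J)) × unitInterval, Z.obj (e 0)),
        (∀ x, H (x, 0) = D.h n e' x) ∧ (∀ a x, H ((a, x), 1) = f n (p.maps n j₁ a, x)) ∧
        (∀ k (θ : Fin (k.1 + 1) ↪o Fin (m + 1)) a t j r,
          H ((a, (stdSimplex.map θ t, j)), r) = bH n k θ ((a, r), (t, j))) ∧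
        ∀ a t (j : GJ.Frontier) r, H ((a, (t, j.1)), r) = D.h n e' (a, (t, j.1)) := by
    filter_upwards [hg, hf] with n h1 h2
    obtain ⟨-, H, hH0, hH1, hHk, hHF⟩ := h1
    obtain ⟨-, E, hE0, hE1, hEL⟩ := h2
    -- Concatenating H with E would reparametrize H on the boundary and destroy the agreement with
    -- the faces. Since E is constant there, a fourth side joins the same ends and has exactly the
    -- boundary values of H.
    obtain ⟨H', hL, h0, h1⟩ := ((simplexGauge m).prod GJ).exists_fourth_side
      (H.comp ⟨fun x => ((x.1.1, x.1.2.1), x.2.2), by fun_prop⟩) H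
      ((D.h n e').comp ContinuousMap.fst) E (fun a l t => rfl)
      (fun a l s => (hH0 (a, l.1)).symm) (fun a l s => (hEL a l s).trans (hH1 (a, l.1)).symm)
      (fun a x => (hH0 (a, x)).symm) (fun a x => (hE0 a x).trans (hH1 (a, x)).symm)
    refine ⟨H', fun x => h0 x.1 x.2, fun a x => (h1 a x).trans (hE1 a x),
      fun k θ a t j r => ?_, fun a t j r => ?_⟩
    · exact (hL a ⟨_, simplexGauge_prod_map_eq_one GJ k θ t j⟩ r).trans (hHk k θ a t j r)
    · exact (hL a ⟨_, simplexGauge_prod_frontier_eq_one GJ t j⟩ r).trans (hHF a t j r)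
  have : Nonempty C((A × (Simplex m × J)) × unitInterval, Z.obj (e 0)) :=
    ⟨(D.h 0 e').comp ContinuousMap.fst⟩
  obtain ⟨H, hH⟩ := exists_of_eventually_exists hH
  refine ⟨⟨j₁, hε.trans hj₁, f, H, hH.mono fun n h => h.1, hH.mono fun n h => h.2.1, ?_,
    hH.mono fun n h => h.2.2.2⟩, ?_⟩
  · filter_upwards [hf, hB] with n h1 h2 x t j
    have hl := simplexGauge_prod_frontier_eq_one GJ t j
    refine (h1.1 x ⟨_, hl⟩).trans ((h2.2 _ t j hl).trans ?_)
    exact congrArg (fun z => D.e n e' (z, (t, j))) (S.map_comp _ _ _)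
  · intro k θ θ' hθ'
    obtain rfl : θ' = θ.toOrderHom := OrderHom.ext _ _ (funext fun l => e.injective (hθ' l))
    refine ⟨(hlam k θ).trans hj₁, ?_⟩
    filter_upwards [hf, hB, hH] with n h1 h2 h3
    refine ⟨fun z t s => ?_, fun a t s r => h3.2.2.1 k θ a t s r⟩
    have hl := simplexGauge_prod_map_eq_one GJ k θ t s
    refine (h1.1 z ⟨_, hl⟩).trans ((h2.1 k θ _ t s hl).trans ?_)
    exact congrArg (fun y => Z.map (hle k θ) ((c k θ).f n (y, (t, s)))) (S.map_comp _ _ _)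

end CoarseMorphism

/-- By antisymmetry the range of ν is a finite linear order, and its enumeration is the
nondegenerate multiindex underlying ν. -/
theorem exists_strictChain_factor {M : Type*} [Preorder M]
    (hM : ∀ a b : M, a ≤ b → b ≤ a → a = b) {m : ℕ} (ν : Fin (m + 1) →o M) :
    ∃ (k : ℕ) (e : Fin (k + 1) ↪o M) (σ : Fin (m + 1) →o Fin (k + 1)),
      (∀ l, e (σ l) = ν l) ∧ Function.Surjective σ := by
  classical
  let R : Type _ := Set.range ν
  have hfin : Fintype R := Fintype.ofFinite _
  let _ : LinearOrder R :=
    { le := fun a b => a.1 ≤ b.1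
      lt := fun a b => a.1 < b.1
      lt_iff_le_not_ge := fun a b => lt_iff_le_not_ge
      le_refl := fun a => le_rfl
      le_trans := fun a b c => le_trans
      le_antisymm := fun a b h h' => Subtype.ext (hM _ _ h h')
      le_total := by
        rintro ⟨_, a, rfl⟩ ⟨_, b, rfl⟩
        exact (le_total a b).imp (fun h => ν.monotone h) fun h => ν.monotone h
      toDecidableLE := Classical.decRel _ }
  have hne : Fintype.card R ≠ 0 := (Fintype.card_pos_iff.2 ⟨⟨_, 0, rfl⟩⟩).ne'
  obtain ⟨k, hk⟩ := Nat.exists_eq_succ_of_ne_zero hne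
  let i : Fin (k + 1) ≃o R := Fintype.orderIsoFinOfCardEq R hk
  refine ⟨k, OrderEmbedding.ofMapLEIff (fun l => (i l).1) fun a b => i.le_iff_le,
    ⟨fun l => i.symm ⟨ν l, l, rfl⟩, fun a b h => i.symm.monotone (ν.monotone h)⟩, fun l => ?_,
    fun l => ?_⟩
  · exact congrArg Subtype.val (i.apply_symm_apply ⟨ν l, l, rfl⟩)
  · obtain ⟨x, hx⟩ := (i l).2
    refine ⟨x, ?_⟩
    change i.symm ⟨ν x, x, rfl⟩ = l
    rw [OrderIso.symm_apply_eq]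
    exact Subtype.ext hx

/-- A strict chain is determined by its range, a subset of the finitely many predecessors of ν. This
permits an upper bound for the indices of all solutions below ν. -/
theorem StrictChain.finite_of_last_le {M : Type u} [Preorder M]
    (hM : ∀ i : M, (Set.Iic i).Finite) (ν : M) :
    {i : StrictChain M | i.2 (Fin.last i.1) ≤ ν}.Finite := by
  have := (hM ν).to_subtype
  let φ : {i : StrictChain M | i.2 (Fin.last i.1) ≤ ν} → Set (Set.Iic ν) := fun i =>
    {x | x.1 ∈ Set.range i.1.2}
  have hφ : Function.Injective φ := by
    rintro ⟨⟨k, e⟩, he⟩ ⟨⟨k', e'⟩, he'⟩ h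
    have hr : Set.range e = Set.range e' := by
      have key : ∀ {j : ℕ} (e : Fin (j + 1) ↪o M), e (Fin.last j) ≤ ν → ∀ l, e l ≤ ν :=
        fun e he l => (e.monotone (Fin.le_last l)).trans he
      refine Set.Subset.antisymm ?_ ?_
      · rintro _ ⟨l, rfl⟩
        have : (⟨e l, key e he l⟩ : Set.Iic ν) ∈ φ ⟨⟨k, e⟩, he⟩ := ⟨l, rfl⟩
        rw [h] at this
        exact this
      · rintro _ ⟨l, rfl⟩
        have : (⟨e' l, key e' he' l⟩ : Set.Iic ν) ∈ φ ⟨⟨k', e'⟩, he'⟩ := ⟨l, rfl⟩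
        rw [← h] at this
        exact this
    have hk : k = k' := by
      have h1 := Nat.card_range_of_injective e.injective
      have h2 := Nat.card_range_of_injective e'.injective
      rw [hr, h2] at h1
      simpa using h1.symm
    subst hk
    have : e = e' := RelEmbedding.ext fun l =>
      congrFun ((StrictMono.range_inj e.strictMono e'.strictMono).1 hr) l
    subst this
    rfl
  have := Finite.of_injective φ hφ
  exact Set.toFinite _

/-! ### Assembling the solutions over all multiindices. -/

namespace CoarseMorphism.LiftingProblem

variable {A : Type u} [TopologicalSpace A] {S : InvSystem.{u}}
variable {p : CoarseMorphism A S} {Z : InvSystem.{u}} {J : Type} [TopologicalSpace J] {GJ : Gauge J}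

theorem Solution.extends_of_forall_lt {D : p.LiftingProblem Z GJ} {d : ∀ i, D.Solution i}
    (h : ∀ i j : StrictChain Z.Idx, j.1 < i.1 → (d i).Extends (d j)) (i j : StrictChain Z.Idx) :
    (d i).Extends (d j) := by
  intro θ hθ
  have hinj : Function.Injective θ := fun a b hab =>
    j.2.injective ((hθ a).symm.trans ((congrArg i.2 hab).trans (hθ b)))
  have hle := Fintype.card_le_of_injective θ hinj
  rw [Fintype.card_fin, Fintype.card_fin] at hle
  rcases (Nat.le_of_succ_le_succ hle).eq_or_lt with hk | hk
  · obtain ⟨k, e⟩ := i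
    obtain ⟨k', e'⟩ := j
    change k' = k at hk
    subst hk
    have h1 : (θ : Fin (k' + 1) → Fin (k' + 1)) = id :=
      (StrictMono.range_inj (g := id) (θ.monotone.strictMono_of_injective hinj) strictMono_id).1
        ((Finite.surjective_of_injective hinj).range_eq.trans Set.range_id.symm)
    obtain rfl : θ = OrderHom.id := OrderHom.ext _ _ h1
    obtain rfl : e = e' := RelEmbedding.ext hθ
    have hid : ∀ t : Simplex k', stdSimplex.map (OrderHom.id : Fin (k' + 1) →o Fin (k' + 1)) t = t :=
      fun t => stdSimplex.map_id_apply t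
    refine ⟨le_rfl, Eventually.of_forall fun n => ⟨fun z t s => ?_, fun a t s r => ?_⟩⟩
    · refine (congrArg (fun t => (d ⟨k', e⟩).f n (z, (t, s))) (hid t)).trans
        (Eq.trans ?_ (Z.map_id _ _).symm)
      exact congrArg (fun z => (d ⟨k', e⟩).f n (z, (t, s))) (S.map_id _ z).symm
    · exact (congrArg (fun t => (d ⟨k', e⟩).H n ((a, (t, s)), r)) (hid t)).trans (Z.map_id _ _).symm
  · exact h i j hk θ hθ

theorem exists_solution [CompactSpace J] [T2Space J] (D : p.LiftingProblem Z GJ)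
    (hp : p.ExtensionProperty) (hZ : Z.InHPol) :
    ∃ d : ∀ i, D.Solution i, ∀ i j, (d i).Extends (d j) := by
  obtain ⟨d, hd⟩ := exists_rank_recursion (I := StrictChain Z.Idx) Sigma.fst
    (D := fun i => D.Solution i) (fun i j x y => x.Extends y) (by
      rintro ⟨m, e⟩ d hd
      obtain ⟨x, hx⟩ := D.exists_solution_step hp hZ m e
        (fun k θ => d ⟨k.1, θ.trans e⟩ k.2) fun k k' hk θ φ => hd _ _ _ _ hk
      refine ⟨x, ?_⟩
      rintro ⟨k, e'⟩ hk θ hθ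
      have hinj : Function.Injective θ := fun a b hab =>
        e'.injective ((hθ a).symm.trans ((congrArg e hab).trans (hθ b)))
      obtain ⟨ψ, hψ⟩ : ∃ ψ : Fin (k + 1) ↪o Fin (m + 1), ∀ l, ψ l = θ l :=
        ⟨OrderEmbedding.ofStrictMono θ (θ.monotone.strictMono_of_injective hinj), fun _ => rfl⟩
      obtain rfl : ψ.trans e = e' := RelEmbedding.ext fun l =>
        (congrArg e (hψ l)).trans (hθ l)
      exact hx ⟨k, hk⟩ ψ θ hθ)
  exact ⟨d, Solution.extends_of_forall_lt hd⟩

theorem h_congr (D : p.LiftingProblem Z GJ) (n : ℕ) {m : ℕ} {ν ν' : MultiIndex Z.Idx m}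
    (h : ν = ν') (x : A × (Simplex m × J)) :
    D.h n ν x = Z.map (le_of_eq (by rw [h])) (D.h n ν' x) := by
  subst h
  rw [Z.map_id]

theorem e_congr (D : p.LiftingProblem Z GJ) (n : ℕ) {m : ℕ} {ν ν' : MultiIndex Z.Idx m}
    (h : ν = ν') (x : S.obj (D.idx (ν (Fin.last m)))) (t : Simplex m × GJ.Frontier) :
    D.e n ν (x, t) = Z.map (le_of_eq (by rw [h])) (D.e n ν' (S.map (le_of_eq (by rw [h])) x, t)) := by
  subst h
  rw [Z.map_id, S.map_id]

/-- On a degenerate multiindex the solution is the one on its nondegenerate reduction, precomposed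
with the degeneracy. The index function dominates the solutions over all chains ending at or below
ν, which makes it increasing. -/
theorem exists_coherent_solution [CompactSpace J] [T2Space J] (D : p.LiftingProblem Z GJ)
    (hp : p.ExtensionProperty) (hZ : Z.InHPol) (hM : ∀ a b : Z.Idx, a ≤ b → b ≤ a → a = b) :
    ∃ (ι : Z.Idx →o S.Idx) (hι : ∀ ν, D.idx ν ≤ ι ν)
      (f : ℕ → ∀ {m : ℕ} (ν : MultiIndex Z.Idx m),
        C(S.obj (ι (ν (Fin.last m))) × (Simplex m × J), Z.obj (ν 0)))
      (H : ℕ → ∀ {m : ℕ} (ν : MultiIndex Z.Idx m),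
        C((A × (Simplex m × J)) × unitInterval, Z.obj (ν 0))),
      (∀ {m k : ℕ} (ν : MultiIndex Z.Idx m) (θ : Fin (k + 1) →o Fin (m + 1)), ∀ᶠ n in atTop,
        (∀ x t j, f n ν (x, (stdSimplex.map θ t, j)) =
          Z.map (ν.monotone (Fin.zero_le (θ 0))) (f n (ν.comp θ)
            (S.map (ι.monotone (ν.monotone (Fin.le_last (θ (Fin.last k))))) x, (t, j)))) ∧
        ∀ a t j r, H n ν ((a, (stdSimplex.map θ t, j)), r) =
          Z.map (ν.monotone (Fin.zero_le (θ 0))) (H n (ν.comp θ) ((a, (t, j)), r))) ∧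
      (∀ {m : ℕ} (ν : MultiIndex Z.Idx m), ∀ᶠ n in atTop,
        (∀ x, H n ν (x, 0) = D.h n ν x) ∧
        (∀ a x, H n ν ((a, x), 1) = f n ν (p.maps n _ a, x)) ∧
        ∀ x t (j : GJ.Frontier), f n ν (x, (t, j.1)) = D.e n ν (S.map (hι _) x, (t, j))) := by
  obtain ⟨d, hd⟩ := D.exists_solution hp hZ
  choose ub hub using fun ν => S.exists_upper_bound
    (StrictChain.finite_of_last_le Z.cofinite ν).toFinset fun i => (d i).idx
  obtain ⟨ι, hι⟩ := InvSystem.exists_orderHom_ge S Z ub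
  have hdι : ∀ i ν, i.2 (Fin.last i.1) ≤ ν → (d i).idx ≤ ι ν := fun i ν h =>
    (hub ν i (by simpa using h)).trans (hι ν)
  choose K E σ hσ hs using fun (m : ℕ) (ν : MultiIndex Z.Idx m) => exists_strictChain_factor hM ν
  let i : ∀ {m : ℕ} (_ : MultiIndex Z.Idx m), StrictChain Z.Idx := fun {m} ν => ⟨K m ν, E m ν⟩
  have h0 : ∀ {m : ℕ} (ν : MultiIndex Z.Idx m), ν 0 ≤ E m ν 0 := fun {m} ν => by
    obtain ⟨x, hx⟩ := hs m ν 0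
    have h : σ m ν 0 = 0 := le_antisymm (((σ m ν).monotone (Fin.zero_le x)).trans_eq hx)
      (Fin.zero_le _)
    exact ((hσ m ν 0).symm.trans (congrArg _ h)).le
  have hidx : ∀ {m : ℕ} (ν : MultiIndex Z.Idx m), (d (i ν)).idx ≤ ι (ν (Fin.last m)) :=
    fun {m} ν => hdι _ _ (by
      obtain ⟨x, hx⟩ := hs m ν (Fin.last _)
      change E m ν (Fin.last _) ≤ _
      rw [← hx, hσ]
      exact ν.monotone (Fin.le_last x))
  let c : ∀ {m : ℕ} (ν : MultiIndex Z.Idx m), C(Simplex m × J, Simplex (K m ν) × J) := fun {m} ν =>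
    ⟨fun x => (stdSimplex.map (σ m ν) x.1, x.2),
      ((stdSimplex.continuous_map _).comp continuous_fst).prodMk continuous_snd⟩
  let f : ℕ → ∀ {m : ℕ} (ν : MultiIndex Z.Idx m),
      C(S.obj (ι (ν (Fin.last m))) × (Simplex m × J), Z.obj (ν 0)) := fun n m ν =>
    ((Z.map (h0 ν)).comp ((d (i ν)).f n)).comp ((S.map (hidx ν)).prodMap (c ν))
  let H : ℕ → ∀ {m : ℕ} (ν : MultiIndex Z.Idx m),
      C((A × (Simplex m × J)) × unitInterval, Z.obj (ν 0)) := fun n m ν =>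
    ((Z.map (h0 ν)).comp ((d (i ν)).H n)).comp
      (((ContinuousMap.id A).prodMap (c ν)).prodMap (ContinuousMap.id _))
  have hι' : ∀ ν, D.idx ν ≤ ι ν := fun ν => by
    let e : Fin 1 ↪o Z.Idx := OrderEmbedding.ofStrictMono (fun _ => ν)
      fun a b h => absurd h (by rw [Subsingleton.elim a b]; exact lt_irrefl _)
    exact (d ⟨0, e⟩).le.trans (hdι ⟨0, e⟩ ν le_rfl)
  refine ⟨ι, hι', f, H, fun {m k} ν θ => ?_, fun {m} ν => ?_⟩
  -- A monotone θ induces an injective map between the reductions of νθ and ν, and coherence along θ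
  -- reduces to `Extends` along that map.
  · obtain ⟨θ', hθ'⟩ := exists_orderHom_lift (E m ν) (E k (ν.comp θ)).toOrderHom fun l => by
      obtain ⟨y, rfl⟩ := hs k (ν.comp θ) l
      exact ⟨σ m ν (θ y), (hσ m ν (θ y)).trans (hσ k (ν.comp θ) y).symm⟩
    have hcomp : (σ m ν).comp θ = θ'.comp (σ k (ν.comp θ)) := OrderHom.ext _ _ (funext fun y =>
      (E m ν).injective ((hσ m ν (θ y)).trans
        ((hσ k (ν.comp θ) y).symm.trans (hθ' (σ k (ν.comp θ) y)).symm)))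
    have hmap : ∀ t : Simplex k, stdSimplex.map (S := ℝ) (σ m ν) (stdSimplex.map θ t) =
        stdSimplex.map θ' (stdSimplex.map (σ k (ν.comp θ)) t) := fun t => by
      rw [← simplex_map_comp, hcomp, simplex_map_comp]
    obtain ⟨hle, hd'⟩ := hd (i ν) (i (ν.comp θ)) θ' hθ'
    filter_upwards [hd'] with n hn
    refine ⟨fun x t j => ?_, fun a t j r => ?_⟩
    · refine (congrArg (fun s => Z.map (h0 ν) ((d (i ν)).f n (S.map (hidx ν) x, (s, j))))
        (hmap t)).trans ((congrArg _ (hn.1 _ _ j)).trans ((Z.map_comp _ _ _).trans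
          (Eq.trans ?_ (Z.map_comp _ _ _).symm)))
      exact congrArg (fun z => Z.map _ ((d (i (ν.comp θ))).f n
        (z, (stdSimplex.map (σ k (ν.comp θ)) t, j)))) ((S.map_comp _ _ _).trans
          (S.map_comp _ _ _).symm)
    · exact (congrArg (fun s => Z.map (h0 ν) ((d (i ν)).H n ((a, (s, j)), r)))
        (hmap t)).trans ((congrArg _ (hn.2 a _ j r)).trans ((Z.map_comp _ _ _).trans
          (Z.map_comp _ _ _).symm))
  · have hν : (E m ν).toOrderHom.comp (σ m ν) = ν := OrderHom.ext _ _ (funext (hσ m ν))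
    filter_upwards [(d (i ν)).H_zero, (d (i ν)).H_one, (d (i ν)).f_frontier,
      D.h_coh (E m ν).toOrderHom (σ m ν), D.e_coh (E m ν).toOrderHom (σ m ν), p.comm (hidx ν)]
      with n h1 h2 h3 h4 h5 h6
    refine ⟨fun x => ?_, fun a x => ?_, fun x t j => ?_⟩
    · refine (congrArg (Z.map (h0 ν)) (h1 _)).trans ((congrArg (Z.map (h0 ν)) (h4 _ _ _)).trans ?_)
      exact (Z.map_comp _ _ _).trans (D.h_congr n hν.symm x).symm
    · refine (congrArg (Z.map (h0 ν)) (h2 a _)).trans ?_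
      exact congrArg (fun z => Z.map (h0 ν) ((d (i ν)).f n (z, c ν x))) (h6 a).symm
    · refine (congrArg (Z.map (h0 ν)) (h3 _ _ j)).trans ((congrArg (Z.map (h0 ν)) (h5 _ _ _)).trans ?_)
      refine (Z.map_comp _ _ _).trans (Eq.trans ?_ (D.e_congr n hν.symm _ _).symm)
      refine congrArg (fun z => Z.map _ (D.e n ((E m ν).toOrderHom.comp (σ m ν)) (z, (t, j)))) ?_
      exact (congrArg _ (S.map_comp _ _ _)).trans ((S.map_comp _ _ _).trans (S.map_comp _ _ _).symm)

end CoarseMorphism.LiftingProblem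

/-! ### The universal property for systems over partially ordered sets -/

namespace CoarseMorphism.ExtensionProperty

variable {A : Type u} [TopologicalSpace A] {S : InvSystem.{u}} {p : CoarseMorphism A S}
  {Z : InvSystem.{u}}

/-- Here J is a point with empty frontier, so nothing is prescribed, and H is the required coherent
homotopy. -/
theorem exists_pull_homotopic (hp : p.ExtensionProperty) (hZ : Z.InHPol)
    (hM : ∀ a b : Z.Idx, a ≤ b → b ≤ a → a = b)
    (h : CoarseCoherentMap (InvSystem.rudimentary A) Z) :
    ∃ f : CoarseCoherentMap S Z, h.Homotopic (p.pull f) := by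
  let i₀ : S.Idx := S.nonempty.some
  have hF : IsEmpty (Gauge.trivial Unit).Frontier := ⟨fun j => zero_ne_one j.2⟩
  have : ∀ m, IsEmpty (S.obj i₀ × (Simplex m × (Gauge.trivial Unit).Frontier)) :=
    fun m => ⟨fun x => hF.false x.2.2⟩
  let D : p.LiftingProblem Z (Gauge.trivial Unit) :=
    { h := fun n m ν => (h.maps n ν).comp ⟨fun x => (x.1, x.2.1), by fun_prop⟩
      idx := ⟨fun _ => i₀, fun _ _ _ => le_rfl⟩
      e := fun n m ν => ⟨fun x => (hF.false x.2.2).elim, continuous_of_discreteTopology⟩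
      h_coh := fun ν θ => (h.cohAt ν θ).mono fun n hn a t _ => hn a t
      e_coh := fun ν θ => Eventually.of_forall fun n x t j => (hF.false j).elim
      h_frontier := fun ν => Eventually.of_forall fun n a t j => (hF.false j).elim }
  obtain ⟨ι, _, f, H, hc, hH⟩ := D.exists_coherent_solution hp hZ hM
  let f' : CoarseCoherentMap S Z := CoarseCoherentMap.ofCohAt ι
    (fun n m ν => (f n ν).comp ⟨fun x => (x.1, (x.2, ())), by fun_prop⟩)
    fun ν θ => (hc ν θ).mono fun n hn x t => hn.1 x t ()
  let F : CoarseCoherentMap (InvSystem.rudimentary A).cylinder Z :=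
    CoarseCoherentMap.ofCohAt ⟨fun _ => PUnit.unit, fun _ _ _ => le_rfl⟩
      (fun n m ν => (H n ν).comp
        (⟨fun x => ((x.1.1, (x.2, ())), x.1.2), by fun_prop⟩ :
          C((A × unitInterval) × Simplex m, (A × (Simplex m × Unit)) × unitInterval)))
      fun ν θ => (hc ν θ).mono fun n hn x t => hn.2 x.1 t () x.2
  refine ⟨f', F, fun _ => le_rfl, fun _ => le_rfl, fun {m} ν => ?_⟩
  filter_upwards [hH ν] with n hn x t
  exact ⟨hn.1 (x, (t, ())), hn.2.1 x (t, ())⟩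

/-- Here J is the interval: the homotopy over A is the map to be factored, and f and f' prescribe
the values at the end points. The factorization g is itself the homotopy from f to f'. -/
theorem homotopic_of_pull (hp : p.ExtensionProperty) (hZ : Z.InHPol)
    (hM : ∀ a b : Z.Idx, a ≤ b → b ≤ a → a = b) {f f' : CoarseCoherentMap S Z}
    (h : (p.pull f).Homotopic (p.pull f')) : f.Homotopic f' := by
  obtain ⟨F, _, _, hF⟩ := h
  choose b hb hb' using fun ν => S.directed (f.idx ν) (f'.idx ν)
  obtain ⟨ε, hε⟩ := InvSystem.exists_orderHom_ge S Z b
  have h1 : ∀ ν, f.idx ν ≤ ε ν := fun ν => (hb ν).trans (hε ν)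
  have h2 : ∀ ν, f'.idx ν ≤ ε ν := fun ν => (hb' ν).trans (hε ν)
  have hfr : ∀ j : Gauge.interval.Frontier, j.1 = 0 ∨ j.1 = 1 := fun j =>
    (Gauge.interval_eq_one_iff j.1).1 j.2
  have he : ∀ n {m : ℕ} (ν : MultiIndex Z.Idx m), ∃ e : C(S.obj (ε (ν (Fin.last m))) ×
      (Simplex m × Gauge.interval.Frontier), Z.obj (ν 0)), ∀ x t j,
      (j.1 = 0 → e (x, (t, j)) = f.maps n ν (S.map (h1 _) x, t)) ∧
      (j.1 = 1 → e (x, (t, j)) = f'.maps n ν (S.map (h2 _) x, t)) := by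
    intro n m ν
    obtain ⟨e, he⟩ := exists_glue (ι := Bool)
      (W := S.obj (ε (ν (Fin.last m))) × (Simplex m × Gauge.interval.Frontier))
      (fun i => bif i then {w | w.2.2.1 = 1} else {w | w.2.2.1 = 0})
      (fun i => by
        cases i
        · exact isClosed_eq (by fun_prop) continuous_const
        · exact isClosed_eq (by fun_prop) continuous_const)
      (fun w => (hfr w.2.2).elim (fun h => ⟨false, h⟩) fun h => ⟨true, h⟩)
      (fun i => match i with
        | true => (f'.maps n ν).comp ⟨fun w => (S.map (h2 _) w.1.1, w.1.2.1), by fun_prop⟩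
        | false => (f.maps n ν).comp ⟨fun w => (S.map (h1 _) w.1.1, w.1.2.1), by fun_prop⟩)
      (fun i j w hi hj => by
        cases i <;> cases j
        · rfl
        · exact absurd (Eq.trans (Eq.symm hi) hj) zero_ne_one
        · exact absurd (Eq.trans (Eq.symm hj) hi) zero_ne_one
        · rfl)
    exact ⟨e, fun x t j => ⟨fun h => he false (x, (t, j)) h, fun h => he true (x, (t, j)) h⟩⟩
  choose e he using he
  let D : p.LiftingProblem Z Gauge.interval :=
    { h := fun n m ν => (F.maps n ν).comp (⟨fun x => ((x.1, x.2.2), x.2.1), by fun_prop⟩ :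
        C(A × (Simplex m × unitInterval), (A × unitInterval) × Simplex m))
      idx := ε
      e := fun n m ν => e n ν
      h_coh := fun ν θ => (F.cohAt ν θ).mono fun n hn a t j => hn (a, j) t
      e_coh := fun ν θ => by
        filter_upwards [f.cohAt ν θ, f'.cohAt ν θ] with n hn hn' x t j
        rcases hfr j with h | h
        · refine ((he n ν x _ j).1 h).trans ((hn _ t).trans ?_)
          refine congrArg _ (Eq.trans ?_ ((he n (ν.comp θ) _ t j).1 h).symm)
          exact congrArg (fun z => f.maps n (ν.comp θ) (z, t))
            ((S.map_comp _ _ _).trans (S.map_comp _ _ _).symm)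
        · refine ((he n ν x _ j).2 h).trans ((hn' _ t).trans ?_)
          refine congrArg _ (Eq.trans ?_ ((he n (ν.comp θ) _ t j).2 h).symm)
          exact congrArg (fun z => f'.maps n (ν.comp θ) (z, t))
            ((S.map_comp _ _ _).trans (S.map_comp _ _ _).symm)
      h_frontier := fun {m} ν => by
        filter_upwards [hF ν, p.comm (h1 (ν (Fin.last m))), p.comm (h2 (ν (Fin.last m)))]
          with n hn c1 c2 a t j
        rcases hfr j with h | h
        · refine Eq.trans ?_ ((he n ν _ t j).1 h).symm
          refine (congrArg (fun s => F.maps n ν ((a, s), t)) h).trans ((hn a t).1.trans ?_)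
          exact congrArg (fun z => f.maps n ν (z, t)) (c1 a).symm
        · refine Eq.trans ?_ ((he n ν _ t j).2 h).symm
          refine (congrArg (fun s => F.maps n ν ((a, s), t)) h).trans ((hn a t).2.trans ?_)
          exact congrArg (fun z => f'.maps n ν (z, t)) (c2 a).symm }
  obtain ⟨ι, hι, g, _, hc, hH⟩ := D.exists_coherent_solution hp hZ hM
  refine ⟨CoarseCoherentMap.ofCohAt (X := S.cylinder) ι
    (fun n m ν => (g n ν).comp (⟨fun x => (x.1.1, (x.2, x.1.2)), by fun_prop⟩ :
      C((S.obj (ι (ν (Fin.last m))) × unitInterval) × Simplex m,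
        S.obj (ι (ν (Fin.last m))) × (Simplex m × unitInterval))))
    fun ν θ => (hc ν θ).mono fun n hn x t => hn.1 x.1 t x.2,
    fun ν => (h1 ν).trans (hι ν), fun ν => (h2 ν).trans (hι ν), fun {m} ν => ?_⟩
  have z0 : Gauge.interval.g 0 = 1 := (Gauge.interval_eq_one_iff 0).2 (Or.inl rfl)
  have z1 : Gauge.interval.g 1 = 1 := (Gauge.interval_eq_one_iff 1).2 (Or.inr rfl)
  filter_upwards [hH ν] with n hn x t
  constructor
  · refine (hn.2.2 x t ⟨0, z0⟩).trans (((he n ν _ t ⟨0, z0⟩).1 rfl).trans ?_)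
    exact congrArg (fun z => f.maps n ν (z, t)) (S.map_comp _ _ _)
  · refine (hn.2.2 x t ⟨1, z1⟩).trans (((he n ν _ t ⟨1, z1⟩).2 rfl).trans ?_)
    exact congrArg (fun z => f'.maps n ν (z, t)) (S.map_comp _ _ _)

end CoarseMorphism.ExtensionProperty

/-! ### Reindexing over a partially ordered set -/

namespace InvSystem

/-- The system obtained by choosing one index from each class of equivalent indices. -/
noncomputable abbrev antisymm (Z : InvSystem.{u}) : InvSystem.{u} where
  Idx := Antisymmetrization Z.Idx (· ≤ ·)
  nonempty := Z.nonempty.map (toAntisymmetrization (· ≤ ·))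
  directed i j := by
    obtain ⟨k, h1, h2⟩ := Z.directed (ofAntisymmetrization (· ≤ ·) i)
      (ofAntisymmetrization (· ≤ ·) j)
    refine ⟨toAntisymmetrization (· ≤ ·) k, ?_, ?_⟩
    · rw [← toAntisymmetrization_ofAntisymmetrization (· ≤ ·) i]
      exact toAntisymmetrization_mono h1
    · rw [← toAntisymmetrization_ofAntisymmetrization (· ≤ ·) j]
      exact toAntisymmetrization_mono h2
  cofinite i := by
    refine Set.Finite.of_finite_image ((Z.cofinite (ofAntisymmetrization (· ≤ ·) i)).subset ?_)
      (f := ofAntisymmetrization (· ≤ ·)) fun a _ b _ h => ?_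
    · rintro _ ⟨j, hj, rfl⟩
      exact ofAntisymmetrization_le_ofAntisymmetrization_iff.2 hj
    · rw [← toAntisymmetrization_ofAntisymmetrization (· ≤ ·) a, h,
        toAntisymmetrization_ofAntisymmetrization]
  obj i := Z.obj (ofAntisymmetrization (· ≤ ·) i)
  map h := Z.map (ofAntisymmetrization_le_ofAntisymmetrization_iff.2 h)
  map_id i x := Z.map_id _ x
  map_comp _ _ x := Z.map_comp _ _ x

variable (Z : InvSystem.{u})

/-- The class of an index. -/
def cls : Z.Idx →o Z.antisymm.Idx := ⟨toAntisymmetrization (· ≤ ·), toAntisymmetrization_mono⟩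

/-- The representative of a class. -/
noncomputable def rep : Z.antisymm.Idx →o Z.Idx :=
  ⟨ofAntisymmetrization (· ≤ ·), fun _ _ h => ofAntisymmetrization_le_ofAntisymmetrization_iff.2 h⟩

theorem rep_cls_le (i : Z.Idx) : Z.rep (Z.cls i) ≤ i :=
  toAntisymmetrization_le_toAntisymmetrization_iff.1
    (toAntisymmetrization_ofAntisymmetrization (· ≤ ·) (Z.cls i)).le

theorem le_rep_cls (i : Z.Idx) : i ≤ Z.rep (Z.cls i) :=
  toAntisymmetrization_le_toAntisymmetrization_iff.1
    (toAntisymmetrization_ofAntisymmetrization (· ≤ ·) (Z.cls i)).ge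

end InvSystem

/-! ### Splitting of simplices -/

section Split

/-- The coordinates below the threshold `c` of the distribution function. -/
def lowerPart {m : ℕ} (c : ℝ) (t : Simplex m) (l : Fin (m + 1)) : ℝ :=
  min (partialSum t (l.1 + 1)) c - min (partialSum t l.1) c

theorem lowerPart_nonneg {m : ℕ} (c : ℝ) (t : Simplex m) (l : Fin (m + 1)) :
    0 ≤ lowerPart c t l :=
  sub_nonneg.2 (min_le_min_right c (partialSum_mono t (Nat.le_succ _)))

theorem lowerPart_le {m : ℕ} (c : ℝ) (t : Simplex m) (l : Fin (m + 1)) :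
    lowerPart c t l ≤ t.1 l := by
  have h := partialSum_succ t l
  have h0 := t.2.1 l
  rw [lowerPart, h]
  rcases le_total (partialSum t l.1 + t.1 l) c with h1 | h1 <;>
    rcases le_total (partialSum t l.1) c with h2 | h2 <;>
    simp only [min_eq_left, min_eq_right, h1, h2] <;> linarith

theorem lt_of_lowerPart_ne_zero {m : ℕ} {c : ℝ} {t : Simplex m} {l : Fin (m + 1)}
    (h : lowerPart c t l ≠ 0) : partialSum t l.1 < c := by
  by_contra! h1
  refine h ?_
  rw [lowerPart, min_eq_right h1, min_eq_right (h1.trans (partialSum_mono t (Nat.le_succ _))),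
    sub_self]

theorem lt_of_lowerPart_ne {m : ℕ} {c : ℝ} {t : Simplex m} {l : Fin (m + 1)}
    (h : t.1 l - lowerPart c t l ≠ 0) : c < partialSum t (l.1 + 1) := by
  by_contra! h1
  refine h ?_
  rw [lowerPart, min_eq_left h1, min_eq_left ((partialSum_mono t (Nat.le_succ _)).trans h1),
    partialSum_succ]
  ring

/-- The lower part consists of the increments of the distribution function truncated at c. For c ≥ 0
truncation fixes 0, and the increments over a fibre of θ telescope. -/
theorem lowerPart_map {k m : ℕ} {c : ℝ} (hc : 0 ≤ c) (θ : Fin (k + 1) →o Fin (m + 1))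
    (t : Simplex k) :
    lowerPart c (stdSimplex.map θ t) = FunOnFinite.linearMap ℝ ℝ θ (lowerPart c t) := by
  have h0 : (fun r : ℝ => min r c) 0 = 0 := min_eq_left hc
  funext j
  rw [FunOnFinite.linearMap_apply_apply, Finset.sum_filter]
  obtain ⟨i, hi, h1, h2⟩ := exists_partialSum_map θ j.1
  obtain ⟨i', hi', h1', h2'⟩ := exists_partialSum_map θ (j.1 + 1)
  have e := sum_sub_partialSum t (fun r : ℝ => min r c) h0 i hi
  have e' := sum_sub_partialSum t (fun r : ℝ => min r c) h0 i' hi'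
  rw [lowerPart, h2, h2', ← e, ← e', ← Finset.sum_sub_distrib]
  refine Finset.sum_congr rfl fun l _ => ?_
  have k1 := h1 l
  have k2 := h1' l
  rcases lt_trichotomy (θ l) j with h | h | h
  · have h' : θ l ≠ j := h.ne
    have : (θ l).1 < j.1 := h
    rw [if_pos (k1.1 this), if_pos (k2.1 (this.trans (Nat.lt_succ_self _))), if_neg h', sub_self]
  · have n1 : ¬ l.1 < i := fun h' => by
      have := k1.2 h'
      rw [h] at this
      exact lt_irrefl _ this
    have n2 : l.1 < i' := k2.1 (by rw [h]; exact Nat.lt_succ_self _)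
    rw [if_neg n1, if_pos n2, if_pos h, sub_zero]
    rfl
  · have h' : θ l ≠ j := h.ne'
    have h3 : j.1 < (θ l).1 := h
    have n1 : ¬ l.1 < i := fun h' => by
      have := k1.2 h'
      omega
    have n2 : ¬ l.1 < i' := fun h' => by
      have := k2.2 h'
      omega
    rw [if_neg n1, if_neg n2, if_neg h', sub_self]

/-- The map `l ↦ 2l + b`. -/
def interleave {m : ℕ} (b : Fin 2) : Fin (m + 1) →o Fin (2 * m + 1 + 1) where
  toFun l := ⟨2 * l.1 + b.1, by omega⟩
  monotone' _ _ h := Fin.le_def.2 (Nat.add_le_add_right (Nat.mul_le_mul_left 2 h) _)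

/-- The index half. -/
def halfIdx {m : ℕ} (l : Fin (2 * m + 1 + 1)) : Fin (m + 1) := ⟨l.1 / 2, by omega⟩

/-- The map `2l + b ↦ 2θ(l) + b`. -/
def doubleMap {k m : ℕ} (θ : Fin (k + 1) → Fin (m + 1)) (l : Fin (2 * k + 1 + 1)) :
    Fin (2 * m + 1 + 1) := ⟨2 * (θ (halfIdx l)).1 + l.1 % 2, by omega⟩

theorem halfIdx_interleave {m : ℕ} (b : Fin 2) (l : Fin (m + 1)) :
    halfIdx (interleave b l) = l := Fin.ext (by change (2 * l.1 + b.1) / 2 = l.1; omega)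

theorem doubleMap_interleave {k m : ℕ} (θ : Fin (k + 1) → Fin (m + 1)) (b : Fin 2)
    (l : Fin (k + 1)) : doubleMap θ (interleave b l) = interleave b (θ l) := by
  refine Fin.ext ?_
  change 2 * (θ (halfIdx (interleave b l))).1 + (2 * l.1 + b.1) % 2 = 2 * (θ l).1 + b.1
  rw [halfIdx_interleave]
  omega

theorem linearMap_interleave_val {m : ℕ} (b : Fin 2) (v : Fin (m + 1) → ℝ)
    (j : Fin (2 * m + 1 + 1)) :
    FunOnFinite.linearMap ℝ ℝ (interleave b : Fin (m + 1) → Fin (2 * m + 1 + 1)) v j =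
      if j.1 % 2 = b.1 then v (halfIdx j) else 0 := by
  rw [FunOnFinite.linearMap_apply_apply, Finset.sum_filter]
  have : ∀ l : Fin (m + 1), interleave b l = j ↔ l = halfIdx j ∧ j.1 % 2 = b.1 := fun l => by
    rw [Fin.ext_iff, Fin.ext_iff]
    change 2 * l.1 + b.1 = j.1 ↔ l.1 = j.1 / 2 ∧ j.1 % 2 = b.1
    omega
  simp only [this]
  split_ifs with h
  · simp [h]
  · simp [h]

theorem sum_linearMap {k m : ℕ} (φ : Fin k → Fin m) (v : Fin k → ℝ) :
    ∑ j, FunOnFinite.linearMap ℝ ℝ φ v j = ∑ l, v l := by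
  simp only [FunOnFinite.linearMap_apply_apply]
  exact Finset.sum_fiberwise _ _ _

/-- The point of the doubled simplex whose lower part is put on the even vertices and whose upper
part is put on the odd vertices. -/
noncomputable def splitSimplex {m : ℕ} (c : unitInterval) (t : Simplex m) : Simplex (2 * m + 1) :=
  ⟨FunOnFinite.linearMap ℝ ℝ (interleave 0) (lowerPart c t) +
    FunOnFinite.linearMap ℝ ℝ (interleave 1) (t.1 - lowerPart c t), by
    constructor
    · intro j
      refine add_nonneg ?_ ?_
      · rw [linearMap_interleave_val]
        split_ifs
        · exact lowerPart_nonneg _ _ _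
        · exact le_rfl
      · rw [linearMap_interleave_val]
        split_ifs
        · exact sub_nonneg.2 (lowerPart_le _ _ _)
        · exact le_rfl
    · simp only [Pi.add_apply]
      rw [Finset.sum_add_distrib, sum_linearMap, sum_linearMap, ← Finset.sum_add_distrib]
      simp only [Pi.sub_apply, add_sub_cancel]
      exact t.2.2⟩

theorem splitSimplex_map {k m : ℕ} (c : unitInterval) (θ : Fin (k + 1) →o Fin (m + 1))
    (t : Simplex k) :
    splitSimplex c (stdSimplex.map θ t) = stdSimplex.map (doubleMap θ) (splitSimplex c t) := by
  refine Subtype.ext ?_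
  have hb : ∀ (b : Fin 2) (v : Fin (k + 1) → ℝ),
      FunOnFinite.linearMap ℝ ℝ (interleave b : Fin (m + 1) → _) (FunOnFinite.linearMap ℝ ℝ θ v) =
        FunOnFinite.linearMap ℝ ℝ (doubleMap θ)
          (FunOnFinite.linearMap ℝ ℝ (interleave b : Fin (k + 1) → _) v) := fun b v => by
    have h : (interleave b : Fin (m + 1) → Fin (2 * m + 1 + 1)) ∘ θ =
        doubleMap θ ∘ (interleave b : Fin (k + 1) → _) :=
      funext fun l => (doubleMap_interleave θ b l).symm
    have h1 := FunOnFinite.linearMap_comp ℝ ℝ (⇑θ) (interleave b : Fin (m + 1) → Fin (2 * m + 1 + 1))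
    have h2 := FunOnFinite.linearMap_comp ℝ ℝ (interleave b : Fin (k + 1) → _) (doubleMap θ)
    rw [h, h2] at h1
    exact (LinearMap.congr_fun h1 v).symm
  have ht : (stdSimplex.map θ t).1 = FunOnFinite.linearMap ℝ ℝ θ t.1 := rfl
  change FunOnFinite.linearMap ℝ ℝ (interleave 0) (lowerPart c (stdSimplex.map θ t)) +
    FunOnFinite.linearMap ℝ ℝ (interleave 1) ((stdSimplex.map θ t).1 -
      lowerPart c (stdSimplex.map θ t)) =
    FunOnFinite.linearMap ℝ ℝ (doubleMap θ)
      (FunOnFinite.linearMap ℝ ℝ (interleave 0) (lowerPart c t) +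
        FunOnFinite.linearMap ℝ ℝ (interleave 1) (t.1 - lowerPart c t))
  rw [lowerPart_map c.2.1, ht, ← map_sub, hb, hb, map_add]

theorem splitSimplex_one {m : ℕ} (t : Simplex m) :
    splitSimplex 1 t = stdSimplex.map (interleave 0) t := by
  have h : lowerPart ((1 : unitInterval) : ℝ) t = t.1 := funext fun l => by
    have h1 : ∀ j ≤ m + 1, partialSum t j ≤ ((1 : unitInterval) : ℝ) := fun j hj =>
      (partialSum_mono t hj).trans_eq (partialSum_top t)
    rw [lowerPart, min_eq_left (h1 _ l.2), min_eq_left (h1 _ l.2.le), partialSum_succ]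
    ring
  refine Subtype.ext ?_
  change FunOnFinite.linearMap ℝ ℝ (interleave 0) (lowerPart _ t) +
    FunOnFinite.linearMap ℝ ℝ (interleave 1) (t.1 - lowerPart _ t) = _
  rw [h, sub_self, map_zero, add_zero]
  rfl

theorem splitSimplex_zero {m : ℕ} (t : Simplex m) :
    splitSimplex 0 t = stdSimplex.map (interleave 1) t := by
  have h : lowerPart ((0 : unitInterval) : ℝ) t = 0 := funext fun l => by
    have h1 : ∀ j, ((0 : unitInterval) : ℝ) ≤ partialSum t j := fun j =>
      (partialSum_zero t).ge.trans (partialSum_mono t (Nat.zero_le j))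
    rw [lowerPart, min_eq_right (h1 _), min_eq_right (h1 _), sub_self]
    rfl
  refine Subtype.ext ?_
  change FunOnFinite.linearMap ℝ ℝ (interleave 0) (lowerPart _ t) +
    FunOnFinite.linearMap ℝ ℝ (interleave 1) (t.1 - lowerPart _ t) = _
  rw [h, sub_zero, map_zero, zero_add]
  rfl

theorem continuous_splitSimplex {m : ℕ} :
    Continuous fun x : unitInterval × Simplex m => splitSimplex x.1 x.2 := by
  have hu : Continuous fun x : unitInterval × Simplex m => lowerPart x.1 x.2 :=
    continuous_pi fun l =>
      (((continuous_partialSum _).comp continuous_snd).min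
        (continuous_subtype_val.comp continuous_fst)).sub
      (((continuous_partialSum _).comp continuous_snd).min
        (continuous_subtype_val.comp continuous_fst))
  refine Continuous.subtype_mk (((FunOnFinite.continuous_linearMap ℝ ℝ _).comp hu).add
    ((FunOnFinite.continuous_linearMap ℝ ℝ _).comp (Continuous.sub ?_ hu))) _
  exact continuous_subtype_val.comp continuous_snd

/-- On the support of a split point, all doubled maps are monotone. -/
theorem exists_splitSimplex_eq {m : ℕ} (c : unitInterval) (t : Simplex m) :
    ∃ (k : Fin (2 * m + 1 + 1)) (φ : Fin (k.1 + 1) ↪o Fin (2 * m + 1 + 1)) (t' : Simplex k.1),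
      stdSimplex.map φ t' = splitSimplex c t ∧
      ∀ {n : ℕ} (θ : Fin (m + 1) →o Fin (n + 1)), Monotone (doubleMap θ ∘ φ) := by
  obtain ⟨k, φ, t', ht', hφ⟩ := exists_simplex_support (splitSimplex c t)
  have hk : k < 2 * m + 1 + 1 := by
    have h1 := Fintype.card_le_of_injective φ φ.injective
    rw [Fintype.card_fin, Fintype.card_fin] at h1
    omega
  refine ⟨⟨k, hk⟩, φ, t', ht', fun {n} θ a b hab => ?_⟩
  have hab' : (φ a).1 ≤ (φ b).1 := φ.monotone hab
  have hval : ∀ j, (splitSimplex c t).1 j = (if j.1 % 2 = 0 then lowerPart c t (halfIdx j) else 0) +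
      if j.1 % 2 = 1 then t.1 (halfIdx j) - lowerPart c t (halfIdx j) else 0 := fun j =>
    congrArg₂ (· + ·) (linearMap_interleave_val 0 _ j) (linearMap_interleave_val 1 _ j)
  have hθ : (halfIdx (φ a)).1 ≤ (halfIdx (φ b)).1 → (θ (halfIdx (φ a))).1 ≤ (θ (halfIdx (φ b))).1 :=
    fun h => θ.monotone h
  have ha2 : (halfIdx (φ a)).1 = (φ a).1 / 2 := rfl
  have hb2 : (halfIdx (φ b)).1 = (φ b).1 / 2 := rfl
  refine Fin.le_def.2 ?_
  change 2 * (θ (halfIdx (φ a))).1 + (φ a).1 % 2 ≤ 2 * (θ (halfIdx (φ b))).1 + (φ b).1 % 2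
  by_cases h : (φ a).1 % 2 = 1 ∧ (φ b).1 % 2 = 0
  -- Odd vertices in the support carry mass above level c and even ones mass below it. So an odd
  -- vertex 2l + 1 cannot precede an even vertex 2l' with l < l', the only configuration in which
  -- the doubled map could fail to be monotone.
  · have h1 := hφ a
    have h2 := hφ b
    rw [hval, if_neg (by omega), if_pos h.1, zero_add] at h1
    rw [hval, if_pos h.2, if_neg (by omega), add_zero] at h2
    have h3 := lt_of_lowerPart_ne h1
    have h4 := lt_of_lowerPart_ne_zero h2
    have h5 : (halfIdx (φ a)).1 + 1 ≤ (halfIdx (φ b)).1 := by omega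
    exact absurd (partialSum_mono t h5) (not_le.2 (h4.trans h3))
  · have := hθ (by omega)
    omega

end Split

/-! ### Passage to representatives of equivalent indices and back. -/

namespace CoarseCoherentMap

variable {X Z : InvSystem.{u}}

/-- Restriction of a coherent mapping to representatives. -/
noncomputable def toAntisymm (f : CoarseCoherentMap X Z) : CoarseCoherentMap X Z.antisymm :=
  ofCohAt (Y := Z.antisymm) (f.idx.comp Z.rep) (fun n _ ν => f.maps n (Z.rep.comp ν))
    fun ν θ => f.cohAt (Z.rep.comp ν) θ

/-- Extension of a coherent mapping from representatives. -/
noncomputable def ofAntisymm (f : CoarseCoherentMap X Z.antisymm) : CoarseCoherentMap X Z :=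
  ofCohAt (f.idx.comp Z.cls)
    (fun n _ ν => (Z.map (Z.le_rep_cls (ν 0))).comp (f.maps n (Z.cls.comp ν))) fun ν θ => by
      filter_upwards [f.cohAt (Z.cls.comp ν) θ] with n hn x t
      exact (congrArg (Z.map (Z.le_rep_cls (ν 0))) (hn x t)).trans
        ((Z.map_comp _ _ _).trans (Z.map_comp _ _ _).symm)

theorem Homotopic.toAntisymm {f f' : CoarseCoherentMap X Z} (h : f.Homotopic f') :
    f.toAntisymm.Homotopic f'.toAntisymm := by
  obtain ⟨F, h1, h2, hF⟩ := h
  exact ⟨F.toAntisymm, fun _ => h1 _, fun _ => h2 _, fun ν => hF (Z.rep.comp ν)⟩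

theorem Homotopic.ofAntisymm {f f' : CoarseCoherentMap X Z.antisymm} (h : f.Homotopic f') :
    f.ofAntisymm.Homotopic f'.ofAntisymm := by
  obtain ⟨F, h1, h2, hF⟩ := h
  refine ⟨F.ofAntisymm, fun _ => h1 _, fun _ => h2 _, fun ν => ?_⟩
  filter_upwards [hF (Z.cls.comp ν)] with n hn x t
  exact ⟨congrArg (Z.map (Z.le_rep_cls (ν 0))) (hn x t).1,
    congrArg (Z.map (Z.le_rep_cls (ν 0))) (hn x t).2⟩

/-- The multiindex `ν₀, rν₀, ν₁, rν₁, …`, where `r` takes representatives. -/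
noncomputable def interleaveRep (Z : InvSystem.{u}) {m : ℕ} (ν : MultiIndex Z.Idx m) :
    MultiIndex Z.Idx (2 * m + 1) where
  toFun l := if l.1 % 2 = 0 then ν (halfIdx l) else Z.rep (Z.cls (ν (halfIdx l)))
  monotone' a b h := by
    have h1 : ν (halfIdx a) ≤ ν (halfIdx b) :=
      ν.monotone (Fin.le_def.2 (Nat.div_le_div_right (Fin.le_def.1 h)))
    have h2 := Z.rep_cls_le (ν (halfIdx a))
    have h3 := Z.le_rep_cls (ν (halfIdx b))
    change (if a.1 % 2 = 0 then _ else _) ≤ if b.1 % 2 = 0 then _ else _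
    split_ifs
    · exact h1
    · exact h1.trans h3
    · exact h2.trans h1
    · exact (h2.trans h1).trans h3

theorem interleaveRep_doubleMap {m k : ℕ} (ν : MultiIndex Z.Idx m) (θ : Fin (k + 1) →o Fin (m + 1))
    (l : Fin (2 * k + 1 + 1)) :
    interleaveRep Z ν (doubleMap θ l) = interleaveRep Z (ν.comp θ) l := by
  have h1 : (doubleMap θ l).1 % 2 = l.1 % 2 := by
    change (2 * (θ (halfIdx l)).1 + l.1 % 2) % 2 = _
    omega
  have h2 : halfIdx (doubleMap θ l) = θ (halfIdx l) := Fin.ext (by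
    change (2 * (θ (halfIdx l)).1 + l.1 % 2) / 2 = _
    omega)
  change (if (doubleMap θ l).1 % 2 = 0 then _ else _) = if l.1 % 2 = 0 then _ else _
  rw [h1, h2]
  rfl

theorem interleaveRep_zero {m : ℕ} (ν : MultiIndex Z.Idx m) :
    (interleaveRep Z ν).comp (interleave 0) = ν := OrderHom.ext _ _ (funext fun l => by
  change (if (interleave 0 l).1 % 2 = 0 then ν (halfIdx (interleave 0 l)) else _) = _
  rw [if_pos (by change (2 * l.1 + 0) % 2 = 0; omega), halfIdx_interleave])

theorem interleaveRep_one {m : ℕ} (ν : MultiIndex Z.Idx m) :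
    (interleaveRep Z ν).comp (interleave 1) = Z.rep.comp (Z.cls.comp ν) :=
  OrderHom.ext _ _ (funext fun l => by
    change (if (interleave 1 l).1 % 2 = 0 then _ else Z.rep (Z.cls (ν (halfIdx (interleave 1 l)))))
      = _
    rw [if_neg (by change ¬ (2 * l.1 + 1) % 2 = 0; omega), halfIdx_interleave]
    rfl)

/-- Coherence, evaluated after bonding maps on both sides. -/
theorem eventually_map_maps_eq (f : CoarseCoherentMap X Z) {m k : ℕ} (μ : MultiIndex Z.Idx m)
    (θ : Fin (k + 1) →o Fin (m + 1)) (κ : MultiIndex Z.Idx k) (e : μ.comp θ = κ) :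
    ∀ᶠ n in atTop, ∀ {w : Z.Idx} (h : w ≤ μ 0) (h' : w ≤ κ 0) {i : X.Idx}
      (hi : f.idx (μ (Fin.last m)) ≤ i) (hi' : f.idx (κ (Fin.last k)) ≤ i) (x : X.obj i)
      (t : Simplex k), Z.map h (f.maps n μ (X.map hi x, stdSimplex.map θ t)) =
        Z.map h' (f.maps n κ (X.map hi' x, t)) := by
  subst e
  filter_upwards [f.cohAt μ θ] with n hn w h h' i hi hi' x t
  refine (congrArg (Z.map h) (hn (X.map hi x) t)).trans ((Z.map_comp _ _ _).trans ?_)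
  exact congrArg (fun z => Z.map h' (f.maps n (μ.comp θ) (z, t))) (X.map_comp _ _ _)

theorem interleaveRep_last_le {m : ℕ} (ν : MultiIndex Z.Idx m) :
    interleaveRep Z ν (Fin.last _) ≤ Z.rep (Z.cls (ν (Fin.last m))) := by
  have h : ν (halfIdx (Fin.last (2 * m + 1))) ≤ ν (Fin.last m) := ν.monotone (Fin.le_last _)
  change (if (Fin.last (2 * m + 1)).1 % 2 = 0 then ν (halfIdx (Fin.last (2 * m + 1))) else
    Z.rep (Z.cls (ν (halfIdx (Fin.last (2 * m + 1)))))) ≤ _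
  split_ifs
  · exact h.trans (Z.le_rep_cls _)
  · exact Z.rep.monotone (Z.cls.monotone h)

theorem le_interleaveRep_zero {m : ℕ} (ν : MultiIndex Z.Idx m) : ν 0 ≤ interleaveRep Z ν 0 := by
  change _ ≤ if (0 : Fin (2 * m + 1 + 1)).1 % 2 = 0 then ν (halfIdx 0) else
    Z.rep (Z.cls (ν (halfIdx 0)))
  rw [if_pos (by rfl)]
  exact ν.monotone (Fin.zero_le _)

/-- `splitSimplex` as a continuous mapping. -/
noncomputable def splitMap (m : ℕ) : C(unitInterval × Simplex m, Simplex (2 * m + 1)) :=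
  ⟨fun x => splitSimplex x.1 x.2, continuous_splitSimplex⟩

/-- The mapping `(x, s, t) ↦ (x, splitSimplex (1 - s) t)`, with a bonding map applied to `x`. -/
noncomputable def splitCylinder (X : InvSystem.{u}) {i j : X.Idx} (h : i ≤ j) (m : ℕ) :
    C((X.obj j × unitInterval) × Simplex m, X.obj i × Simplex (2 * m + 1)) :=
  ((X.map h).comp (ContinuousMap.fst.comp ContinuousMap.fst)).prodMk
    ((splitMap m).comp (((⟨_, unitInterval.continuous_symm⟩ : C(unitInterval, unitInterval)).comp
      (ContinuousMap.snd.comp ContinuousMap.fst)).prodMk ContinuousMap.snd))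

/-- The homotopy from `f` to the extension of its restriction to representatives, by means of
the prism decomposition of `Δ^m × I`. -/
noncomputable def splitFamily (f : CoarseCoherentMap X Z) :
    CoherentFamily X.cylinder Z (f.idx.comp (Z.rep.comp Z.cls)) := fun n m ν =>
  ((Z.map (le_interleaveRep_zero ν)).comp (f.maps n (interleaveRep Z ν))).comp
    (splitCylinder X (f.idx.monotone (interleaveRep_last_le ν)) m)

theorem splitFamily_apply (f : CoarseCoherentMap X Z) (n : ℕ) {m : ℕ} (ν : MultiIndex Z.Idx m)
    (x : X.obj (f.idx (Z.rep (Z.cls (ν (Fin.last m)))))) (s : unitInterval) (t : Simplex m) :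
    f.splitFamily n ν ((x, s), t) = Z.map (le_interleaveRep_zero ν)
      (f.maps n (interleaveRep Z ν) (X.map (f.idx.monotone (interleaveRep_last_le ν)) x,
        splitSimplex (unitInterval.symm s) t)) := rfl

/-- The doubled map of θ need not be monotone, so coherence of f does not apply to it directly. It
becomes monotone on the support face of each split point. There are finitely many such faces, so one
bound on n serves for all, and both sides are compared on the support face. -/
theorem cohAt_splitFamily (f : CoarseCoherentMap X Z) {m k : ℕ} (ν : MultiIndex Z.Idx m)
    (θ : Fin (k + 1) →o Fin (m + 1)) : CohAt (X := X.cylinder) f.splitFamily ν θ := by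
  have h1 : ∀ᶠ n in atTop, ∀ (j : Fin (2 * k + 1 + 1))
      (φ : Fin (j.1 + 1) ↪o Fin (2 * k + 1 + 1)) (hφ : Monotone (doubleMap θ ∘ φ)),
      ∀ {w : Z.Idx} (h : w ≤ interleaveRep Z ν 0)
        (h' : w ≤ (interleaveRep Z (ν.comp θ)).comp φ.toOrderHom 0) {i : X.Idx}
        (hi : f.idx (interleaveRep Z ν (Fin.last _)) ≤ i)
        (hi' : f.idx ((interleaveRep Z (ν.comp θ)).comp φ.toOrderHom (Fin.last _)) ≤ i)
        (x : X.obj i) (t : Simplex j.1),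
        Z.map h (f.maps n (interleaveRep Z ν)
          (X.map hi x, stdSimplex.map (doubleMap θ ∘ φ) t)) =
        Z.map h' (f.maps n ((interleaveRep Z (ν.comp θ)).comp φ.toOrderHom) (X.map hi' x, t)) :=
    eventually_all.2 fun j => eventually_all.2 fun φ => eventually_all.2 fun hφ =>
      f.eventually_map_maps_eq (interleaveRep Z ν) ⟨_, hφ⟩ _
        (OrderHom.ext _ _ (funext fun l => interleaveRep_doubleMap ν θ (φ l)))
  have h2 : ∀ᶠ n in atTop, ∀ (j : Fin (2 * k + 1 + 1))
      (φ : Fin (j.1 + 1) ↪o Fin (2 * k + 1 + 1)),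
      ∀ {w : Z.Idx} (h : w ≤ interleaveRep Z (ν.comp θ) 0)
        (h' : w ≤ (interleaveRep Z (ν.comp θ)).comp φ.toOrderHom 0) {i : X.Idx}
        (hi : f.idx (interleaveRep Z (ν.comp θ) (Fin.last _)) ≤ i)
        (hi' : f.idx ((interleaveRep Z (ν.comp θ)).comp φ.toOrderHom (Fin.last _)) ≤ i)
        (x : X.obj i) (t : Simplex j.1),
        Z.map h (f.maps n (interleaveRep Z (ν.comp θ)) (X.map hi x, stdSimplex.map φ t)) =
        Z.map h' (f.maps n ((interleaveRep Z (ν.comp θ)).comp φ.toOrderHom) (X.map hi' x, t)) :=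
    eventually_all.2 fun j => eventually_all.2 fun φ =>
      f.eventually_map_maps_eq (interleaveRep Z (ν.comp θ)) φ.toOrderHom _ rfl
  filter_upwards [h1, h2] with n h1 h2
  rintro ⟨x, s⟩ t
  obtain ⟨j, φ, t', ht', hφ⟩ := exists_splitSimplex_eq (unitInterval.symm s) t
  have e1 : splitSimplex (unitInterval.symm s) (stdSimplex.map θ t) =
      stdSimplex.map (doubleMap θ ∘ φ) t' := by
    rw [splitSimplex_map, ← ht']
    exact stdSimplex.map_comp_apply (S := ℝ) _ _ t'
  have hw : ν 0 ≤ (interleaveRep Z (ν.comp θ)).comp φ.toOrderHom 0 :=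
    (ν.monotone (Fin.zero_le (θ 0))).trans ((le_interleaveRep_zero (ν.comp θ)).trans
      ((interleaveRep Z (ν.comp θ)).monotone (Fin.zero_le _)))
  have hi : f.idx ((interleaveRep Z (ν.comp θ)).comp φ.toOrderHom (Fin.last _)) ≤
      f.idx (Z.rep (Z.cls (ν (Fin.last m)))) :=
    f.idx.monotone (((interleaveRep Z (ν.comp θ)).monotone (Fin.le_last _)).trans
      ((interleaveRep_last_le (ν.comp θ)).trans (Z.rep.monotone (Z.cls.monotone
        (ν.monotone (Fin.le_last _))))))
  have e2 : f.splitFamily n ν ((x, s), stdSimplex.map θ t) = Z.map hw (f.maps n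
      ((interleaveRep Z (ν.comp θ)).comp φ.toOrderHom) (X.map hi x, t')) := by
    refine (f.splitFamily_apply n ν x s _).trans ?_
    rw [e1]
    exact h1 j φ (hφ θ) _ _ _ _ _ _
  refine e2.trans ?_
  have e4 := f.splitFamily_apply n (ν.comp θ) (X.map (f.idx.monotone (Z.rep.monotone
    (Z.cls.monotone (ν.monotone (Fin.le_last (θ (Fin.last k))))))) x) s t
  rw [← ht'] at e4
  refine Eq.trans ?_ (congrArg (Z.map (ν.monotone (Fin.zero_le (θ 0)))) e4).symm
  refine Eq.trans ?_ (Z.map_comp (ν.monotone (Fin.zero_le (θ 0))) _ _).symm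
  refine Eq.trans ?_ (congrArg (fun z => Z.map ((ν.monotone (Fin.zero_le (θ 0))).trans
    (le_interleaveRep_zero (ν.comp θ))) (f.maps n (interleaveRep Z (ν.comp θ))
      (z, stdSimplex.map φ t'))) (X.map_comp _ _ x)).symm
  exact (h2 j φ _ _ _ _ _ _).symm

/-- As s runs from 0 to 1, the mass moves from the indices ν_l to their representatives. These are
equivalent in the preorder, so the interleaved sequence is a multiindex of Z on which f is defined.
-/
theorem homotopic_ofAntisymm_toAntisymm (f : CoarseCoherentMap X Z) :
    f.Homotopic f.toAntisymm.ofAntisymm := by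
  refine ⟨ofCohAt (X := X.cylinder) _ f.splitFamily f.cohAt_splitFamily,
    fun ν => f.idx.monotone (Z.le_rep_cls ν), fun ν => le_rfl, fun {m} ν => ?_⟩
  filter_upwards [f.eventually_map_maps_eq _ _ _ (interleaveRep_zero ν),
    f.eventually_map_maps_eq _ _ _ (interleaveRep_one ν)] with n h0 h1 x t
  constructor
  · have e : splitSimplex (unitInterval.symm 0) t = stdSimplex.map (interleave 0) t := by
      rw [unitInterval.symm_zero, splitSimplex_one]
    refine (f.splitFamily_apply n ν x 0 t).trans ?_
    rw [e]
    exact (h0 _ le_rfl _ (f.idx.monotone (Z.le_rep_cls _)) _ _).trans (Z.map_id _ _)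
  · have e : splitSimplex (unitInterval.symm 1) t = stdSimplex.map (interleave 1) t := by
      rw [unitInterval.symm_one, splitSimplex_zero]
    refine (f.splitFamily_apply n ν x 1 t).trans ?_
    rw [e]
    exact h1 _ (Z.le_rep_cls _) _ le_rfl _ _

end CoarseCoherentMap

/-! ### The extension property implies the universal property for all systems. -/

namespace CoarseMorphism

/-- In a preorder with distinct equivalent elements, injective chains do not capture all
nondegenerate multiindices: a chain may oscillate between equivalent indices. The problem is
therefore solved over representatives, and both existence and uniqueness are carried back along the
prism homotopy. -/
theorem ExtensionProperty.isStrongExpansion {A : Type u} [TopologicalSpace A] {S : InvSystem.{u}}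
    {p : CoarseMorphism A S} (hp : p.ExtensionProperty) (hS : S.InHPol) :
    p.IsStrongExpansion := by
  refine ⟨hS, fun Z hZ h => ?_⟩
  have hZ' : Z.antisymm.InHPol := fun _ => hZ _
  have hM : ∀ a b : Z.antisymm.Idx, a ≤ b → b ≤ a → a = b := fun _ _ => le_antisymm
  obtain ⟨f', hf'⟩ := hp.exists_pull_homotopic hZ' hM h.toAntisymm
  have hf : h.Homotopic (p.pull f'.ofAntisymm) := by
    refine (h.homotopic_ofAntisymm_toAntisymm.trans hf'.ofAntisymm).trans ?_
    exact homotopic_of_eventually_eq fun ν => Eventually.of_forall fun n a t => rfl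
  refine ⟨f'.ofAntisymm, (p.factors_iff _ _).2 hf, fun g hg => ?_⟩
  have h1 : (p.pull g).Homotopic (p.pull f'.ofAntisymm) :=
    ((p.factors_iff _ _).1 hg).symm.trans hf
  have h2 : (p.pull g.toAntisymm).Homotopic (p.pull f'.ofAntisymm.toAntisymm) := by
    refine CoarseCoherentMap.Homotopic.trans ?_ (h1.toAntisymm.trans ?_)
    · exact homotopic_of_eventually_eq fun ν => Eventually.of_forall fun n a t => rfl
    · exact homotopic_of_eventually_eq fun ν => Eventually.of_forall fun n a t => rfl
  have h3 := hp.homotopic_of_pull hZ' hM h2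
  exact (g.homotopic_ofAntisymm_toAntisymm.trans h3.ofAntisymm).trans
    (f'.ofAntisymm.homotopic_ofAntisymm_toAntisymm).symm

end CoarseMorphism

theorem mainTheorem10 {X Y : Type u} [TopologicalSpace X] [TopologicalSpace Y]
    {S T : InvSystem.{u}} (p : CoarseMorphism X S) (q : CoarseMorphism Y T)
    (hq : (CoarseMorphism.oneProd X q).IsStrongExpansion)
    (hp : ∀ μ : T.Idx, (p.prodOne (T.obj μ)).IsStrongExpansion) :
    (p.prod q).IsStrongExpansion :=
  (CoarseMorphism.ExtensionProperty.prod hq.extensionProperty fun μ =>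
    -- The space X_λ × Y_μ is in HPol because it is a term of 𝐗 × Y_μ.
    (hp μ).extensionProperty).isStrongExpansion fun i => (hp i.2).1 i.1
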